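/- **Setting.** Let $X$ be a simplicial complete toric surface over $\mathbb C$ with ray generators $v_1,\dots,v_m\in\mathbb Z^2$, homogeneous coordinate ring $S=\mathbb C[z_1,\dots,z_m]$ graded by $Cl(X)$ with $\deg z_i=[\mathcal D_i]$, and irrelevant locus $Z\subset\mathbb C^m$, so that $X=(\mathbb C^m\setminus Z)/G$ with $G=\operatorname{Hom}(Cl(X),\mathbb C^*)$. Let $\alpha=\sum_{i=1}^m A_i\,dz_i\in H^0(X,\hat\Omega^1_X(\mathcal D))$, i.e. $A_i\in S$ is homogeneous of degree $\mathcal D-\mathcal D_i$ and $\sum_i a_iz_iA_i=0$ for every integral relation $\sum_i a_iv_i=0$. Let $T=\mathbb C[x_0,\dots,x_n]$ be the homogeneous coordinate ring of $\mathbb P^n$, and let $F=(F_1,\dots,F_m)$ be the polynomial lifting, of degree $\bar e=(e_1,\dots,e_m)$, of a rational map $\mathbb P^n\dashrightarrow X$: $F_i\in T$ is homogeneous of degree $e_i\ge 0$ and $\sum_i e_iv_i=0$. Write $F^*:S\to T$, $z_i\mapsto F_i$, and $\omega=F^*\alpha=\sum_i A_i(F)\,dF_i$. For a polynomial $1$-form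 $\beta$, let $J(\beta)$ be the ideal generated by its coefficients, $\mathscr C(d\beta)$ the ideal generated by the coefficients of $d\beta$, $K(\beta)=\operatorname{ann}(\overline{d\beta})+J(\beta)$ the Kupka ideal, where $\overline{d\beta}$ is the class of $d\beta$ in the Kähler $2$-forms modulo $J(\beta)$ (equivalently $K(\beta)=(J(\beta):\mathscr C(d\beta))$), and $I(\beta)=\{h:\ h\,d\beta=\beta\wedge\eta\text{ for some polynomial }1\text{-form }\eta\}$ the unfoldings ideal. Let $Sing(\alpha)\subset X$ be the zero set of $\alpha$ and $Sing(\omega)\subset\mathbb P^n$ the subscheme defined by $J(\omega)$. A point $[x]\in\mathbb P^n$ is a critical point of $F$ if $\operatorname{Im}(dF(x))$ together with the tangent space at $F(x)$ of its $G$-orbit, $\operatorname{span}\{(a_iF_i(x))_i:\ \sum_i a_iv_i=0\}$, does not span $\mathbb C^m$; for $F(x)\notin Z$ this says that $\mathbb P^n\dashrightarrow X$ is not submersive at $[x]$ (in orbifold charts where $X$ is singular), and base points, $F(x)\in Z$, are allowed. Let $C(F)\subset\mathbb P^n$ be the set of critical points, and $C_V(F)\subset X$ the set of images of the critical points with $F(x)\notin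 Z$. The pair $(F,\alpha)$ is *generic* if 1. $C_V(F)\cap Sing(\alpha)=\emptyset$, and the scheme $Sing(\omega)$ is reduced at every point of $C(F)$; 2. $J(\alpha)$ is radical and has codimension $\ge 2$; 3. $\mathscr C(d\alpha)$ has codimension $\ge 3$ (the unit ideal has infinite codimension). **Proposition.** If $(F,\alpha)$ is a generic pair and $F^*:S\to T$ is flat, then $$I(\omega)=K(\omega)=\langle A_1(F),\dots,A_m(F)\rangle .$$ -/

import Mathlib

open MvPolynomial

noncomputable section

namespace ToricFoliation

/-! ### Complete simplicial fans, class group, toric variety in homogeneous coordinates -/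

/-- The cone in `ℝ^q` generated by the vectors `v i`, `i ∈ σ`. -/
def cone {q m : ℕ} (v : Fin m → Fin q → ℤ) (σ : Finset (Fin m)) : Set (Fin q → ℝ) :=
  {x | ∃ c : Fin m → ℝ, (∀ i, 0 ≤ c i) ∧ x = fun k => ∑ i ∈ σ, c i * (v i k : ℝ)}

/-- A complete simplicial fan in `ℝ^q` with exactly `m` rays, numbered by `Fin m`.
A cone is recorded by the set of (indices of) its rays. -/
structure SimplicialCompleteFan (q m : ℕ) where
  /-- the ray generators `v_1, …, v_m` -/
  ray : Fin m → Fin q → ℤ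
  /-- the cones, each given by its set of rays -/
  cones : Set (Finset (Fin m))
  /-- ray generators are primitive lattice vectors (in particular nonzero) -/
  primitive : ∀ i (k : ℤ) (w : Fin q → ℤ), ray i = k • w → IsUnit k
  ray_mem : ∀ i, {i} ∈ cones
  face_mem : ∀ σ ∈ cones, ∀ τ ⊆ σ, τ ∈ cones
  simplicial : ∀ σ ∈ cones,
    LinearIndependent ℝ (fun i : σ => fun k => (ray i k : ℝ))
  inter : ∀ σ ∈ cones, ∀ τ ∈ cones, cone ray σ ∩ cone ray τ = cone ray (σ ∩ τ)
  complete : ∀ x : Fin q → ℝ, ∃ σ ∈ cones, x ∈ cone ray σ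

section Toric

variable {q m : ℕ} (Δ : SimplicialCompleteFan q m)

/-- The map `M = ℤ^q → ℤ^m`, `u ↦ (⟨u, v_i⟩)_i`, sending a character to its divisor. -/
def divMap : (Fin q → ℤ) →+ (Fin m → ℤ) where
  toFun u := fun i => ∑ k, u k * Δ.ray i k
  map_zero' := by ext i; simp
  map_add' u w := by ext i; simp [add_mul, Finset.sum_add_distrib]

/-- The Weil divisor class group `Cl(X) = ℤ^m / M`. -/
abbrev ClassGroup : Type := (Fin m → ℤ) ⧸ (divMap Δ).range

/-- The class of the torus invariant prime divisor `D_i`, which is the degree of `z_i`. -/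
def divClass (i : Fin m) : ClassGroup Δ := QuotientAddGroup.mk (Pi.single i 1)

/-- Integral relations `∑ a_i v_i = 0` among the ray generators. -/
def IsRelation (a : Fin m → ℤ) : Prop := ∑ i, a i • Δ.ray i = 0

/-- The zero locus `Z` in `ℂ^m` of the irrelevant ideal `⟨∏_{i ∉ σ} z_i⟩_σ`. -/
def irrelevantLocus : Set (Fin m → ℂ) :=
  {z | ∀ σ ∈ Δ.cones, ∏ i ∈ σᶜ, z i = 0}

/-- Membership in the group `G = Hom(Cl(X), ℂ^*) ⊆ (ℂ^*)^m`. -/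
def InG (g : Fin m → ℂˣ) : Prop := ∀ k, ∏ i, g i ^ Δ.ray i k = 1

/-- Two points of `ℂ^m ∖ Z` are identified when they lie in the same `G`-orbit. -/
def orbitSetoid : Setoid {z : Fin m → ℂ // z ∉ irrelevantLocus Δ} where
  r z w := ∃ g : Fin m → ℂˣ, InG Δ g ∧ ∀ i, (w : Fin m → ℂ) i = g i * (z : Fin m → ℂ) i
  iseqv :=
    { refl := fun z => ⟨fun _ => 1, fun k => by simp, fun i => by simp⟩
      symm := by
        rintro z w ⟨g, hg, h⟩
        refine ⟨fun i => (g i)⁻¹, fun k => ?_, fun i => ?_⟩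
        · simp only [inv_zpow, Finset.prod_inv_distrib, hg k, inv_one]
        · rw [h i]; simp
      trans := by
        rintro z w y ⟨g, hg, h⟩ ⟨g', hg', h'⟩
        refine ⟨fun i => g' i * g i, fun k => ?_, fun i => ?_⟩
        · simp only [mul_zpow, Finset.prod_mul_distrib, hg k, hg' k, mul_one]
        · rw [h' i, h i]; push_cast; ring }

/-- The (closed points of the) toric variety `X = (ℂ^m ∖ Z) / G`. -/
def ToricVariety : Type := Quotient (orbitSetoid Δ)

/-- The quotient map `ℂ^m ∖ Z → X`. -/
def toX (z : Fin m → ℂ) (hz : z ∉ irrelevantLocus Δ) : ToricVariety Δ :=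
  Quotient.mk (orbitSetoid Δ) ⟨z, hz⟩

end Toric

/-! ### Polynomial differential forms

The Kähler `1`-forms of `S = ℂ[z_i : i ∈ ι]` over `ℂ` form the free module on the `dz_i`; a form
`∑ A_i dz_i` is the vector of its coefficients `A`.  A `2`-form `θ` is the antisymmetric array of
its coefficients: the `(i, j)` entry is the coefficient of `dz_i ∧ dz_j`, i.e. `θ(∂_i, ∂_j)`. -/

section Forms

variable {ι : Type} [Fintype ι]

/-- `1`-forms `∑ A_i dz_i`. -/
abbrev OneForm (ι : Type) : Type := ι → MvPolynomial ι ℂ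

/-- Arrays of coefficients of `2`-forms. -/
abbrev TwoForm (ι : Type) : Type := ι → ι → MvPolynomial ι ℂ

/-- The exterior derivative of a `1`-form. -/
def extD (α : OneForm ι) : TwoForm ι := fun i j => pderiv i (α j) - pderiv j (α i)

/-- The wedge product of two `1`-forms. -/
def wedge (α η : OneForm ι) : TwoForm ι := fun i j => α i * η j - α j * η i

/-- The singular ideal `J(α)`, generated by the coefficients of `α`. -/
def singularIdeal (α : OneForm ι) : Ideal (MvPolynomial ι ℂ) := Ideal.span (Set.range α)

/-- The ideal of coefficients of a `2`-form. -/
def contentIdeal (θ : TwoForm ι) : Ideal (MvPolynomial ι ℂ) :=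
  Ideal.span {c | ∃ i j, c = θ i j}

/-- The Kupka ideal `K(α) = ann(dα) + J(α)`, where the annihilator is that of the class of `dα` in
`Ω² ⊗ S/J(α)`. -/
def kupkaIdeal (α : OneForm ι) : Ideal (MvPolynomial ι ℂ) :=
  Ideal.torsionOf (MvPolynomial ι ℂ) (ι → ι → MvPolynomial ι ℂ ⧸ singularIdeal α)
    (fun i j => Ideal.Quotient.mk (singularIdeal α) (extD α i j)) ⊔ singularIdeal α

/-- The unfoldings ideal `I(ω) = {h : h dω = ω ∧ η for some 1-form η}`. -/
def unfoldingsIdeal (ω : OneForm ι) : Ideal (MvPolynomial ι ℂ) where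
  carrier := {h | ∃ η : OneForm ι, h • extD ω = wedge ω η}
  zero_mem' := ⟨0, by ext1 i; ext1 j; simp [wedge]⟩
  add_mem' := by
    rintro h h' ⟨η, hη⟩ ⟨η', hη'⟩
    refine ⟨η + η', ?_⟩
    rw [add_smul, hη, hη']
    ext1 i; ext1 j
    simp only [wedge, Pi.add_apply]
    ring
  smul_mem' := by
    rintro c h ⟨η, hη⟩
    refine ⟨c • η, ?_⟩
    rw [smul_eq_mul, mul_smul, hη]
    ext1 i; ext1 j
    simp only [wedge, Pi.smul_apply, smul_eq_mul]
    ring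

/-- The pullback `F^*α = ∑ A_i(F) dF_i` of a `1`-form by a polynomial map `F`. -/
def pullback {κ : Type} (F : ι → MvPolynomial κ ℂ) (α : OneForm ι) : OneForm κ :=
  fun j => ∑ i, aeval F (α i) * pderiv j (F i)

/-- An ideal `J` defines a reduced scheme at the point `x`: its extension to the local ring at `x`
is a radical ideal. -/
def IsReducedAt (J : Ideal (MvPolynomial ι ℂ)) (x : ι → ℂ) : Prop :=
  haveI : (RingHom.ker (eval x)).IsPrime := RingHom.ker_isPrime _
  (J.map (algebraMap (MvPolynomial ι ℂ) (Localization.AtPrime (RingHom.ker (eval x))))).IsRadical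

end Forms

/-! ### Twisted forms on `X`, liftings of rational maps `ℙⁿ ⇢ X`, generic pairs -/

section Pairs

variable {q m n : ℕ} (Δ : SimplicialCompleteFan q m)

/-- `α ∈ H⁰(X, Ω̂¹_X(D))`: `α = ∑ A_i dz_i` with `A_i` homogeneous of degree `D - D_i`, and `α` is
annihilated by the radial vector fields `∑ a_i z_i ∂/∂z_i`. -/
structure IsTwistedForm (D : ClassGroup Δ) (α : OneForm (Fin m)) : Prop where
  homogeneous : ∀ i, IsWeightedHomogeneous (divClass Δ) (α i) (D - divClass Δ i)
  descends : ∀ a : Fin m → ℤ, IsRelation Δ a → ∑ i, (a i : MvPolynomial (Fin m) ℂ) * X i * α i = 0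

/-- `F = (F_1, …, F_m)` is a polynomial map of degree `e`, where `e` is a relation among the rays:
`F_i` is homogeneous of degree `e_i`. -/
structure IsPolynomialLifting (e : Fin m → ℕ) (F : Fin m → MvPolynomial (Fin (n + 1)) ℂ) :
    Prop where
  relation : IsRelation Δ (fun i => (e i : ℤ))
  homogeneous : ∀ i, (F i).IsHomogeneous (e i)

/-- The value `F(x) ∈ ℂ^m`. -/
def evalMap (F : Fin m → MvPolynomial (Fin (n + 1)) ℂ) (x : Fin (n + 1) → ℂ) : Fin m → ℂ :=
  fun i => eval x (F i)

/-- The Jacobian matrix of `F` at `x`. -/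
def jacobian (F : Fin m → MvPolynomial (Fin (n + 1)) ℂ) (x : Fin (n + 1) → ℂ) :
    Matrix (Fin m) (Fin (n + 1)) ℂ :=
  Matrix.of fun i j => eval x (pderiv j (F i))

/-- The tangent space at `z ∈ ℂ^m` of its `G`-orbit, spanned by the radial vector fields. -/
def orbitTangent (z : Fin m → ℂ) : Submodule ℂ (Fin m → ℂ) :=
  Submodule.span ℂ {w | ∃ a : Fin m → ℤ, IsRelation Δ a ∧ w = fun i => (a i : ℂ) * z i}

/-- The set `C(F)` of critical points of `F`, as a set of representatives `x ∈ ℂ^{n+1} ∖ {0}` of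
points of `ℙⁿ`: the differential of `F` at `x`, followed by the projection of `ℂ^m` modulo the
tangent space of the `G`-orbit of `F(x)`, is not surjective.  For `F(x) ∉ Z` that projection is the
differential of `ℂ^m ∖ Z → X` (in orbifold charts if `X` is singular), so this says that the
rational map `ℙⁿ ⇢ X` is not submersive at `[x]`; the condition also makes sense, in terms of the
lifting `F`, at the base points `F(x) ∈ Z`. -/
def criticalPoints (F : Fin m → MvPolynomial (Fin (n + 1)) ℂ) : Set (Fin (n + 1) → ℂ) :=
  {x | x ≠ 0 ∧
    LinearMap.range (jacobian F x).mulVecLin ⊔ orbitTangent Δ (evalMap F x) ≠ ⊤}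

/-- The set `C_V(F) ⊆ X` of critical values of the rational map `ℙⁿ ⇢ X` induced by `F`. -/
def criticalValues (F : Fin m → MvPolynomial (Fin (n + 1)) ℂ) : Set (ToricVariety Δ) :=
  {p | ∃ x ∈ criticalPoints Δ F, ∃ hx : evalMap F x ∉ irrelevantLocus Δ, p = toX Δ _ hx}

/-- The singular set `Sing(α) = {x ∈ X : α(x) = 0}`. -/
def singularSet (α : OneForm (Fin m)) : Set (ToricVariety Δ) :=
  {p | ∃ (z : Fin m → ℂ) (hz : z ∉ irrelevantLocus Δ), (∀ i, eval z (α i) = 0) ∧ p = toX Δ z hz}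

/-- `(F, α)` is a generic pair; here `ω = F^*α`.  Reducedness of `Sing(ω) ⊆ ℙⁿ` at `[x]` is tested
on the affine cone `{J(ω) = 0} ⊆ ℂ^{n+1}` at `x ≠ 0`. -/
structure IsGenericPair (F : Fin m → MvPolynomial (Fin (n + 1)) ℂ) (α : OneForm (Fin m)) :
    Prop where
  criticalValues_inter : criticalValues Δ F ∩ singularSet Δ α = ∅
  reduced_along : ∀ x ∈ criticalPoints Δ F, IsReducedAt (singularIdeal (pullback F α)) x
  radical : (singularIdeal α).IsRadical
  two_le_height : 2 ≤ (singularIdeal α).height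
  three_le_height : 3 ≤ (contentIdeal (extD α)).height

end Pairs

end ToricFoliation

end

noncomputable section

namespace ToricFoliation

/-! ### Heights of primes in polynomial rings -/

section Heights

variable {A : Type*} [CommRing A]

-- Let L be the ideal of the A_i(F). Any three rays in the plane are dependent; contracting α ∧ dα
-- with the corresponding radial field, which kills α and sends dα to a multiple of α, gives α ∧ dα
-- = 0 (`IsTwistedForm.integrable`). Contracting once more with ∂_l and pulling back gives A_l(F) dω
-- = ω ∧ G_l with G_l = F^*(i_{∂_l} dα), so L ⊆ I(ω), and I(ω) ⊆ K(ω) is formal. Since J(ω) ⊆ L, the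
-- inclusion K(ω) ⊆ L holds as soon as no associated prime Q of L contains all coefficients of dω
-- (`kupkaIdeal_le`, `exists_extD_pullback_notMem`).
--
-- Suppose Q does. By flatness its contraction p to S is a minimal prime of the radical ideal J(α).
-- The codimension of dα and the geometry of the fan give an entry D = (dα)_{ij} outside p
-- (`Descends.exists_extD_notMem`), and α ∧ dα = 0 then shows that A_i, A_j generate J(α) at p.
-- Removing a common factor that is a unit at p leaves a coprime pair, whose pullbacks f, g remain
-- coprime by flatness. So Q is associated to (f, g), and unmixedness (`PairUnmixed`) gives it
-- height two.
--
-- As Q does not contain all variables, V(Q) has a nonzero point x. At a noncritical x the Jacobian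
-- columns and the radial vectors span, and dα vanishes on all of them along V(Q), against D(F) ∉ Q.
-- So x is critical and Sing(ω) is reduced there. Write ω = φ ω' with ω' free of common factors. If
-- ω' vanishes on V(Q), reducedness forces J(ω) = Q at Q, which the decomposability of dα modulo
-- J(α) excludes (`exists_reduced_form_notMem`). If not, the fields ω'_r ∂_k − ω'_k ∂_r preserve L
-- at Q, hence Q, and a prime tangent to a nonvanishing hyperplane field in this way has height at
-- most one (`height_le_one_of_reduced_form_notMem`).

attribute [local instance] Polynomial.algebra Polynomial.isLocalization in
theorem height_le_height_comap_C_add_one [IsNoetherianRing A] (Q : Ideal (Polynomial A))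
    [Q.IsPrime] : Q.height ≤ (Q.comap Polynomial.C).height + 1 := by
  set p := Q.comap (Polynomial.C : A →+* Polynomial A) with hp
  have hpp : p.IsPrime := Ideal.comap_isPrime _ _
  let Ap := Localization.AtPrime p
  have disj : Disjoint (p.primeCompl.map (Polynomial.C : A →+* Polynomial A) : Set (Polynomial A))
      Q := by
    refine Set.disjoint_left.mpr fun a ⟨b, hb⟩ ha ↦ hb.1 ?_
    simp only [hp, SetLike.mem_coe, Ideal.mem_comap]
    rw [hb.2]; exact ha
  -- Inverting the complement of p in A preserves the height of Q, which is then bounded by dim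
  -- A_p[X] = dim A_p + 1.
  have h1 : Q.height = (Q.map (algebraMap (Polynomial A) (Polynomial Ap))).height := by
    rw [IsLocalization.height_map_of_disjoint (p.primeCompl.map (Polynomial.C : A →+* _)) _ disj]
  have hprime : (Q.map (algebraMap (Polynomial A) (Polynomial Ap))).IsPrime :=
    IsLocalization.isPrime_of_isPrime_disjoint (p.primeCompl.map (Polynomial.C : A →+* _)) _ _
      inferInstance disj
  have h2 := Ideal.height_le_ringKrullDim_of_isPrime
    (I := Q.map (algebraMap (Polynomial A) (Polynomial Ap)))
  have : IsNoetherianRing Ap := IsLocalization.isNoetherianRing p.primeCompl Ap inferInstance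
  rw [Polynomial.ringKrullDim_of_isNoetherianRing,
    IsLocalization.AtPrime.ringKrullDim_eq_height p Ap, ← h1] at h2
  exact_mod_cast h2

/-- The extended prime lies over p and is zero in its fibre, so the fibre contributes nothing to the
height bound. -/
theorem height_map_C_le [IsNoetherianRing A] (p : Ideal A) [p.IsPrime] :
    (p.map (Polynomial.C : A →+* Polynomial A)).height ≤ p.height := by
  have hP : (p.map (Polynomial.C : A →+* Polynomial A)).IsPrime :=
    Ideal.isPrime_map_C_of_isPrime
  have : (p.map (Polynomial.C : A →+* Polynomial A)).LiesOver p := by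
    refine ⟨?_⟩
    ext x
    simp only [Ideal.under_def, Ideal.mem_comap, Polynomial.algebraMap_eq, Ideal.mem_map_C_iff]
    constructor
    · intro hx n
      rw [Polynomial.coeff_C]
      split_ifs <;> simp [hx]
    · intro h; simpa using h 0
  have h := Ideal.height_le_height_add_of_liesOver p (p.map (Polynomial.C : A →+* Polynomial A))
  have h0 : ((p.map (Polynomial.C : A →+* Polynomial A)).map
      (Ideal.Quotient.mk <| p.map (algebraMap A (Polynomial A)))) = ⊥ := by
    rw [Polynomial.algebraMap_eq, Ideal.map_quotient_self]
  rw [h0] at h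
  have : Nontrivial (Polynomial A ⧸ p.map (algebraMap A (Polynomial A))) :=
    Ideal.Quotient.nontrivial_iff.mpr hP.ne_top
  simpa using h

end Heights

/-! ### Coprime pairs in a factorial ring and their colon ideals. -/

section UFD

variable {A : Type*} [CommRing A] [IsDomain A] [UniqueFactorizationMonoid A]

omit [IsDomain A] [UniqueFactorizationMonoid A] in
theorem height_span_prime_le_one [IsNoetherianRing A] {π : A} (h : Prime π) :
    (Ideal.span {π}).height ≤ 1 :=
  Ideal.height_span_singleton_le_one h.not_isUnit

theorem exists_isRelPrime_of_two_le_height [IsNoetherianRing A] {p : Ideal A} [p.IsPrime]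
    (hp : ¬ p.height ≤ 1) : ∃ π ∈ p, ∃ r ∈ p, Prime π ∧ ¬ π ∣ r := by
  have hbot : p ≠ ⊥ := by
    rintro rfl
    exact hp (by simp)
  obtain ⟨π, hπ, hpr⟩ := Ideal.IsPrime.exists_mem_prime_of_ne_bot ‹_› hbot
  by_contra! h
  apply hp
  have : p ≤ Ideal.span {π} := fun r hr => Ideal.mem_span_singleton.mpr (h π hπ r hr hpr)
  exact (Ideal.height_mono this).trans (height_span_prime_le_one hpr)

theorem two_le_height_of_isRelPrime [IsNoetherianRing A] {p : Ideal A} [p.IsPrime] {f g : A}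
    (hf : f ∈ p) (hg : g ∈ p) (h : IsRelPrime f g) : ¬ p.height ≤ 1 := by
  intro hp
  rcases eq_or_ne p ⊥ with rfl | hbot
  · rw [Ideal.mem_bot] at hf hg
    subst hf; subst hg
    exact not_isUnit_zero (h (dvd_refl 0) (dvd_refl 0))
  obtain ⟨π, hπ, hpr⟩ := Ideal.IsPrime.exists_mem_prime_of_ne_bot ‹_› hbot
  have h1 : p.height = 1 := by
    refine le_antisymm hp (Order.one_le_iff_pos.mpr (pos_iff_ne_zero.mpr ?_))
    rw [Ne, Ideal.height_eq_zero_iff_eq_bot]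
    exact hbot
  have := Ideal.eq_span_singleton_of_height_eq_one h1 hπ hpr
  rw [this, Ideal.mem_span_singleton] at hf hg
  exact hpr.not_isUnit (h hf hg)

/-- Prime avoidance: a prime of height at least two is not covered by the finitely many principal
primes generated by the factors of f. -/
theorem exists_isRelPrime_mem [IsNoetherianRing A] {p : Ideal A} [p.IsPrime]
    (hp : ¬ p.height ≤ 1) {f : A} (hf : f ≠ 0) : ∃ h ∈ p, IsRelPrime h f := by
  classical
  let s := (UniqueFactorizationMonoid.factors f).toFinset
  have hs : ∀ π ∈ s, Prime π := fun π hπ =>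
    UniqueFactorizationMonoid.prime_of_factor π (by simpa [s] using hπ)
  have hnot : ¬ ((p : Set A) ⊆ ⋃ i ∈ (↑s : Set A), (Ideal.span {i} : Ideal A)) := by
    rw [Ideal.subset_union_prime (f := fun i : A => Ideal.span {i}) 0 0]
    · rintro ⟨π, hπ, hle⟩
      exact hp ((Ideal.height_mono hle).trans (height_span_prime_le_one (hs π hπ)))
    · intro i hi _ _
      exact (Ideal.span_singleton_prime (hs i hi).ne_zero).mpr (hs i hi)
  rw [Set.not_subset] at hnot
  obtain ⟨h, hh, hn⟩ := hnot
  refine ⟨h, hh, ?_⟩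
  refine ((UniqueFactorizationMonoid.isRelPrime_iff_no_prime_factors hf).mpr ?_).symm
  intro d hdf hdh hd
  obtain ⟨π, hπ, hassoc⟩ :=
    UniqueFactorizationMonoid.exists_mem_factors_of_dvd hf hd.irreducible hdf
  refine hn (Set.mem_biUnion (x := π) (by simpa [s] using hπ) ?_)
  exact Ideal.mem_span_singleton.mpr (hassoc.symm.dvd.trans hdh)

/-- The ideal `Q` is the annihilator of the class of `y` modulo `(f, g)`. -/
def IsPairColon (Q : Ideal A) (f g y : A) : Prop :=
  ∀ r, r ∈ Q ↔ r * y ∈ Ideal.span {f, g}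

omit [IsDomain A] [UniqueFactorizationMonoid A] in
theorem IsPairColon.swap {Q : Ideal A} {f g y : A} (h : IsPairColon Q f g y) :
    IsPairColon Q g f y := by
  intro r
  rw [h r, Set.pair_comm]

omit [IsDomain A] in
-- Linkage: if h y = u f + w g, then w plays for (f, h) the part of y for (f, g). Both inclusions
-- come from cancelling a factor by coprimality.
theorem IsPairColon.exchange {Q : Ideal A} {f g h y : A} (hQ : IsPairColon Q f g y)
    (hh : h ∈ Q) (hfg : IsRelPrime f g) (hfh : IsRelPrime f h) :
    ∃ w, IsPairColon Q f h w := by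
  obtain ⟨u, w, huw⟩ := Ideal.mem_span_pair.mp ((hQ h).mp hh)
  refine ⟨w, fun r => ?_⟩
  rw [hQ r]
  simp only [Ideal.mem_span_pair]
  constructor
  · rintro ⟨s, t, hst⟩
    have h1 : g * (r * w - h * t) = f * (h * s - r * u) := by linear_combination r * huw - h * hst
    have h2 : f ∣ r * w - h * t := hfg.dvd_of_dvd_mul_left (Dvd.intro _ h1.symm)
    obtain ⟨c, hc⟩ := h2
    exact ⟨c, t, by linear_combination -hc⟩
  · rintro ⟨c, d, hcd⟩
    have h1 : h * (r * y - d * g) = f * (r * u + c * g) := by linear_combination (-r) * huw - g * hcd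
    obtain ⟨e, he⟩ := hfh.dvd_of_dvd_mul_left (Dvd.intro _ h1.symm)
    exact ⟨e, d, by linear_combination -he⟩

/-- Being associated to a coprime pair inside Q does not depend on the pair. The passage uses an
auxiliary h ∈ Q coprime to both f and f', in three exchanges. -/
theorem IsPairColon.exchange_pair [IsNoetherianRing A] {Q : Ideal A} [Q.IsPrime]
    {f g f' g' y : A} (hQ : IsPairColon Q f g y) (hht : ¬ Q.height ≤ 1)
    (hfg : IsRelPrime f g) (hfg' : IsRelPrime f' g') (hf' : f' ∈ Q) (hg' : g' ∈ Q) :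
    ∃ w, IsPairColon Q f' g' w := by
  have hmem : f ∈ Q := (hQ f).mpr
    (Ideal.mul_mem_right _ _ (Ideal.subset_span (Set.mem_insert _ _)))
  have hmemg : g ∈ Q := (hQ g).mpr
    (Ideal.mul_mem_right _ _ (Ideal.subset_span (Set.mem_insert_of_mem _ rfl)))
  have key : ∀ {a b : A}, IsRelPrime a b → a ∈ Q → b ∈ Q → a ≠ 0 := by
    rintro a b hab ha hb rfl
    exact ‹Q.IsPrime›.ne_top (Ideal.eq_top_of_isUnit_mem _ hb (hab (dvd_zero _) dvd_rfl))
  have hf0 := key hfg hmem hmemg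
  have hf0' := key hfg' hf' hg'
  obtain ⟨h, hh, hrel⟩ := exists_isRelPrime_mem hht (mul_ne_zero hf0 hf0')
  have hr1 : IsRelPrime f h := (hrel.of_mul_right_left).symm
  have hr2 : IsRelPrime h f' := hrel.of_mul_right_right
  obtain ⟨w1, h1⟩ := hQ.exchange hh hfg hr1
  obtain ⟨w2, h2⟩ := h1.swap.exchange hf' hr1.symm hr2
  exact h2.swap.exchange hg' hr2.symm hfg'

end UFD

/-- Every associated prime of an ideal generated by two relatively prime elements has height at
most `2`. -/
def PairUnmixed (A : Type*) [CommRing A] : Prop :=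
  ∀ (f g y : A) (Q : Ideal A), Q.IsPrime → IsRelPrime f g → IsPairColon Q f g y → Q.height ≤ 2

theorem PairUnmixed.of_ringEquiv {A B : Type*} [CommRing A] [CommRing B] (e : A ≃+* B)
    (h : PairUnmixed A) : PairUnmixed B := by
  intro f g y Q hQ hfg hcol
  rw [← RingEquiv.height_comap e Q]
  refine h (e.symm f) (e.symm g) (e.symm y) (Q.comap e) (Ideal.comap_isPrime _ _) ?_ ?_
  · intro d h1 h2
    have h1' := map_dvd e h1
    have h2' := map_dvd e h2
    rw [RingEquiv.apply_symm_apply] at h1' h2'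
    have := (hfg h1' h2').map e.symm
    simpa using this
  · intro r
    rw [Ideal.mem_comap, hcol]
    simp only [Ideal.mem_span_pair]
    constructor
    · rintro ⟨a, b, hab⟩
      refine ⟨e.symm a, e.symm b, e.injective ?_⟩
      simpa using hab
    · rintro ⟨a, b, hab⟩
      refine ⟨e a, e b, ?_⟩
      have := congrArg e hab
      simpa using this

theorem pairUnmixed_of_field (K : Type*) [Field K] : PairUnmixed K := by
  intro f g y Q hQ _ _
  rw [(Ideal.eq_bot_or_top Q).resolve_right hQ.ne_top]
  simp

/-! ### Unmixedness passes to polynomial rings. -/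

section Polynomial

open scoped Polynomial

variable {A : Type*} [CommRing A]

/-- Associated primes of I[X] are extended from associated primes of I: after multiplying y by a
suitable constant outside q, its highest coefficient outside I has annihilator exactly q. -/
theorem exists_colon_eq_of_polynomial_colon {I : Ideal A} {q : Ideal A} [q.IsPrime]
    {Q : Ideal A[X]} [Q.IsPrime] (hq : q = Q.comap Polynomial.C) {y : A[X]}
    (hQ : ∀ r, r ∈ Q ↔ r * y ∈ I.map Polynomial.C) :
    (∃ b, ∀ a, a ∈ q ↔ a * b ∈ I) ∧ Q = q.map Polynomial.C := by
  classical
  have hqc : ∀ a, a ∈ q ↔ ∀ n, a * y.coeff n ∈ I := by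
    intro a
    rw [hq, Ideal.mem_comap, hQ, Ideal.mem_map_C_iff]
    simp
  -- The constant c kills modulo I every coefficient whose annihilator is not inside q; a finite
  -- product of elements outside q suffices.
  have hcolon : ∀ z : A[X], ∃ c ∉ q, ∀ n, c * z.coeff n ∈ I ∨ ∀ a, a * (c * z.coeff n) ∈ I → a ∈ q := by
    intro z
    have : ∀ s : Finset ℕ, ∃ c ∉ q, ∀ n ∈ s, c * z.coeff n ∈ I ∨
        ∀ a, a * z.coeff n ∈ I → a ∈ q := by
      intro s
      induction s using Finset.induction_on with
      | empty => exact ⟨1, fun h => ‹q.IsPrime›.ne_top ((Ideal.eq_top_iff_one _).mpr h), by simp⟩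
      | insert n s hn ih =>
        obtain ⟨c, hc, h⟩ := ih
        by_cases hz : ∀ a, a * z.coeff n ∈ I → a ∈ q
        · refine ⟨c, hc, fun k hk => ?_⟩
          rcases Finset.mem_insert.mp hk with rfl | hk
          · exact Or.inr hz
          · exact h k hk
        · push Not at hz
          obtain ⟨a, ha, haq⟩ := hz
          refine ⟨a * c, fun hm => (‹q.IsPrime›.mem_or_mem hm).elim haq hc, fun k hk => ?_⟩
          rcases Finset.mem_insert.mp hk with rfl | hk
          · left
            rw [mul_right_comm]
            exact Ideal.mul_mem_right _ _ ha
          · rcases h k hk with h | h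
            · left; rw [mul_assoc]; exact Ideal.mul_mem_left _ _ h
            · exact Or.inr h
    obtain ⟨c, hc, h⟩ := this z.support
    refine ⟨c, hc, fun n => ?_⟩
    by_cases hn : n ∈ z.support
    · rcases h n hn with h | h
      · exact Or.inl h
      · right
        intro a ha
        have := h (a * c) (by rwa [mul_assoc])
        exact (‹q.IsPrime›.mem_or_mem this).resolve_right hc
    · left
      rw [Polynomial.notMem_support_iff.mp hn]
      simp
  obtain ⟨c, hc, hy⟩ := hcolon y
  have hcy : ∃ N, c * y.coeff N ∉ I ∧ ∀ n > N, c * y.coeff n ∈ I := by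
    have hne : (y.support.filter fun n => c * y.coeff n ∉ I).Nonempty := by
      by_contra hemp
      rw [Finset.not_nonempty_iff_eq_empty, Finset.filter_eq_empty_iff] at hemp
      apply hc
      rw [hqc]
      intro n
      by_cases hn : n ∈ y.support
      · simpa using hemp hn
      · rw [Polynomial.notMem_support_iff.mp hn]; simp
    refine ⟨_, (Finset.mem_filter.mp (Finset.max'_mem _ hne)).2, fun n hn => ?_⟩
    by_contra hcon
    have hns : n ∈ y.support := by
      rw [Polynomial.mem_support_iff]
      intro h0
      rw [h0] at hcon
      simp at hcon
    exact absurd (Finset.le_max' _ n (Finset.mem_filter.mpr ⟨hns, hcon⟩)) (not_le.mpr hn)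
  obtain ⟨N, hN, hN'⟩ := hcy
  have hNq : ∀ a, a * (c * y.coeff N) ∈ I → a ∈ q := (hy N).resolve_left hN
  refine ⟨⟨c * y.coeff N, fun a => ⟨fun ha => ?_, hNq a⟩⟩, ?_⟩
  · rw [mul_left_comm]
    exact Ideal.mul_mem_left _ _ ((hqc a).mp ha N)
  · apply le_antisymm
    · intro r hr
      rw [Ideal.mem_map_C_iff]
      have hprod : ∀ n, (r * (Polynomial.C c * y)).coeff n ∈ I := by
        intro n
        have h1 := (hQ r).mp hr
        have h2 : r * (Polynomial.C c * y) ∈ I.map Polynomial.C := by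
          rw [mul_left_comm]; exact Ideal.mul_mem_left _ _ h1
        exact Ideal.mem_map_C_iff.mp h2 n
      by_contra! hbad
      have hne : (r.support.filter fun n => r.coeff n ∉ q).Nonempty := by
        obtain ⟨n, hn⟩ := hbad
        refine ⟨n, Finset.mem_filter.mpr ⟨?_, hn⟩⟩
        rw [Polynomial.mem_support_iff]
        intro h0
        rw [h0] at hn
        simp at hn
      set M := Finset.max' _ hne with hM
      have hMr : r.coeff M ∉ q := (Finset.mem_filter.mp (Finset.max'_mem _ hne)).2
      have hMmax : ∀ n > M, r.coeff n ∈ q := by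
        intro n hn
        by_contra hcon
        have hns : n ∈ r.support := by
          rw [Polynomial.mem_support_iff]
          intro h0
          rw [h0] at hcon
          simp at hcon
        exact absurd (Finset.le_max' _ n (Finset.mem_filter.mpr ⟨hns, hcon⟩)) (not_le.mpr hn)
      apply hMr
      apply hNq
      -- M is the last index where r leaves q and N the last where c y leaves I, so every other term
      -- of the coefficient M + N already lies in I.
      have h3 := hprod (M + N)
      rw [Polynomial.coeff_mul] at h3
      have hmem : (M, N) ∈ Finset.HasAntidiagonal.antidiagonal (M + N) := by simp
      rw [← Finset.add_sum_erase _ _ hmem, Polynomial.coeff_C_mul] at h3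
      refine (Submodule.add_mem_iff_left _ (Submodule.sum_mem _ ?_)).mp h3
      rintro ⟨i, j⟩ hij
      rw [Finset.mem_erase, Finset.HasAntidiagonal.mem_antidiagonal] at hij
      simp only [Polynomial.coeff_C_mul]
      rcases lt_or_ge N j with h | h
      · exact Ideal.mul_mem_left _ _ (hN' j h)
      · have hi : M < i := by
          have hne : ¬ (i = M ∧ j = N) := fun hh => hij.1 (by rw [hh.1, hh.2])
          have := hij.2
          simp only at this
          omega
        rw [mul_left_comm]
        exact Ideal.mul_mem_left _ _ ((hqc _).mp (hMmax i hi) j)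
    · rw [hq]
      exact Ideal.map_comap_le

/-- If the contraction q has height at most one, Q has height at most two. Otherwise q contains a
coprime pair of constants; exchanging (f, g) for it makes Q extended from q, and q is associated to
that pair in A. -/
theorem PairUnmixed.polynomial [IsDomain A] [UniqueFactorizationMonoid A] [IsNoetherianRing A]
    (h : PairUnmixed A) : PairUnmixed A[X] := by
  intro f g y Q hQ hfg hcol
  set q := Q.comap (Polynomial.C : A →+* A[X]) with hq
  have hqp : q.IsPrime := Ideal.comap_isPrime _ _
  have hle := height_le_height_comap_C_add_one Q
  rw [← hq] at hle
  by_cases hq1 : q.height ≤ 1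
  · refine hle.trans ((add_le_add_left hq1 1).trans ?_)
    norm_num
  obtain ⟨π, hπ, r, hr, hpr, hndvd⟩ := exists_isRelPrime_of_two_le_height hq1
  have hrel : IsRelPrime π r := by
    rw [hpr.irreducible.isRelPrime_iff_not_dvd]; exact hndvd
  have hrelC : IsRelPrime (Polynomial.C π) (Polynomial.C r) := by
    rw [(Polynomial.prime_C_iff.mpr hpr).irreducible.isRelPrime_iff_not_dvd]
    intro hd
    apply hndvd
    have := (Polynomial.C_dvd_iff_dvd_coeff _ _).mp hd 0
    simpa using this
  by_cases hQ1 : Q.height ≤ 1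
  · exact hQ1.trans (by norm_num)
  obtain ⟨w, hw⟩ := hcol.exchange_pair hQ1 hfg hrelC hπ hr
  have hI : (Ideal.span {π, r}).map (Polynomial.C : A →+* A[X]) = Ideal.span {Polynomial.C π, Polynomial.C r} := by
    rw [Ideal.map_span, Set.image_pair]
  obtain ⟨⟨b, hb⟩, hQq⟩ := exists_colon_eq_of_polynomial_colon (I := Ideal.span {π, r}) hq (y := w)
    (fun s => by rw [hI]; exact hw s)
  rw [hQq]
  exact (height_map_C_le q).trans (h π r b q hqp hrel hb)

end Polynomial

theorem pairUnmixed_mvPolynomial (K : Type*) [Field K] (n : ℕ) :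
    PairUnmixed (MvPolynomial (Fin n) K) := by
  induction n with
  | zero =>
    exact (pairUnmixed_of_field K).of_ringEquiv
      (MvPolynomial.isEmptyAlgEquiv K (Fin 0)).symm.toRingEquiv
  | succ n ih =>
    exact ih.polynomial.of_ringEquiv (MvPolynomial.finSuccEquiv K n).symm.toRingEquiv

/-! ### The differentials of algebraically independent polynomials -/

section Jacobian

variable {ι κ : Type} [Fintype ι] [Fintype κ] {k : Type} [Field k] [CharZero k]

/-- The gradient of a polynomial, with entries in the fraction field. -/
def gradient (κ : Type) (k : Type) [Field k] :
    MvPolynomial κ k →ₗ[k] (κ → FractionRing (MvPolynomial κ k)) where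
  toFun p j := algebraMap _ _ (pderiv j p)
  map_add' p q := by ext j; simp
  map_smul' a p := by
    ext j
    simp only [Derivation.map_smul, RingHom.id_apply, Pi.smul_apply]
    rw [Algebra.smul_def, map_mul, Algebra.smul_def,
      IsScalarTower.algebraMap_apply k (MvPolynomial κ k) (FractionRing (MvPolynomial κ k))]

omit [Fintype κ] [CharZero k] in
theorem gradient_mul (p q : MvPolynomial κ k) :
    gradient κ k (p * q) =
      algebraMap _ (FractionRing (MvPolynomial κ k)) p • gradient κ k q
        + algebraMap _ (FractionRing (MvPolynomial κ k)) q • gradient κ k p := by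
  ext j
  simp only [gradient, LinearMap.coe_mk, AddHom.coe_mk, Derivation.leibniz, smul_eq_mul, map_add,
    map_mul, Pi.add_apply, Pi.smul_apply]

omit [Fintype κ] [CharZero k] in
theorem gradient_mem_span_of_mem_adjoin {s : Set (MvPolynomial κ k)} {p : MvPolynomial κ k}
    (hp : p ∈ Algebra.adjoin k s) :
    gradient κ k p ∈ Submodule.span (FractionRing (MvPolynomial κ k)) (gradient κ k '' s) := by
  induction hp using Algebra.adjoin_induction with
  | mem x hx => exact Submodule.subset_span ⟨x, hx, rfl⟩
  | algebraMap r =>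
    have : gradient κ k (algebraMap k (MvPolynomial κ k) r) = 0 := by
      ext j
      simp [gradient, MvPolynomial.algebraMap_eq]
    rw [this]
    exact Submodule.zero_mem _
  | add x y _ _ hx hy => rw [map_add]; exact Submodule.add_mem _ hx hy
  | mul x y _ _ hx hy =>
    rw [gradient_mul]
    exact Submodule.add_mem _ (Submodule.smul_mem _ _ hy) (Submodule.smul_mem _ _ hx)

/-- In characteristic zero, replacing an annihilating polynomial by its derivative lowers the degree
without reaching zero, so this stops at one whose derivative does not vanish at x. -/
theorem exists_aeval_derivative_ne_zero {R A : Type*} [CommRing R] [IsDomain R] [CharZero R]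
    [CommRing A] [Algebra R A] [FaithfulSMul R A] {x : A} (hx : IsAlgebraic R x) :
    ∃ P : Polynomial R, Polynomial.aeval x P = 0 ∧
      Polynomial.aeval x (Polynomial.derivative P) ≠ 0 := by
  obtain ⟨P, hP0, hP⟩ := hx
  induction h : P.natDegree using Nat.strong_induction_on generalizing P with
  | _ d ih =>
    by_cases hd : Polynomial.aeval x (Polynomial.derivative P) = 0
    · have hne : P.natDegree ≠ 0 := by
        intro h0
        rw [Polynomial.eq_C_of_natDegree_eq_zero h0, Polynomial.aeval_C] at hP
        have : P.coeff 0 = 0 := by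
          apply FaithfulSMul.algebraMap_injective R A
          rw [hP, map_zero]
        apply hP0
        rw [Polynomial.eq_C_of_natDegree_eq_zero h0, this, map_zero]
      have hlt := Polynomial.natDegree_derivative_lt hne
      refine ih _ (h ▸ hlt) (Polynomial.derivative P) ?_ hd rfl
      intro h0
      exact hne (Polynomial.derivative_eq_zero.mp h0)
    · exact ⟨P, hP, hd⟩

omit [Fintype κ] [CharZero k] in
-- Chain rule for polynomials over k[s]: differentiating the coefficients contributes only gradients
-- of elements of s.
theorem gradient_aeval_sub_mem (s : Set (MvPolynomial κ k)) (x : MvPolynomial κ k)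
    (P : Polynomial (Algebra.adjoin k s)) :
    gradient κ k (Polynomial.aeval x P) -
        algebraMap _ (FractionRing (MvPolynomial κ k))
          (Polynomial.aeval x (Polynomial.derivative P)) • gradient κ k x ∈
      Submodule.span (FractionRing (MvPolynomial κ k)) (gradient κ k '' s) := by
  induction P using Polynomial.induction_on' with
  | add p q hp hq =>
    convert Submodule.add_mem _ hp hq using 1
    simp only [map_add, add_smul]
    abel
  | monomial n a =>
    have hpow : gradient κ k (x ^ n) =
        algebraMap _ (FractionRing (MvPolynomial κ k)) (n * x ^ (n - 1)) • gradient κ k x := by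
      ext j
      simp only [gradient, LinearMap.coe_mk, AddHom.coe_mk, Derivation.leibniz_pow, smul_eq_mul,
        nsmul_eq_mul, map_mul, Pi.smul_apply]
      ring
    have ha := gradient_mem_span_of_mem_adjoin a.2
    convert Submodule.smul_mem _ (algebraMap _ (FractionRing (MvPolynomial κ k)) (x ^ n)) ha using 1
    rw [Polynomial.aeval_monomial, gradient_mul, hpow, Polynomial.derivative_monomial,
      Polynomial.aeval_monomial, smul_smul, ← map_mul]
    have : algebraMap (Algebra.adjoin k s) (MvPolynomial κ k) (a * (n : Algebra.adjoin k s)) *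
        x ^ (n - 1) = (a : MvPolynomial κ k) * (n * x ^ (n - 1)) := by
      rw [map_mul, map_natCast, mul_assoc]; rfl
    rw [this]
    have h2 : algebraMap (Algebra.adjoin k s) (MvPolynomial κ k) a = (a : MvPolynomial κ k) := rfl
    rw [h2]
    abel

omit [Fintype ι] in
-- Extend F to a transcendence basis s. Each variable is algebraic over k[s], and differentiating
-- its relation puts its gradient in the span of those of s. As s has as many elements as there are
-- variables, these spanning gradients are independent.
theorem linearIndependent_gradient {F : ι → MvPolynomial κ k}
    (hF : AlgebraicIndependent k F) :
    LinearIndependent (FractionRing (MvPolynomial κ k)) (fun i => gradient κ k (F i)) := by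
  classical
  set K := FractionRing (MvPolynomial κ k)
  have hmat : Algebra.IsAlgebraic (Algebra.adjoin k (Set.range (X : κ → MvPolynomial κ k)))
      (MvPolynomial κ k) := (IsTranscendenceBasis.mvPolynomial κ k).isAlgebraic
  obtain ⟨s, hs, hbasis⟩ := exists_isTranscendenceBasis_superset hF.coe_range
  have hcard : Cardinal.mk s = Cardinal.mk κ := by
    have := hbasis.lift_cardinalMk_eq (IsTranscendenceBasis.mvPolynomial κ k)
    simpa using this
  have hfin : Finite s := by
    rw [← Cardinal.mk_lt_aleph0_iff, hcard]
    exact Cardinal.mk_lt_aleph0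
  have : Fintype s := Fintype.ofFinite s
  have hcard' : Fintype.card s = Fintype.card κ := by
    rw [Cardinal.mk_fintype, Cardinal.mk_fintype] at hcard
    exact_mod_cast hcard
  have halg : Algebra.IsAlgebraic (Algebra.adjoin k s) (MvPolynomial κ k) := by
    have := hbasis.isAlgebraic
    rwa [Subtype.range_coe] at this
  have hspan : ⊤ ≤ Submodule.span K (Set.range fun p : s => gradient κ k p.1) := by
    have hr : (Set.range fun p : s => gradient κ k p.1) = gradient κ k '' s := by
      ext v; simp
    rw [hr, ← (Pi.basisFun K κ).span_eq, Submodule.span_le]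
    rintro _ ⟨j, rfl⟩
    obtain ⟨P, hP, hP'⟩ := exists_aeval_derivative_ne_zero (halg.isAlgebraic (X j))
    have h1 := gradient_aeval_sub_mem s (X j) P
    rw [hP, map_zero, zero_sub, Submodule.neg_mem_iff] at h1
    have hne : algebraMap (MvPolynomial κ k) K
        (Polynomial.aeval (X j) (Polynomial.derivative P)) ≠ 0 := by
      rwa [Ne, IsFractionRing.to_map_eq_zero_iff]
    rw [Submodule.smul_mem_iff _ hne] at h1
    suffices hb : Pi.basisFun K κ j = gradient κ k (X j) by rw [hb]; exact h1
    ext l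
    simp only [Pi.basisFun_apply, gradient, LinearMap.coe_mk, AddHom.coe_mk, pderiv_X]
    by_cases h : j = l
    · subst h; simp
    · simp [h, Ne.symm h]
  have hli := linearIndependent_of_top_le_span_of_card_eq_finrank hspan
    (by rw [Module.finrank_fintype_fun_eq_card]; exact hcard')
  exact hli.comp (fun i => (⟨F i, hs ⟨i, rfl⟩⟩ : s))
    (fun i j h => AlgebraicIndependent.injective hF (Subtype.ext_iff.mp h))

theorem eq_zero_of_sum_mul_pderiv_eq_zero {F : ι → MvPolynomial κ k}
    (hF : Function.Injective (aeval (R := k) F)) {c : ι → MvPolynomial κ k}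
    (hc : ∀ j, ∑ i, c i * pderiv j (F i) = 0) : c = 0 := by
  have hli := linearIndependent_gradient (F := F) hF
  rw [Fintype.linearIndependent_iff] at hli
  have := hli (fun i => algebraMap _ _ (c i)) (by
    ext j
    have := congrArg (algebraMap (MvPolynomial κ k) (FractionRing (MvPolynomial κ k))) (hc j)
    simpa only [gradient, LinearMap.coe_mk, AddHom.coe_mk, Finset.sum_apply, Pi.smul_apply,
      smul_eq_mul, map_sum, map_mul, map_zero, Pi.zero_apply] using this)
  ext1 i
  exact (IsFractionRing.to_map_eq_zero_iff).mp (this i)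

end Jacobian

/-! ### Localization of ideals at a prime and differential ideals -/

section Saturation

variable {R : Type*} [CommRing R]

/-- The contraction to `R` of the extension of `L` to the local ring at `Q`. -/
def localIdeal (L Q : Ideal R) [hQ : Q.IsPrime] : Ideal R where
  carrier := {x | ∃ w ∉ Q, w * x ∈ L}
  zero_mem' := ⟨1, fun h => hQ.ne_top ((Ideal.eq_top_iff_one _).mpr h), by simp⟩
  add_mem' := by
    rintro x y ⟨w, hw, hx⟩ ⟨v, hv, hy⟩
    refine ⟨w * v, fun h => (hQ.mem_or_mem h).elim hw hv, ?_⟩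
    have : w * v * (x + y) = v * (w * x) + w * (v * y) := by ring
    rw [this]
    exact L.add_mem (L.mul_mem_left _ hx) (L.mul_mem_left _ hy)
  smul_mem' := by
    rintro c x ⟨w, hw, hx⟩
    refine ⟨w, hw, ?_⟩
    rw [smul_eq_mul, mul_left_comm]
    exact L.mul_mem_left _ hx

variable {L L' Q : Ideal R} [hQ : Q.IsPrime]

theorem le_localIdeal : L ≤ localIdeal L Q := fun x hx =>
  ⟨1, fun h => hQ.ne_top ((Ideal.eq_top_iff_one _).mpr h), by simpa using hx⟩

theorem localIdeal_mono (h : L ≤ L') : localIdeal L Q ≤ localIdeal L' Q :=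
  fun _ ⟨w, hw, hx⟩ => ⟨w, hw, h hx⟩

theorem mem_localIdeal_of_mul_mem {c x : R} (hc : c ∉ Q) (h : c * x ∈ localIdeal L Q) :
    x ∈ localIdeal L Q := by
  obtain ⟨w, hw, hx⟩ := h
  exact ⟨w * c, fun h => (hQ.mem_or_mem h).elim hw hc, by rwa [mul_assoc]⟩

theorem localIdeal_le (h : L ≤ Q) : localIdeal L Q ≤ Q :=
  fun _ ⟨_, hw, hx⟩ => (hQ.mem_or_mem (h hx)).resolve_left hw

theorem localIdeal_le_localIdeal (h : L ≤ localIdeal L' Q) : localIdeal L Q ≤ localIdeal L' Q :=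
  fun _ ⟨_, hw, hx⟩ => mem_localIdeal_of_mul_mem hw (h hx)

theorem exists_pow_mem_localIdeal_of_mem_minimalPrimes (h : Q ∈ L.minimalPrimes) {q : R}
    (hq : q ∈ Q) : ∃ N, q ^ N ∈ localIdeal L Q := by
  have h1 := IsLocalization.AtPrime.radical_map_of_mem_minimalPrimes
    (A := Localization.AtPrime Q) Q L h
  have h2 : algebraMap R (Localization.AtPrime Q) q ∈
      (L.map (algebraMap R (Localization.AtPrime Q))).radical := by
    rw [h1]; exact Ideal.mem_map_of_mem _ hq
  obtain ⟨N, hN⟩ := h2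
  rw [← map_pow, IsLocalization.algebraMap_mem_map_algebraMap_iff Q.primeCompl] at hN
  obtain ⟨w, hw, hx⟩ := hN
  exact ⟨N, w, hw, hx⟩

variable {k : Type*} [Field k] [CharZero k] [Algebra k R]

omit [CharZero k] in
theorem derivation_mem_localIdeal {δ : Derivation k R R} (h : ∀ x ∈ L, δ x ∈ localIdeal L Q)
    {x : R} (hx : x ∈ localIdeal L Q) : δ x ∈ localIdeal L Q := by
  obtain ⟨w, hw, hwx⟩ := hx
  have h1 := h _ hwx
  rw [Derivation.leibniz, smul_eq_mul, smul_eq_mul] at h1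
  have h2 : x * δ w ∈ localIdeal L Q := Ideal.mul_mem_right _ _ ⟨w, hw, hwx⟩
  exact mem_localIdeal_of_mul_mem hw ((Submodule.add_mem_iff_left _ h2).mp h1)

/-- A local form of the fact that, in characteristic zero, minimal primes of a differential ideal
are differential. -/
theorem derivation_mem_of_pow_mem {δ : Derivation k R R} (hLQ : L ≤ Q)
    (h : ∀ x ∈ L, δ x ∈ localIdeal L Q) {q : R} {N : ℕ} (hN : q ^ N ∈ localIdeal L Q) :
    δ q ∈ Q := by
  suffices key : ∀ a b : ℕ, q ^ a * δ q ^ b ∈ localIdeal L Q → δ q ∈ Q from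
    key N 0 (by simpa using hN)
  intro a
  induction a with
  | zero =>
    intro b hb
    have := localIdeal_le hLQ hb
    rw [pow_zero, one_mul] at this
    exact hQ.mem_of_pow_mem _ this
  | succ a ih =>
    intro b hb
    refine ih (b + 2) ?_
    -- Applying δ and multiplying by δ q trades one factor q for two factors δ q, up to the integer
    -- a + 1 and a multiple of the element at hand.
    have h1 := Ideal.mul_mem_left _ (δ q) (derivation_mem_localIdeal h hb)
    have h2 : δ q * δ (q ^ (a + 1) * δ q ^ b) =
        ((a + 1 : ℕ) : R) * (q ^ a * δ q ^ (b + 2)) +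
          (b : R) * δ (δ q) * (q ^ (a + 1) * δ q ^ b) := by
      rcases b with _ | b
      · simp only [Derivation.leibniz, Derivation.leibniz_pow, smul_eq_mul, nsmul_eq_mul]
        simp
        ring
      · simp only [Derivation.leibniz, Derivation.leibniz_pow, smul_eq_mul, nsmul_eq_mul,
          Nat.add_sub_cancel]
        push_cast
        ring
    rw [h2, Submodule.add_mem_iff_left _ (Ideal.mul_mem_left _ _ hb)] at h1
    refine mem_localIdeal_of_mul_mem (c := ((a + 1 : ℕ) : R)) ?_ h1
    intro hmem
    refine hQ.ne_top (Ideal.eq_top_of_isUnit_mem _ hmem ?_)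
    rw [← map_natCast (algebraMap k R)]
    exact (IsUnit.mk0 _ (by exact_mod_cast a.succ_ne_zero)).map _

end Saturation

/-! ### Primes stable under the vector fields tangent to a hyperplane field. -/

section Coordinates

variable {k : Type*} [Field k] [CharZero k]

theorem exists_pderiv_ne_zero_totalDegree_lt {σ : Type*} {P : MvPolynomial σ k}
    (hP : P.totalDegree ≠ 0) : ∃ i, pderiv i P ≠ 0 ∧ (pderiv i P).totalDegree < P.totalDegree := by
  obtain ⟨m, hm, hm0⟩ : ∃ m ∈ P.support, m ≠ 0 := by
    by_contra! h
    apply hP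
    rw [totalDegree_eq_zero_iff]
    intro m hm x
    simp [h m hm]
  obtain ⟨i, hi⟩ := Finsupp.ne_iff.mp hm0
  refine ⟨i, ?_, ?_⟩
  · intro h0
    have := congrArg (coeff (m - Finsupp.single i 1)) h0
    rw [coeff_pderiv, coeff_zero] at this
    have hle : Finsupp.single i 1 ≤ m := by
      rw [Finsupp.single_le_iff]; exact Nat.one_le_iff_ne_zero.mpr hi
    rw [tsub_add_cancel_of_le hle] at this
    rcases mul_eq_zero.mp this with h | h
    · exact (mem_support_iff.mp hm) h
    · exact Nat.cast_add_one_ne_zero _ h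
  · rw [totalDegree, Finset.sup_lt_iff (Nat.pos_of_ne_zero hP)]
    intro m hm
    rw [mem_support_iff, coeff_pderiv] at hm
    have h1 : m + Finsupp.single i 1 ∈ P.support := mem_support_iff.mpr (left_ne_zero_of_mul hm)
    have h2 := le_totalDegree h1
    rw [Finsupp.sum_add_index' (fun _ => rfl) (fun _ _ _ => rfl), Finsupp.sum_single_index rfl] at h2
    exact Nat.lt_of_succ_le h2

/-- On polynomials in Q free of the variable r, the hypothesis becomes stability under partial
derivatives, since w_r ∉ Q; repeated differentiation would bring a nonzero constant into Q. So Q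
meets that subring in zero, and adjoining one variable raises the height by at most one. -/
theorem height_le_one_of_derivations_preserve {n : ℕ} (Q : Ideal (MvPolynomial (Fin (n + 1)) k))
    [hQ : Q.IsPrime] (w : Fin (n + 1) → MvPolynomial (Fin (n + 1)) k) {r : Fin (n + 1)}
    (hr : w r ∉ Q) (h : ∀ j, ∀ q ∈ Q, w r * pderiv j q - w j * pderiv r q ∈ Q) :
    Q.height ≤ 1 := by
  have hzero : ∀ d : ℕ, ∀ P : MvPolynomial (Fin n) k, P.totalDegree = d →
      rename r.succAbove P ∈ Q → P = 0 := by
    intro d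
    induction d using Nat.strong_induction_on with
    | _ d ih =>
      intro P hd hmem
      by_cases hd0 : P.totalDegree = 0
      · rw [totalDegree_eq_zero_iff_eq_C] at hd0
        by_contra hne
        rw [hd0, rename_C] at hmem
        refine hQ.ne_top (Ideal.eq_top_of_isUnit_mem _ hmem ((IsUnit.mk0 _ ?_).map C))
        intro h0
        rw [h0, map_zero] at hd0
        exact hne hd0
      · obtain ⟨i, hi0, hi⟩ := exists_pderiv_ne_zero_totalDegree_lt hd0
        have h1 := h (r.succAbove i) _ hmem
        have h2 : pderiv r (rename r.succAbove P) = 0 := by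
          apply pderiv_eq_zero_of_notMem_vars
          intro hv
          obtain ⟨x, _, hx⟩ := Finset.mem_image.mp (vars_rename _ _ hv)
          exact Fin.succAbove_ne r x hx
        rw [h2, mul_zero, sub_zero, pderiv_rename Fin.succAbove_right_injective] at h1
        have h3 := (hQ.mem_or_mem h1).resolve_left hr
        exact absurd (ih _ (hd ▸ hi) _ rfl h3) hi0
  let e : MvPolynomial (Fin (n + 1)) k ≃ₐ[k] Polynomial (MvPolynomial (Fin n) k) :=
    (renameEquiv k (_root_.finSuccEquiv' r)).trans (optionEquivLeft k (Fin n))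
  have he : ∀ P, e (rename r.succAbove P) = Polynomial.C P := by
    intro P
    have : (e : MvPolynomial (Fin (n + 1)) k →ₐ[k] _).comp (rename r.succAbove) =
        Polynomial.CAlgHom.comp (AlgHom.id k (MvPolynomial (Fin n) k)) := by
      apply MvPolynomial.algHom_ext
      intro i
      simp [e, optionEquivLeft_X_some]
    exact DFunLike.congr_fun this P
  have hht := height_le_height_comap_C_add_one (Q.comap e.symm.toRingEquiv)
  rw [RingEquiv.height_comap] at hht
  have hbot : (Q.comap e.symm.toRingEquiv).comap
      (Polynomial.C : MvPolynomial (Fin n) k →+* _) = ⊥ := by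
    rw [eq_bot_iff]
    intro P hP
    rw [Ideal.mem_bot]
    refine hzero _ P rfl ?_
    rw [Ideal.mem_comap, Ideal.mem_comap, ← he] at hP
    simpa using hP
  rw [hbot, Ideal.height_bot, zero_add] at hht
  exact hht

end Coordinates

/-! ### Differential forms -/

section Forms

variable {ι κ : Type} [Fintype ι] [Fintype κ]

omit [Fintype ι] in
theorem extD_antisymm (α : OneForm ι) (i j : ι) : extD α j i = - extD α i j := by
  simp [extD]

omit [Fintype ι] in
theorem extD_self (α : OneForm ι) (i : ι) : extD α i i = 0 := by
  simp [extD]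

omit [Fintype κ] in
theorem pderiv_aeval (F : ι → MvPolynomial κ ℂ) (a : κ) (p : MvPolynomial ι ℂ) :
    pderiv a (aeval F p) = ∑ j, aeval F (pderiv j p) * pderiv a (F j) := by
  classical
  induction p using MvPolynomial.induction_on with
  | C c => simp [MvPolynomial.algebraMap_eq]
  | add p q hp hq => simp only [map_add, hp, hq, add_mul, Finset.sum_add_distrib]
  | mul_X p i hp =>
    have h1 : ∑ j, aeval F p * aeval F ((Pi.single i 1 : ι → MvPolynomial ι ℂ) j) *
        pderiv a (F j) = aeval F p * pderiv a (F i) := by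
      rw [Finset.sum_eq_single i (fun j _ hj => by simp [hj]) (by simp)]
      simp
    have h2 : ∀ j, aeval F (pderiv j (p * X i)) * pderiv a (F j) =
        aeval F (pderiv j p) * pderiv a (F j) * F i +
          aeval F p * aeval F ((Pi.single i 1 : ι → MvPolynomial ι ℂ) j) * pderiv a (F j) := by
      intro j
      rw [pderiv_mul, pderiv_X, map_add, map_mul, map_mul, aeval_X, Pi.single_comm]
      ring
    rw [map_mul, aeval_X, pderiv_mul, hp, Finset.sum_congr rfl fun j _ => h2 j,
      Finset.sum_add_distrib, h1, Finset.sum_mul]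

omit [Fintype κ] in
theorem extD_pullback (F : ι → MvPolynomial κ ℂ) (α : OneForm ι) (a b : κ) :
    extD (pullback F α) a b =
      ∑ j, ∑ i, aeval F (extD α j i) * pderiv a (F j) * pderiv b (F i) := by
  have hcomm : ∀ i, pderiv a (pderiv b (F i)) = pderiv b (pderiv a (F i)) := by
    intro i
    ext m
    simp only [coeff_pderiv]
    by_cases h : a = b
    · subst h; rfl
    · rw [add_right_comm]
      simp [h, Ne.symm h]
      ring
  have h1 : ∀ a b : κ, pderiv a (pullback F α b) =
      ∑ i, aeval F (α i) * pderiv a (pderiv b (F i)) +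
        ∑ j, ∑ i, aeval F (pderiv j (α i)) * pderiv a (F j) * pderiv b (F i) := by
    intro a b
    simp only [pullback, map_sum, pderiv_mul, pderiv_aeval, Finset.sum_add_distrib]
    rw [add_comm, Finset.sum_comm (γ := ι) (α := ι)]
    congr 1
    exact Finset.sum_congr rfl fun i _ => by rw [Finset.sum_mul]
  rw [extD, h1, h1]
  simp only [hcomm, extD, map_sub, sub_mul, Finset.sum_sub_distrib]
  rw [Finset.sum_comm (f := fun j i => aeval F (pderiv i (α j)) * pderiv a (F j) * pderiv b (F i))]
  have : ∀ j i, aeval F (pderiv j (α i)) * pderiv a (F i) * pderiv b (F j) =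
      aeval F (pderiv j (α i)) * pderiv b (F j) * pderiv a (F i) := fun _ _ => by ring
  simp only [this]
  ring

end Forms

/-! ### Radial vector fields acting on twisted forms. -/

section Twisted

variable {q m : ℕ} {Δ : SimplicialCompleteFan q m}

/-- The pairing of the class group with a relation among the rays. -/
def relationPairing {a : Fin m → ℤ} (ha : IsRelation Δ a) : ClassGroup Δ →+ ℤ :=
  QuotientAddGroup.lift _
    { toFun := fun d => ∑ i, a i * d i
      map_zero' := by simp
      map_add' := fun x y => by simp [mul_add, Finset.sum_add_distrib] } <| by
    rintro _ ⟨u, rfl⟩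
    have h : ∀ k, ∑ i, a i * Δ.ray i k = 0 := fun k => by
      have := congrFun ha k
      simpa using this
    simp only [divMap, AddMonoidHom.coe_mk, ZeroHom.coe_mk, Finset.mul_sum, AddMonoidHom.mem_ker]
    rw [Finset.sum_comm]
    refine Finset.sum_eq_zero fun k _ => ?_
    rw [← mul_zero (u k), ← h k, Finset.mul_sum]
    exact Finset.sum_congr rfl fun i _ => by ring

theorem relationPairing_divClass {a : Fin m → ℤ} (ha : IsRelation Δ a) (i : Fin m) :
    relationPairing ha (divClass Δ i) = a i := by
  simp [relationPairing, divClass, Pi.single_apply]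

/-- Euler's formula: the radial field multiplies each monomial by its weight. -/
theorem relation_euler {a : Fin m → ℤ} (ha : IsRelation Δ a) {p : MvPolynomial (Fin m) ℂ}
    {M : ClassGroup Δ} (hp : IsWeightedHomogeneous (divClass Δ) p M) :
    ∑ i, (a i : MvPolynomial (Fin m) ℂ) * X i * pderiv i p =
      (relationPairing ha M : MvPolynomial (Fin m) ℂ) * p := by
  have hmon : ∀ d ∈ p.support,
      ∑ i, (a i : MvPolynomial (Fin m) ℂ) * X i * pderiv i (monomial d (coeff d p)) =
        (relationPairing ha M : MvPolynomial (Fin m) ℂ) * monomial d (coeff d p) := by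
    intro d hd
    have hw := hp (mem_support_iff.mp hd)
    have : relationPairing ha M = ∑ i, a i * d i := by
      rw [← hw, Finsupp.weight_apply, Finsupp.sum_fintype _ _ (by simp), map_sum]
      refine Finset.sum_congr rfl fun i _ => ?_
      rw [map_nsmul, relationPairing_divClass, nsmul_eq_mul, mul_comm]
    rw [this]
    push_cast
    rw [Finset.sum_mul]
    refine Finset.sum_congr rfl fun i _ => ?_
    rw [mul_assoc, X_mul_pderiv_monomial, nsmul_eq_mul, mul_assoc]
  conv_lhs => rw [p.as_sum]
  conv_rhs => rw [p.as_sum]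
  simp only [map_sum, Finset.mul_sum]
  rw [Finset.sum_comm]
  refine Finset.sum_congr rfl fun d hd => ?_
  rw [hmon d hd]

/-- Cartan's formula: the Lie derivative of α along a radial field R is its degree times α, and i_R
α = 0. -/
theorem IsTwistedForm.contract_extD {D : ClassGroup Δ} {α : OneForm (Fin m)}
    (hα : IsTwistedForm Δ D α) {a : Fin m → ℤ} (ha : IsRelation Δ a) (j : Fin m) :
    ∑ i, (a i : MvPolynomial (Fin m) ℂ) * X i * extD α i j =
      (relationPairing ha D : MvPolynomial (Fin m) ℂ) * α j := by
  have h1 := relation_euler ha (hα.homogeneous j)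
  have h2 := congrArg (pderiv j) (hα.descends a ha)
  rw [map_zero, map_sum] at h2
  have h3 : ∀ i, pderiv j ((a i : MvPolynomial (Fin m) ℂ) * X i * α i) =
      (a i : MvPolynomial (Fin m) ℂ) * X i * pderiv j (α i) +
        if i = j then (a j : MvPolynomial (Fin m) ℂ) * α j else 0 := by
    intro i
    rw [pderiv_mul, pderiv_mul, pderiv_X]
    have : pderiv j (a i : MvPolynomial (Fin m) ℂ) = 0 := by
      simp
    rw [this]
    by_cases h : i = j
    · subst h; simp; ring
    · simp [h]
  simp only [h3, Finset.sum_add_distrib, Finset.sum_ite_eq', Finset.mem_univ, if_true] at h2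
  rw [map_sub, relationPairing_divClass] at h1
  simp only [extD, mul_sub, Finset.sum_sub_distrib]
  push_cast at h1
  linear_combination h1 - h2

end Twisted

/-! ### Integrability of twisted forms on a toric surface. -/

section Surface

variable {m : ℕ} {Δ : SimplicialCompleteFan 2 m}

/-- The determinant of two rays in the plane. -/
def bracket (Δ : SimplicialCompleteFan 2 m) (i j : Fin m) : ℤ :=
  Δ.ray i 0 * Δ.ray j 1 - Δ.ray i 1 * Δ.ray j 0

theorem ray_ne_zero (Δ : SimplicialCompleteFan 2 m) (i : Fin m) : Δ.ray i ≠ 0 := by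
  intro h
  have := Δ.primitive i 0 0 (by simpa using h)
  simp at this

theorem isRelation_single_add {x y z : ℤ} {i j k : Fin m}
    (h : ∀ c, x * Δ.ray i c + y * Δ.ray j c + z * Δ.ray k c = 0) :
    IsRelation Δ (Pi.single i x + Pi.single j y + Pi.single k z) := by
  rw [IsRelation]
  ext c
  simp only [Pi.add_apply, add_smul, Finset.sum_add_distrib, Pi.single_apply, ite_smul, zero_smul,
    Finset.sum_ite_eq', Finset.mem_univ, if_true, Pi.smul_apply, smul_eq_mul, Pi.zero_apply]
  exact h c

theorem sum_single_add (x y z : ℤ) (i j k : Fin m) (f : Fin m → MvPolynomial (Fin m) ℂ) :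
    ∑ l, (((Pi.single i x + Pi.single j y + Pi.single k z : Fin m → ℤ) l : ℤ) :
        MvPolynomial (Fin m) ℂ) * X l * f l =
      (x : MvPolynomial (Fin m) ℂ) * X i * f i + (y : MvPolynomial (Fin m) ℂ) * X j * f j
        + (z : MvPolynomial (Fin m) ℂ) * X k * f k := by
  simp only [Pi.add_apply, Int.cast_add, add_mul, Finset.sum_add_distrib, Pi.single_apply,
    Int.cast_ite, Int.cast_zero, ite_mul, zero_mul, Finset.sum_ite_eq', Finset.mem_univ, if_true]

theorem exists_relation (Δ : SimplicialCompleteFan 2 m) (i j k : Fin m) :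
    ∃ x y z : ℤ, (x ≠ 0 ∨ y ≠ 0 ∨ z ≠ 0) ∧
      ∀ c, x * Δ.ray i c + y * Δ.ray j c + z * Δ.ray k c = 0 := by
  by_cases h : bracket Δ i j = 0
  · obtain ⟨c, hc⟩ := Function.ne_iff.mp (ray_ne_zero Δ i)
    refine ⟨Δ.ray j c, - Δ.ray i c, 0, Or.inr (Or.inl (neg_ne_zero.mpr hc)), fun c' => ?_⟩
    simp only [bracket] at h
    fin_cases c <;> fin_cases c' <;> simp <;> linarith
  · refine ⟨bracket Δ j k, bracket Δ k i, bracket Δ i j, Or.inr (Or.inr h), fun c => ?_⟩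
    simp only [bracket]
    fin_cases c <;> simp <;> ring

/-- `α ∧ dα = 0`. -/
theorem IsTwistedForm.integrable {D : ClassGroup Δ} {α : OneForm (Fin m)}
    (hα : IsTwistedForm Δ D α) (i j k : Fin m) :
    α i * extD α j k + α j * extD α k i + α k * extD α i j = 0 := by
  set θ : Fin m → Fin m → Fin m → MvPolynomial (Fin m) ℂ := fun i j k =>
    α i * extD α j k + α j * extD α k i + α k * extD α i j with hθ
  -- For a radial field R, i_R(α ∧ dα) = (i_R α) dα − α ∧ i_R dα, and both terms vanish because i_R
  -- dα is a multiple of α.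
  have hcontr : ∀ a : Fin m → ℤ, IsRelation Δ a → ∀ j k,
      ∑ i, (a i : MvPolynomial (Fin m) ℂ) * X i * θ i j k = 0 := by
    intro a ha j k
    have h1 := hα.descends a ha
    have h2 := hα.contract_extD ha j
    have h3 := hα.contract_extD ha k
    have : ∀ i, (a i : MvPolynomial (Fin m) ℂ) * X i * θ i j k =
        ((a i : MvPolynomial (Fin m) ℂ) * X i * α i) * extD α j k
          - α j * ((a i : MvPolynomial (Fin m) ℂ) * X i * extD α i k)
          + α k * ((a i : MvPolynomial (Fin m) ℂ) * X i * extD α i j) := by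
      intro i
      simp only [hθ, extD_antisymm α i k]
      ring
    simp only [this, Finset.sum_add_distrib, Finset.sum_sub_distrib, ← Finset.sum_mul,
      ← Finset.mul_sum, h1, h2, h3]
    ring
  have hjj : ∀ j k, θ j j k = 0 := fun j k => by
    simp only [hθ, extD_self, extD_antisymm α j k]; ring
  have hkk : ∀ j k, θ k j k = 0 := fun j k => by
    simp only [hθ, extD_self, extD_antisymm α j k]; ring
  have hcyc : ∀ i j k, θ i j k = θ j k i := fun i j k => by simp only [hθ]; ring
  -- A relation supported on i, j, k leaves a single term of the contraction, since θ vanishes when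
  -- an index repeats.
  have hone : ∀ (x y z : ℤ) (i j k : Fin m),
      (∀ c, x * Δ.ray i c + y * Δ.ray j c + z * Δ.ray k c = 0) → x ≠ 0 → θ i j k = 0 := by
    intro x y z i j k h hx
    have := hcontr _ (isRelation_single_add h) j k
    rw [sum_single_add, hjj, hkk, mul_zero, mul_zero, add_zero, add_zero] at this
    refine (mul_eq_zero.mp this).resolve_left (mul_ne_zero ?_ (X_ne_zero i))
    exact_mod_cast hx
  obtain ⟨x, y, z, hne, hrel⟩ := exists_relation Δ i j k
  rcases hne with h | h | h
  · exact hone x y z i j k hrel h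
  · have := hone y z x j k i (fun c => by linarith [hrel c]) h
    rw [← hcyc] at this
    exact this
  · have := hone z x y k i j (fun c => by linarith [hrel c]) h
    rw [hcyc] at this
    exact this

end Surface

/-! ### Differential consequences of integrability. -/

section Integrable

variable {ι κ : Type} [Fintype ι] [Fintype κ] {α : OneForm ι}

omit [Fintype ι] in
theorem mem_singularIdeal (α : OneForm ι) (i : ι) : α i ∈ singularIdeal α :=
  Ideal.subset_span ⟨i, rfl⟩

omit [Fintype ι] in
theorem pderiv_integrable_mem
    (h : ∀ i j k, α i * extD α j k + α j * extD α k i + α k * extD α i j = 0) (r i j k : ι) :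
    pderiv r (α i) * extD α j k + pderiv r (α j) * extD α k i + pderiv r (α k) * extD α i j ∈
      singularIdeal α := by
  have h1 := congrArg (pderiv r) (h i j k)
  simp only [map_add, pderiv_mul, map_zero] at h1
  have h2 : pderiv r (α i) * extD α j k + pderiv r (α j) * extD α k i
      + pderiv r (α k) * extD α i j =
      -(pderiv r (extD α j k)) * α i + -(pderiv r (extD α k i)) * α j
        + -(pderiv r (extD α i j)) * α k := by linear_combination h1
  rw [h2]
  exact Ideal.add_mem _ (Ideal.add_mem _ (Ideal.mul_mem_left _ _ (mem_singularIdeal α i))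
    (Ideal.mul_mem_left _ _ (mem_singularIdeal α j)))
    (Ideal.mul_mem_left _ _ (mem_singularIdeal α k))

omit [Fintype ι] in
/-- `dα` is decomposable modulo the coefficients of `α`. -/
theorem pluecker_mem
    (h : ∀ i j k, α i * extD α j k + α j * extD α k i + α k * extD α i j = 0) (r i j k : ι) :
    extD α r i * extD α j k + extD α k i * extD α r j + extD α i j * extD α r k ∈
      singularIdeal α := by
  have h1 := pderiv_integrable_mem h r i j k
  have h2 := pderiv_integrable_mem h i r j k
  have h3 := pderiv_integrable_mem h j k r i
  have h4 := pderiv_integrable_mem h k j r i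
  -- The alternating sum of the four derivatives is a coefficient of dα ∧ dα, twice the Plücker
  -- expression; hence the factor 1/2.
  have h5 := Ideal.mul_mem_left (singularIdeal α) (C (1 / 2 : ℂ))
    (Ideal.sub_mem _ (Ideal.add_mem _ (Ideal.sub_mem _ h1 h2) h3) h4)
  have h6 : (C (1 / 2 : ℂ) : MvPolynomial ι ℂ) * 2 = 1 := by
    rw [← map_ofNat (C : ℂ →+* MvPolynomial ι ℂ) 2, ← map_mul]
    norm_num
  convert h5 using 1
  simp only [extD]
  linear_combination (-((pderiv r (α i) - pderiv i (α r)) * (pderiv j (α k) - pderiv k (α j)) +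
      (pderiv k (α i) - pderiv i (α k)) * (pderiv r (α j) - pderiv j (α r)) +
      (pderiv i (α j) - pderiv j (α i)) * (pderiv r (α k) - pderiv k (α r)))) * h6

end Integrable

/-! ### Combinatorics of complete fans in the plane -/

section Fan

variable {m : ℕ} (Δ : SimplicialCompleteFan 2 m)

theorem bracket_swap (i j : Fin m) : bracket Δ i j = - bracket Δ j i := by
  simp only [bracket]; ring

theorem bracket_self (i : Fin m) : bracket Δ i i = 0 := by
  simp only [bracket]; ring

theorem bracket_mul_ray {i j : Fin m} (h : bracket Δ i j = 0) (c c' : Fin 2) :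
    Δ.ray i c * Δ.ray j c' = Δ.ray j c * Δ.ray i c' := by
  simp only [bracket] at h
  fin_cases c <;> fin_cases c' <;> simp <;> linarith

/-- The cones on two distinct rays meet only in the origin, so parallel rays pointing the same way
coincide. -/
theorem eq_of_bracket_eq_zero_of_pos {i j : Fin m} (h : bracket Δ i j = 0) {c : Fin 2}
    (hc : 0 < Δ.ray i c * Δ.ray j c) : i = j := by
  by_contra hij
  have hinter := Δ.inter _ (Δ.ray_mem i) _ (Δ.ray_mem j)
  have hemp : ({i} : Finset (Fin m)) ∩ {j} = ∅ := by
    rw [Finset.singleton_inter_of_notMem]; simpa using hij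
  rw [hemp] at hinter
  have hic : Δ.ray i c ≠ 0 := left_ne_zero_of_mul hc.ne'
  have hjc : Δ.ray j c ≠ 0 := right_ne_zero_of_mul hc.ne'
  have hjc' : (Δ.ray j c : ℝ) ≠ 0 := by exact_mod_cast hjc
  have hmem : (fun k => (Δ.ray i k : ℝ)) ∈ cone Δ.ray {i} ∩ cone Δ.ray {j} := by
    refine ⟨⟨fun _ => 1, fun _ => zero_le_one, by simp⟩,
      ⟨fun _ => (Δ.ray i c * Δ.ray j c : ℤ) / (Δ.ray j c : ℝ) ^ 2, fun _ => ?_, ?_⟩⟩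
    · have : (0 : ℝ) < (Δ.ray i c * Δ.ray j c : ℤ) := by exact_mod_cast hc
      positivity
    · ext k
      have := bracket_mul_ray Δ h c k
      have h' : (Δ.ray i c : ℝ) * Δ.ray j k = Δ.ray j c * Δ.ray i k := by exact_mod_cast this
      simp only [Finset.sum_singleton]
      push_cast
      field_simp
      linarith
  rw [hinter] at hmem
  obtain ⟨d, _, hd⟩ := hmem
  have := congrFun hd c
  simp at this
  exact hic this

theorem ray_injective : Function.Injective Δ.ray := by
  intro i j h
  obtain ⟨c, hc⟩ := Function.ne_iff.mp (ray_ne_zero Δ i)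
  refine eq_of_bracket_eq_zero_of_pos Δ (c := c) ?_ ?_
  · simp only [bracket, h]; ring
  · rw [← h]; exact mul_self_pos.mpr hc

/-- Parallel vectors are equal once a linear form takes the same nonzero value on both. -/
theorem eq_of_bracket_eq {i k l : Fin m} (h1 : bracket Δ i k = bracket Δ i l)
    (h2 : bracket Δ i k ≠ 0) (h3 : bracket Δ k l = 0) : k = l := by
  apply ray_injective Δ
  simp only [bracket] at h1 h2 h3
  have hx : (Δ.ray i 0 * Δ.ray k 1 - Δ.ray i 1 * Δ.ray k 0) * (Δ.ray k 0 - Δ.ray l 0) = 0 := by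
    linear_combination (Δ.ray i 0) * h3 + (Δ.ray k 0) * h1
  have hy : (Δ.ray i 0 * Δ.ray k 1 - Δ.ray i 1 * Δ.ray k 0) * (Δ.ray k 1 - Δ.ray l 1) = 0 := by
    linear_combination (Δ.ray i 1) * h3 + (Δ.ray k 1) * h1
  have hx' := (mul_eq_zero.mp hx).resolve_left h2
  have hy' := (mul_eq_zero.mp hy).resolve_left h2
  ext c
  fin_cases c
  · simp; linarith
  · simp; linarith

/-- A line through the origin carries at most two rays, one in each direction. -/
theorem exists_bracket_ne_zero_of_three {i j k : Fin m} (hij : i ≠ j) (hik : i ≠ k) (hjk : j ≠ k) :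
    bracket Δ i j ≠ 0 ∨ bracket Δ i k ≠ 0 ∨ bracket Δ j k ≠ 0 := by
  by_contra! h
  obtain ⟨h1, h2, h3⟩ := h
  obtain ⟨c, hc⟩ := Function.ne_iff.mp (ray_ne_zero Δ i)
  have hc : Δ.ray i c ≠ 0 := hc
  have hnz : ∀ l, bracket Δ i l = 0 → Δ.ray l c ≠ 0 := by
    intro l hl h0
    apply ray_ne_zero Δ l
    ext c'
    have := bracket_mul_ray Δ hl c c'
    rw [h0, zero_mul] at this
    exact (mul_eq_zero.mp this).resolve_left hc
  have hj := hnz j h1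
  have hk := hnz k h2
  have a1 : ¬ 0 < Δ.ray i c * Δ.ray j c := fun h => hij (eq_of_bracket_eq_zero_of_pos Δ h1 h)
  have a2 : ¬ 0 < Δ.ray i c * Δ.ray k c := fun h => hik (eq_of_bracket_eq_zero_of_pos Δ h2 h)
  have a3 : ¬ 0 < Δ.ray j c * Δ.ray k c := fun h => hjk (eq_of_bracket_eq_zero_of_pos Δ h3 h)
  rcases lt_or_gt_of_ne hc with x | x <;> rcases lt_or_gt_of_ne hj with y | y <;>
    rcases lt_or_gt_of_ne hk with z | z
  all_goals first
    | exact a1 (mul_pos x y) | exact a1 (mul_pos_of_neg_of_neg x y)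
    | exact a2 (mul_pos x z) | exact a2 (mul_pos_of_neg_of_neg x z)
    | exact a3 (mul_pos y z) | exact a3 (mul_pos_of_neg_of_neg y z)

theorem exists_bracket_ne_zero (i : Fin m) : ∃ l, bracket Δ i l ≠ 0 := by
  by_contra! h
  -- The vector is v_i rotated by a right angle; if all rays were parallel to v_i, it would be too.
  obtain ⟨σ, _, c, _, hx⟩ := Δ.complete ![-(Δ.ray i 1 : ℝ), (Δ.ray i 0 : ℝ)]
  have h0 := congrFun hx 0
  have h1 := congrFun hx 1
  simp only [Matrix.cons_val_zero, Matrix.cons_val_one] at h0 h1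
  have hsum : (Δ.ray i 0 : ℝ) * ∑ l ∈ σ, c l * (Δ.ray l 1 : ℝ)
      - (Δ.ray i 1 : ℝ) * ∑ l ∈ σ, c l * (Δ.ray l 0 : ℝ) = 0 := by
    rw [Finset.mul_sum, Finset.mul_sum, ← Finset.sum_sub_distrib]
    refine Finset.sum_eq_zero fun l _ => ?_
    have : (Δ.ray i 0 : ℝ) * Δ.ray l 1 - Δ.ray i 1 * Δ.ray l 0 = 0 := by
      have := h l
      simp only [bracket] at this
      exact_mod_cast this
    linear_combination (c l) * this
  rw [← h0, ← h1] at hsum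
  apply ray_ne_zero Δ i
  have h2 : (Δ.ray i 0 : ℝ) ^ 2 + (Δ.ray i 1 : ℝ) ^ 2 = 0 := by linarith
  have h3 : (Δ.ray i 0 : ℝ) = 0 := by nlinarith [sq_nonneg (Δ.ray i 0 : ℝ), sq_nonneg (Δ.ray i 1 : ℝ)]
  have h4 : (Δ.ray i 1 : ℝ) = 0 := by nlinarith [sq_nonneg (Δ.ray i 0 : ℝ), sq_nonneg (Δ.ray i 1 : ℝ)]
  ext k
  fin_cases k
  · simpa using h3
  · simpa using h4

theorem nonempty_rays (Δ : SimplicialCompleteFan 2 m) : Nonempty (Fin m) := by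
  obtain ⟨σ, _, c, _, hx⟩ := Δ.complete ![1, 0]
  have h0 := congrFun hx 0
  rcases σ.eq_empty_or_nonempty with rfl | ⟨i, _⟩
  · simp at h0
  · exact ⟨i⟩

/-- The three-term relation between three rays. -/
theorem bracket_relation (i j k : Fin m) (c : Fin 2) :
    bracket Δ j k * Δ.ray i c + bracket Δ k i * Δ.ray j c + bracket Δ i j * Δ.ray k c = 0 := by
  simp only [bracket]
  fin_cases c <;> simp <;> ring

end Fan

/-! ### The differential of a twisted form along its singular set -/

section LocalIdeal

variable {R : Type*} [CommRing R] {L I p : Ideal R} [hp : p.IsPrime]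

theorem mem_minimalPrimes_of_le_localIdeal (h : p ≤ localIdeal I p) (hI : I ≤ p) :
    p ∈ I.minimalPrimes := by
  refine ⟨⟨hp, hI⟩, fun p' hp' hle x hx => ?_⟩
  obtain ⟨w, hw, hwx⟩ := h hx
  exact (hp'.1.mem_or_mem (hp'.2 hwx)).resolve_left fun h => hw (hle h)

/-- At a minimal prime of L some power of x lies in L up to a unit; as L is radical, so does x. -/
theorem le_localIdeal_of_mem_minimalPrimes (hL : L.IsRadical) (h : p ∈ L.minimalPrimes) :
    p ≤ localIdeal L p := by
  intro x hx
  obtain ⟨N, w, hw, hwx⟩ := exists_pow_mem_localIdeal_of_mem_minimalPrimes h hx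
  refine ⟨w, hw, hL ⟨N + 1, ?_⟩⟩
  have : (w * x) ^ (N + 1) = w ^ N * x * (w * x ^ N) := by ring
  rw [this]
  exact L.mul_mem_left _ hwx

end LocalIdeal

section Descends

variable {m : ℕ} {Δ : SimplicialCompleteFan 2 m}

/-- `α` is annihilated by all radial vector fields. -/
def Descends (Δ : SimplicialCompleteFan 2 m) (α : OneForm (Fin m)) : Prop :=
  ∀ a : Fin m → ℤ, IsRelation Δ a → ∑ i, (a i : MvPolynomial (Fin m) ℂ) * X i * α i = 0

variable {α : OneForm (Fin m)} {p : Ideal (MvPolynomial (Fin m) ℂ)} [hp : p.IsPrime]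

theorem intCast_mem_iff (z : ℤ) : (z : MvPolynomial (Fin m) ℂ) ∈ p ↔ z = 0 := by
  constructor
  · intro h
    by_contra hz
    refine hp.ne_top (Ideal.eq_top_of_isUnit_mem _ h ?_)
    rw [← map_intCast (C : ℂ →+* MvPolynomial (Fin m) ℂ)]
    exact (IsUnit.mk0 _ (by exact_mod_cast hz)).map _
  · rintro rfl; simp

theorem Descends.relation (hα : Descends Δ α) {x y z : ℤ} {i j k : Fin m}
    (h : ∀ c, x * Δ.ray i c + y * Δ.ray j c + z * Δ.ray k c = 0) :
    (x : MvPolynomial (Fin m) ℂ) * (X i * α i) + (y : MvPolynomial (Fin m) ℂ) * (X j * α j)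
      + (z : MvPolynomial (Fin m) ℂ) * (X k * α k) = 0 := by
  have := hα _ (isRelation_single_add h)
  rw [sum_single_add] at this
  linear_combination this

theorem Descends.bracket (hα : Descends Δ α) (i j k : Fin m) :
    (bracket Δ j k : MvPolynomial (Fin m) ℂ) * (X i * α i)
      + (bracket Δ k i : MvPolynomial (Fin m) ℂ) * (X j * α j)
      + (bracket Δ i j : MvPolynomial (Fin m) ℂ) * (X k * α k) = 0 :=
  hα.relation (bracket_relation Δ i j k)

/-- The three-term relation solves for [i j] X_k A_k, and both the integer [i j] and X_k are units
at p. -/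
theorem Descends.mem_localIdeal (hα : Descends Δ α) {K : Ideal (MvPolynomial (Fin m) ℂ)}
    {i j k : Fin m} (hij : ToricFoliation.bracket Δ i j ≠ 0) (hi : X i * α i ∈ K)
    (hj : X j * α j ∈ K) (hk : X k ∉ p) : α k ∈ localIdeal K p := by
  have h := hα.bracket i j k
  refine ⟨(ToricFoliation.bracket Δ i j : MvPolynomial (Fin m) ℂ) * X k, fun h' =>
    (hp.mem_or_mem h').elim (fun h' => hij ((intCast_mem_iff _).mp h')) hk, ?_⟩
  have h2 : (ToricFoliation.bracket Δ i j : MvPolynomial (Fin m) ℂ) * X k * α k =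
      -(ToricFoliation.bracket Δ j k : MvPolynomial (Fin m) ℂ) * (X i * α i) +
      -(ToricFoliation.bracket Δ k i : MvPolynomial (Fin m) ℂ) * (X j * α j) := by
    linear_combination h
  rw [h2]
  exact K.add_mem (K.mul_mem_left _ hi) (K.mul_mem_left _ hj)

omit hp in
/-- Differentiating an identity `u x = ∑ c_k α_k` modulo a prime containing `x` and the `α_k`. -/
theorem pderiv_combination_mem {s : Type*} [Fintype s] {f : s → MvPolynomial (Fin m) ℂ}
    (hf : ∀ k, f k ∈ p) {c : s → MvPolynomial (Fin m) ℂ} {u x : MvPolynomial (Fin m) ℂ}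
    (hx : x ∈ p) (h : u * x = ∑ k, c k * f k) (j : Fin m) :
    u * pderiv j x - ∑ k, c k * pderiv j (f k) ∈ p := by
  have h1 := congrArg (pderiv j) h
  simp only [pderiv_mul, map_sum, Finset.sum_add_distrib] at h1
  have h2 : u * pderiv j x - ∑ k, c k * pderiv j (f k) =
      ∑ k, pderiv j (c k) * f k - pderiv j u * x := by linear_combination h1
  rw [h2]
  exact p.sub_mem (p.sum_mem fun k _ => p.mul_mem_left _ (hf k)) (p.mul_mem_left _ hx)

omit hp in
theorem pderiv_mul_mem {x y : MvPolynomial (Fin m) ℂ} (hx : x ∈ p) (hy : y ∈ p) (j : Fin m) :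
    pderiv j (x * y) ∈ p := by
  rw [pderiv_mul]
  exact p.add_mem (p.mul_mem_left _ hy) (p.mul_mem_right _ hx)

theorem height_le_two_of_le_localIdeal {f g : MvPolynomial (Fin m) ℂ} (hf : f ∈ p) (hg : g ∈ p)
    (h : p ≤ localIdeal (Ideal.span {f, g}) p) : p.height ≤ 2 := by
  classical
  have hmin := mem_minimalPrimes_of_le_localIdeal h (Ideal.span_le.mpr (by
    rintro x (rfl | rfl)
    · exact hf
    · exact hg))
  have h1 := Ideal.height_le_card_of_mem_minimalPrimes_span_finset (s := {f, g}) (p := p)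
    (by simpa using hmin)
  exact h1.trans (by exact_mod_cast Finset.card_le_two)

/-- Two parallel rays whose variables vanish on `V(p)`, the only such variables. -/
theorem Descends.false_of_parallel (hα : Descends Δ α) (hα_mem : ∀ i, α i ∈ p)
    (hJ : p ≤ localIdeal (singularIdeal α) p) (hd : ∀ i j, extD α i j ∈ p)
    {i j : Fin m} (hij : i ≠ j) (hbr : ToricFoliation.bracket Δ i j = 0) (hi : X i ∈ p)
    (hj : X j ∈ p) (hI : ∀ k, X k ∈ p → k = i ∨ k = j) : False := by
  obtain ⟨c, hc⟩ := Function.ne_iff.mp (ray_ne_zero Δ i)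
  have hc : Δ.ray i c ≠ 0 := hc
  have hjc : Δ.ray j c ≠ 0 := by
    intro h0
    apply ray_ne_zero Δ j
    ext c'
    have := bracket_mul_ray Δ hbr c c'
    rw [h0, zero_mul] at this
    exact (mul_eq_zero.mp this).resolve_left hc
  set x := Δ.ray j c with hx
  set y := -Δ.ray i c with hy
  -- Here x v_i + y v_j = 0, and x + y = 0 would make the two rays point the same way.
  have hxy : x + y ≠ 0 := by
    intro h0
    apply hij
    apply eq_of_bracket_eq_zero_of_pos Δ hbr (c := c)
    have : Δ.ray j c = Δ.ray i c := by linarith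
    rw [this]
    exact mul_self_pos.mpr hc
  have hrel := hα.relation (x := x) (y := y) (z := 0) (i := i) (j := j) (k := i) (fun c' => by
    have := bracket_mul_ray Δ hbr c c'
    simp only [hx, hy]
    linarith)
  rw [Int.cast_zero, zero_mul, add_zero] at hrel
  have hx0 : (x : MvPolynomial (Fin m) ℂ) ≠ 0 := by exact_mod_cast hjc
  have hy0 : (y : MvPolynomial (Fin m) ℂ) ∉ p := by
    rw [intCast_mem_iff]; exact neg_ne_zero.mpr hc
  have hy00 : (y : MvPolynomial (Fin m) ℂ) ≠ 0 := fun h => hy0 (by rw [h]; exact p.zero_mem)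
  have hdvd : (X i : MvPolynomial (Fin m) ℂ) ∣ α j := by
    have h1 : (X i : MvPolynomial (Fin m) ℂ) ∣ (y : MvPolynomial (Fin m) ℂ) * (X j * α j) :=
      ⟨-(x : MvPolynomial (Fin m) ℂ) * α i, by linear_combination hrel⟩
    rcases X_dvd_mul_iff.mp h1 with h | h
    · exact absurd (p.mem_of_dvd h hi) hy0
    · rcases X_dvd_mul_iff.mp h with h | h
      · exact absurd (X_dvd_X.mp h) (by simpa using hij)
      · exact h
  obtain ⟨B, hB⟩ := hdvd
  have hAi : (x : MvPolynomial (Fin m) ℂ) * α i = -(y : MvPolynomial (Fin m) ℂ) * (X j * B) := by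
    apply mul_left_cancel₀ (X_ne_zero i : (X i : MvPolynomial (Fin m) ℂ) ≠ 0)
    rw [hB] at hrel
    linear_combination hrel
  have hpx : ∀ r (z : ℤ) (f : MvPolynomial (Fin m) ℂ),
      pderiv r ((z : MvPolynomial (Fin m) ℂ) * f) = z * pderiv r f := by
    intro r z f
    rw [pderiv_mul]; simp
  -- With A_j = X_i B and x A_i = −y X_j B, the (i, j) entry of x dα is (x + y) B modulo p.
  have hBp : B ∈ p := by
    have h1 := p.mul_mem_left (x : MvPolynomial (Fin m) ℂ) (hd i j)
    have h2 : (x : MvPolynomial (Fin m) ℂ) * extD α i j =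
        ((x + y : ℤ) : MvPolynomial (Fin m) ℂ) * B +
          ((x : MvPolynomial (Fin m) ℂ) * pderiv i B * X i
            + (y : MvPolynomial (Fin m) ℂ) * pderiv j B * X j) := by
      have h3 := congrArg (pderiv j) hAi
      rw [hpx, ← Int.cast_neg, hpx, pderiv_mul, pderiv_X_self] at h3
      simp only [extD]
      rw [hB, pderiv_mul, pderiv_X_self]
      push_cast at h3 ⊢
      linear_combination -h3
    rw [h2, Submodule.add_mem_iff_left _ (p.add_mem (p.mul_mem_left _ hi) (p.mul_mem_left _ hj))]
      at h1
    exact (hp.mem_or_mem h1).resolve_left (fun h => hxy ((intCast_mem_iff _).mp h))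
  have hxp : (x : MvPolynomial (Fin m) ℂ) ∉ p := by
    rw [intCast_mem_iff]; exact hjc
  have hderj : ∀ r, pderiv r (α j) ∈ p := fun r => by
    rw [hB]; exact pderiv_mul_mem hi hBp r
  have hderi : ∀ r, pderiv r (α i) ∈ p := fun r => by
    have h3 := congrArg (pderiv r) hAi
    rw [hpx, ← Int.cast_neg, hpx] at h3
    have h4 : (x : MvPolynomial (Fin m) ℂ) * pderiv r (α i) ∈ p := by
      rw [h3]; exact p.mul_mem_left _ (pderiv_mul_mem hj hBp r)
    exact (hp.mem_or_mem h4).resolve_left hxp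
  obtain ⟨l, hl⟩ := exists_bracket_ne_zero Δ i
  let f : Fin 3 → MvPolynomial (Fin m) ℂ := ![α i, α j, α l]
  have hf : ∀ k, f k ∈ p := by
    intro k; fin_cases k <;> exact hα_mem _
  have hfi : ∀ t, f t ∈ Ideal.span (Set.range f) := fun t => Ideal.subset_span ⟨t, rfl⟩
  have hle : singularIdeal α ≤ localIdeal (Ideal.span (Set.range f)) p := by
    rw [singularIdeal, Ideal.span_le]
    rintro _ ⟨k, rfl⟩
    by_cases hk : X k ∈ p
    · rcases hI k hk with rfl | rfl
      · exact le_localIdeal (hfi 0)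
      · exact le_localIdeal (hfi 1)
    · exact hα.mem_localIdeal hl (Ideal.mul_mem_left _ _ (hfi 0)) (Ideal.mul_mem_left _ _ (hfi 2)) hk
  -- A_i and A_j have zero differential modulo p, so dX_i and dX_j would both be proportional to
  -- dA_l up to units, although they are independent.
  have key : ∀ t ∈ ({i, j} : Set (Fin m)), ∃ u ∉ p, ∃ e, ∀ r,
      u * pderiv r (X t) - e * pderiv r (α l) ∈ p := by
    intro t ht
    have htp : X t ∈ p := by rcases ht with rfl | rfl <;> assumption
    obtain ⟨u, hu, hmem⟩ := localIdeal_le_localIdeal hle (hJ htp)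
    obtain ⟨c, hc⟩ := Ideal.mem_span_range_iff_exists_fun.mp hmem
    refine ⟨u, hu, c 2, fun r => ?_⟩
    have h1 := pderiv_combination_mem hf htp hc.symm r
    rw [Fin.sum_univ_three] at h1
    have h2 : u * pderiv r (X t) - c 2 * pderiv r (α l) =
        (u * pderiv r (X t) - (c 0 * pderiv r (f 0) + c 1 * pderiv r (f 1) + c 2 * pderiv r (f 2)))
          + (c 0 * pderiv r (α i) + c 1 * pderiv r (α j)) := by
      simp only [f, Matrix.cons_val_zero, Matrix.cons_val_one, Matrix.cons_val]
      ring
    rw [h2]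
    exact p.add_mem h1 (p.add_mem (p.mul_mem_left _ (hderi r)) (p.mul_mem_left _ (hderj r)))
  obtain ⟨u, hu, e, he⟩ := key i (by simp)
  obtain ⟨v, hv, e', he'⟩ := key j (by simp)
  have h1 := he i
  have h2 := he j
  have h3 := he' j
  rw [pderiv_X_self, mul_one] at h1 h3
  rw [pderiv_X_of_ne hij, mul_zero, zero_sub, neg_mem_iff] at h2
  have he0 : e ∉ p := fun h => hu (by
    have := p.add_mem h1 (p.mul_mem_right (pderiv i (α l)) h)
    simpa using this)
  have hlj : pderiv j (α l) ∈ p := (hp.mem_or_mem h2).resolve_left he0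
  apply hv
  have := p.add_mem h3 (p.mul_mem_left e' hlj)
  simpa using this

/-- The second derivatives of the three-term relation. -/
theorem Descends.bracket_pderiv (hα : Descends Δ α) (i j a b c : Fin m) :
    (ToricFoliation.bracket Δ b c : MvPolynomial (Fin m) ℂ) * pderiv i (pderiv j (X a * α a))
      + (ToricFoliation.bracket Δ c a : MvPolynomial (Fin m) ℂ) * pderiv i (pderiv j (X b * α b))
      + (ToricFoliation.bracket Δ a b : MvPolynomial (Fin m) ℂ) * pderiv i (pderiv j (X c * α c))
      = 0 := by
  have hpx : ∀ r (z : ℤ) (f : MvPolynomial (Fin m) ℂ),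
      pderiv r ((z : MvPolynomial (Fin m) ℂ) * f) = z * pderiv r f := by
    intro r z f
    rw [pderiv_mul]; simp
  have h := congrArg (fun x => pderiv i (pderiv j x)) (hα.bracket a b c)
  simpa only [map_add, hpx, map_zero] using h

omit hp in
theorem pderiv_pderiv_X_mul_mem_of_ne {i j k : Fin m} (hk : X k ∈ p) (hi : k ≠ i) (hj : k ≠ j)
    (f : MvPolynomial (Fin m) ℂ) : pderiv i (pderiv j (X k * f)) ∈ p := by
  rw [pderiv_mul, pderiv_X_of_ne hj, zero_mul, zero_add, pderiv_mul, pderiv_X_of_ne hi, zero_mul,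
    zero_add]
  exact p.mul_mem_right _ hk

omit hp in
theorem pderiv_pderiv_X_mul_sub_mem {i j : Fin m} (hij : i ≠ j) (hi : X i ∈ p)
    (f : MvPolynomial (Fin m) ℂ) :
    pderiv i (pderiv j (X i * f)) - pderiv j f ∈ p := by
  rw [pderiv_mul, pderiv_X_of_ne hij, zero_mul, zero_add, pderiv_mul, pderiv_X_self, one_mul,
    add_sub_cancel_left]
  exact p.mul_mem_right _ hi

omit hp in
theorem pderiv_pderiv_X_mul_sub_mem' {i j : Fin m} (hij : i ≠ j) (hj : X j ∈ p)
    (f : MvPolynomial (Fin m) ℂ) :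
    pderiv i (pderiv j (X j * f)) - pderiv i f ∈ p := by
  rw [pderiv_mul, pderiv_X_self, one_mul, map_add, pderiv_mul, pderiv_X_of_ne hij.symm, zero_mul,
    zero_add, add_sub_cancel_left]
  exact p.mul_mem_right _ hj

omit hp in
theorem pderiv_pderiv_X_mul_self_sub_mem {i : Fin m} (hi : X i ∈ p)
    (f : MvPolynomial (Fin m) ℂ) :
    pderiv i (pderiv i (X i * f)) - 2 * pderiv i f ∈ p := by
  have : pderiv i (pderiv i (X i * f)) - 2 * pderiv i f = X i * pderiv i (pderiv i f) := by
    rw [pderiv_mul, pderiv_X_self, one_mul, map_add, pderiv_mul, pderiv_X_self, one_mul]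
    ring
  rw [this]
  exact p.mul_mem_right _ hi

/-- Consequences for the fan of a nonzero off-diagonal entry of the linear part of `α`. -/
theorem Descends.bracket_of_notMem (hα : Descends Δ α) (hd : ∀ i j, extD α i j ∈ p)
    {i j : Fin m} (hij : i ≠ j) (hi : X i ∈ p) (hj : X j ∈ p) (hs : pderiv i (α j) ∉ p) :
    (∀ k, X k ∈ p → k ≠ i → k ≠ j → ToricFoliation.bracket Δ i k = ToricFoliation.bracket Δ j k ∧
      ToricFoliation.bracket Δ i k ≠ 0) ∧
    (∀ k l, X k ∈ p → X l ∈ p → k ≠ i → k ≠ j → l ≠ i → l ≠ j →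
      ToricFoliation.bracket Δ k l = 0) := by
  -- Modulo p, W_k vanishes for the other variables in p, while W_j ≡ ∂_i A_j and, because dα ≡ 0,
  -- also W_i ≡ ∂_i A_j. The differentiated three-term relations thus become conditions on brackets
  -- alone.
  set W : Fin m → MvPolynomial (Fin m) ℂ := fun k => pderiv i (pderiv j (X k * α k)) with hW
  have hWj : W j - pderiv i (α j) ∈ p := pderiv_pderiv_X_mul_sub_mem' hij hj _
  have hWi : W i - pderiv i (α j) ∈ p := by
    have h1 : W i - pderiv j (α i) ∈ p := pderiv_pderiv_X_mul_sub_mem hij hi _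
    have h2 := p.sub_mem h1 (hd i j)
    simp only [extD] at h2
    convert h2 using 1
    ring
  have hWk : ∀ k, X k ∈ p → k ≠ i → k ≠ j → W k ∈ p := fun k hk h1 h2 =>
    pderiv_pderiv_X_mul_mem_of_ne hk h1 h2 _
  have hWi0 : W i ∉ p := fun h => hs (by
    have := p.sub_mem h hWi
    simpa using this)
  have hrel := fun a b c => hα.bracket_pderiv i j a b c
  have hkl : ∀ k l, W k ∈ p → W l ∈ p → ToricFoliation.bracket Δ k l = 0 := by
    intro k l hk hl
    have h := hrel k l i
    have h1 : (ToricFoliation.bracket Δ k l : MvPolynomial (Fin m) ℂ) * W i ∈ p := by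
      have h2 : (ToricFoliation.bracket Δ k l : MvPolynomial (Fin m) ℂ) * W i =
          -(ToricFoliation.bracket Δ l i : MvPolynomial (Fin m) ℂ) * W k
          - (ToricFoliation.bracket Δ i k : MvPolynomial (Fin m) ℂ) * W l := by
        linear_combination h
      rw [h2]
      exact p.sub_mem (p.mul_mem_left _ hk) (p.mul_mem_left _ hl)
    exact (intCast_mem_iff _).mp ((hp.mem_or_mem h1).resolve_right hWi0)
  refine ⟨fun k hk hki hkj => ?_, fun k l hk hl h1 h2 h3 h4 => hkl k l (hWk k hk h1 h2) (hWk l hl h3 h4)⟩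
  have heq : ToricFoliation.bracket Δ i k = ToricFoliation.bracket Δ j k := by
    have h := hrel i j k
    have h1 : ((ToricFoliation.bracket Δ j k - ToricFoliation.bracket Δ i k : ℤ) :
        MvPolynomial (Fin m) ℂ) * W i ∈ p := by
      have h2 : ((ToricFoliation.bracket Δ j k - ToricFoliation.bracket Δ i k : ℤ) :
          MvPolynomial (Fin m) ℂ) * W i =
          -(ToricFoliation.bracket Δ i j : MvPolynomial (Fin m) ℂ) * W k
          + (ToricFoliation.bracket Δ i k : MvPolynomial (Fin m) ℂ) *
            ((W j - pderiv i (α j)) - (W i - pderiv i (α j))) := by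
        have h3 : (ToricFoliation.bracket Δ k i : MvPolynomial (Fin m) ℂ) =
            - ToricFoliation.bracket Δ i k := by rw [bracket_swap]; push_cast; ring
        rw [h3] at h
        push_cast
        linear_combination h
      rw [h2]
      exact p.add_mem (p.mul_mem_left _ (hWk k hk hki hkj)) (p.mul_mem_left _ (p.sub_mem hWj hWi))
    have := (intCast_mem_iff _).mp ((hp.mem_or_mem h1).resolve_right hWi0)
    linarith
  refine ⟨heq, fun h0 => ?_⟩
  obtain ⟨l, hl⟩ := exists_bracket_ne_zero Δ k
  have h := hrel k l i
  rw [h0, Int.cast_zero, zero_mul, add_zero] at h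
  have h1 : (ToricFoliation.bracket Δ k l : MvPolynomial (Fin m) ℂ) * W i ∈ p := by
    have h2 : (ToricFoliation.bracket Δ k l : MvPolynomial (Fin m) ℂ) * W i =
        -(ToricFoliation.bracket Δ l i : MvPolynomial (Fin m) ℂ) * W k := by
      linear_combination h
    rw [h2]
    exact p.mul_mem_left _ (hWk k hk hki hkj)
  exact hl ((intCast_mem_iff _).mp ((hp.mem_or_mem h1).resolve_right hWi0))

/-- Consequences for the fan of a nonzero diagonal entry of the linear part of `α`. -/
theorem Descends.bracket_of_notMem_self (hα : Descends Δ α)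
    {i : Fin m} (hi : X i ∈ p) (hs : pderiv i (α i) ∉ p) :
    (∀ k, X k ∈ p → k ≠ i → ToricFoliation.bracket Δ i k ≠ 0) ∧
    (∀ k l, X k ∈ p → X l ∈ p → k ≠ i → l ≠ i → ToricFoliation.bracket Δ k l = 0) := by
  -- The same device with ∂_i applied twice; here W_i ≡ 2 ∂_i A_i modulo p.
  set W : Fin m → MvPolynomial (Fin m) ℂ := fun k => pderiv i (pderiv i (X k * α k)) with hW
  have hWi : W i - 2 * pderiv i (α i) ∈ p := pderiv_pderiv_X_mul_self_sub_mem hi _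
  have hWk : ∀ k, X k ∈ p → k ≠ i → W k ∈ p := fun k hk h1 =>
    pderiv_pderiv_X_mul_mem_of_ne hk h1 h1 _
  have hWi0 : W i ∉ p := fun h => hs (by
    have h1 : 2 * pderiv i (α i) ∈ p := by
      have := p.sub_mem h hWi
      simpa using this
    refine (hp.mem_or_mem h1).resolve_left fun h2 => ?_
    have := (intCast_mem_iff (p := p) 2).mp (by exact_mod_cast h2)
    norm_num at this)
  have hrel := fun a b c => hα.bracket_pderiv i i a b c
  have key : ∀ k l, (W l ∈ p ∨ ToricFoliation.bracket Δ i k = 0) → W k ∈ p →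
      ToricFoliation.bracket Δ k l = 0 := by
    intro k l hl hk
    have h := hrel k l i
    have h1 : (ToricFoliation.bracket Δ k l : MvPolynomial (Fin m) ℂ) * W i ∈ p := by
      have h2 : (ToricFoliation.bracket Δ k l : MvPolynomial (Fin m) ℂ) * W i =
          -(ToricFoliation.bracket Δ l i : MvPolynomial (Fin m) ℂ) * W k
          - (ToricFoliation.bracket Δ i k : MvPolynomial (Fin m) ℂ) * W l := by
        linear_combination h
      rw [h2]
      refine p.sub_mem (p.mul_mem_left _ hk) ?_
      rcases hl with hl | hl
      · exact p.mul_mem_left _ hl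
      · rw [hl]; simp
    exact (intCast_mem_iff _).mp ((hp.mem_or_mem h1).resolve_right hWi0)
  refine ⟨fun k hk hki h0 => ?_, fun k l hk hl h1 h2 =>
    key k l (Or.inl (hWk l hl h2)) (hWk k hk h1)⟩
  obtain ⟨l, hl⟩ := exists_bracket_ne_zero Δ k
  exact hl (key k l (Or.inr h0) (hWk k hk hki))

omit hp in
theorem eq_or_eq_or_eq_of_mem_three {β : Type*} {a b c i j k l : β} (h1 : i = a ∨ i = b ∨ i = c)
    (h2 : j = a ∨ j = b ∨ j = c) (h3 : k = a ∨ k = b ∨ k = c) (h4 : l = a ∨ l = b ∨ l = c)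
    (hij : i ≠ j) (hik : i ≠ k) (hjk : j ≠ k) : l = i ∨ l = j ∨ l = k := by
  grind

/-- At least three variables vanish on `V(p)`. -/
theorem Descends.false_of_three (hα : Descends Δ α) (hα_mem : ∀ i, α i ∈ p)
    (hJ : p ≤ localIdeal (singularIdeal α) p) (hd : ∀ i j, extD α i j ∈ p)
    {a b c : Fin m} (hab : a ≠ b) (hac : a ≠ c) (hbc : b ≠ c) (ha : X a ∈ p) (hb : X b ∈ p)
    (hc : X c ∈ p) : False := by
  classical
  -- The A_k with X_k ∈ p generate p locally, since three rays are not all parallel. The matrix (∂_r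
  -- A_k) over these indices is symmetric modulo p because dα ≡ 0, and has no zero row because each
  -- dX_t is a combination of the dA_k up to a unit. The fan excludes every pattern of nonzero
  -- entries.
  let s := {k : Fin m // X k ∈ p}
  let f : s → MvPolynomial (Fin m) ℂ := fun k => α k
  have hf : ∀ k, f k ∈ p := fun k => hα_mem _
  have hfi : ∀ k, X k ∈ p → α k ∈ Ideal.span (Set.range f) := fun k hk =>
    Ideal.subset_span ⟨⟨k, hk⟩, rfl⟩
  have hle : singularIdeal α ≤ localIdeal (Ideal.span (Set.range f)) p := by
    rw [singularIdeal, Ideal.span_le]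
    rintro _ ⟨k, rfl⟩
    by_cases hk : X k ∈ p
    · exact le_localIdeal (hfi k hk)
    · rcases exists_bracket_ne_zero_of_three Δ hab hac hbc with h | h | h
      · exact hα.mem_localIdeal h (Ideal.mul_mem_left _ _ (hfi _ ha))
          (Ideal.mul_mem_left _ _ (hfi _ hb)) hk
      · exact hα.mem_localIdeal h (Ideal.mul_mem_left _ _ (hfi _ ha))
          (Ideal.mul_mem_left _ _ (hfi _ hc)) hk
      · exact hα.mem_localIdeal h (Ideal.mul_mem_left _ _ (hfi _ hb))
          (Ideal.mul_mem_left _ _ (hfi _ hc)) hk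
  have hrow : ∀ t, X t ∈ p → ∃ u ∉ p, ∃ e : s → MvPolynomial (Fin m) ℂ, ∀ r,
      u * pderiv r (X t) - ∑ k, e k * pderiv r (α k) ∈ p := by
    intro t ht
    obtain ⟨u, hu, hmem⟩ := localIdeal_le_localIdeal hle (hJ ht)
    obtain ⟨c, hc⟩ := Ideal.mem_span_range_iff_exists_fun.mp hmem
    exact ⟨u, hu, c, fun r => pderiv_combination_mem hf ht hc.symm r⟩
  have hsym : ∀ i j, pderiv i (α j) ∈ p → pderiv j (α i) ∈ p := by
    intro i j h
    have := p.sub_mem h (hd i j)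
    simpa [extD] using this
  have hne : ∀ i, X i ∈ p → ∃ j, X j ∈ p ∧ pderiv i (α j) ∉ p := by
    intro i hi
    by_contra! hcon
    obtain ⟨u, hu, e, he⟩ := hrow i hi
    apply hu
    have h1 := he i
    rw [pderiv_X_self, mul_one, Submodule.sub_mem_iff_left _
      (p.sum_mem fun (k : s) _ => p.mul_mem_left (e k) (hcon k.1 k.2))] at h1
    exact h1
  have hthird : ∀ i k, i ≠ k → ∃ r, X r ∈ p ∧ r ≠ i ∧ r ≠ k := by
    intro i k hik
    by_contra! hcon
    have h1 := hcon a ha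
    have h2 := hcon b hb
    have h3 := hcon c hc
    by_cases ea : a = i
    · have eb := h2 (fun h => hab (ea.trans h.symm))
      have ec := h3 (fun h => hac (ea.trans h.symm))
      exact hbc (eb.trans ec.symm)
    · have ea' := h1 ea
      by_cases eb : b = i
      · exact hac (ea'.trans (h3 (fun h => hbc (eb.trans h.symm))).symm)
      · exact hab (ea'.trans (h2 eb).symm)
  have hsw0 : ∀ {i j}, ToricFoliation.bracket Δ i j = 0 → ToricFoliation.bracket Δ j i = 0 :=
    fun h => by rw [bracket_swap, h, neg_zero]
  -- A nonzero diagonal entry at i makes the other vanishing rays pairwise parallel and none of them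
  -- parallel to v_i; a nonzero entry in another row contradicts this wherever it sits.
  have hdiag : ∀ i, X i ∈ p → pderiv i (α i) ∈ p := by
    intro i hi
    by_contra hs
    obtain ⟨h1, h2⟩ := hα.bracket_of_notMem_self hi hs
    obtain ⟨k, hk, hki⟩ : ∃ k, X k ∈ p ∧ k ≠ i := by
      by_cases h : a = i
      · exact ⟨b, hb, fun h' => hab (h.trans h'.symm)⟩
      · exact ⟨a, ha, h⟩
    obtain ⟨r, hr, hri, hrk⟩ := hthird i k hki.symm
    obtain ⟨l, hl, hkl⟩ := hne k hk
    rcases eq_or_ne l k with rfl | hlk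
    · exact (hα.bracket_of_notMem_self hk hkl).1 r hr hrk (h2 l r hk hr hki hri)
    · obtain ⟨h3, -⟩ := hα.bracket_of_notMem hd hlk.symm hk hl hkl
      rcases eq_or_ne l i with rfl | hli
      · exact (h3 r hr hrk hri).2 (h2 k r hk hr hki hri)
      · have h4 := h3 i hi hki.symm hli.symm
        refine hlk.symm (eq_of_bracket_eq Δ (i := i) ?_ (h1 k hk hki) (h2 k l hk hl hki hli))
        rw [bracket_swap, h4.1, ← bracket_swap]
  obtain ⟨i, hi⟩ : ∃ i, X i ∈ p := ⟨a, ha⟩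
  have hoff : ∀ i, X i ∈ p → ∃ j, X j ∈ p ∧ i ≠ j ∧ pderiv i (α j) ∉ p := by
    intro i hi
    obtain ⟨j, hj, hij⟩ := hne i hi
    refine ⟨j, hj, ?_, hij⟩
    rintro rfl
    exact hij (hdiag i hi)
  -- With a fourth variable, a nonzero entry (a, j) makes all rays other than a, j parallel; a
  -- nonzero entry in the row of one of these gives a nonzero bracket between two of them or
  -- identifies two rays.
  have hcard : ∀ k, X k ∈ p → k = a ∨ k = b ∨ k = c := by
    by_contra! hcon
    obtain ⟨d, hd', hda, hdb, hdc⟩ := hcon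
    obtain ⟨j, hj, haj, hsaj⟩ := hoff a ha
    have hfour : ∃ k r, X k ∈ p ∧ X r ∈ p ∧ k ≠ a ∧ k ≠ j ∧ r ≠ a ∧ r ≠ j ∧ r ≠ k := by
      rcases eq_or_ne j b with rfl | hjb
      · exact ⟨c, d, hc, hd', hac.symm, hbc.symm, hda, hdb, hdc⟩
      · rcases eq_or_ne j c with rfl | hjc
        · exact ⟨b, d, hb, hd', hab.symm, hbc, hda, hdc, hdb⟩
        · exact ⟨b, c, hb, hc, hab.symm, hjb.symm, hac.symm, hjc.symm, hbc.symm⟩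
    obtain ⟨k, r, hk, hr, hka, hkj, hra, hrj, hrk⟩ := hfour
    obtain ⟨h1, h2⟩ := hα.bracket_of_notMem hd haj ha hj hsaj
    obtain ⟨l, hl, hkl, hskl⟩ := hoff k hk
    obtain ⟨h3, -⟩ := hα.bracket_of_notMem hd hkl hk hl hskl
    have hkr := h2 k r hk hr hka hkj hra hrj
    rcases eq_or_ne l a with rfl | hla
    · exact (h3 r hr hrk hra).2 hkr
    rcases eq_or_ne l j with rfl | hlj
    · exact (h3 r hr hrk hrj).2 hkr
    have h4 := h3 a ha hka.symm hla.symm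
    refine hkl (eq_of_bracket_eq Δ (i := a) ?_ ?_ (h2 k l hk hl hka hkj hla hlj))
    · rw [bracket_swap, h4.1, ← bracket_swap]
    · intro h0; exact h4.2 (hsw0 h0)
  -- If the entry (j, k) vanished, expressing dX_j through the dA's would force the entry (k, i) to
  -- vanish too, leaving row k zero.
  have hall : ∀ i j k, X i ∈ p → X j ∈ p → X k ∈ p → i ≠ j → i ≠ k → j ≠ k →
      pderiv j (α k) ∉ p := by
    intro i j k hi hj hk hij hik hjk hs
    have hcover : ∀ l, X l ∈ p → l = i ∨ l = j ∨ l = k := by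
      intro l hl
      exact eq_or_eq_or_eq_of_mem_three (hcard i hi) (hcard j hj) (hcard k hk) (hcard l hl)
        hij hik hjk
    obtain ⟨u, hu, e, he⟩ := hrow j hj
    have hsum : ∀ r, X r ∈ p → pderiv r (α j) ∈ p → pderiv r (α k) ∈ p →
        u * pderiv r (X j) - e ⟨i, hi⟩ * pderiv r (α i) ∈ p := by
      intro r hr h1 h2
      have h3 := he r
      rw [← Finset.add_sum_erase _ _ (Finset.mem_univ (⟨i, hi⟩ : s)), ← sub_sub,
        Submodule.sub_mem_iff_left] at h3
      · exact h3
      · refine p.sum_mem fun l hl => p.mul_mem_left _ ?_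
        rcases hcover l l.2 with h | h | h
        · exact absurd (Subtype.ext h) (Finset.mem_erase.mp hl).1
        · rw [h]; exact h1
        · rw [h]; exact h2
    have h1 := hsum j hj (hdiag j hj) hs
    have h2 := hsum k hk (hsym _ _ hs) (hdiag k hk)
    rw [pderiv_X_self, mul_one] at h1
    rw [pderiv_X_of_ne hjk, mul_zero, zero_sub, neg_mem_iff] at h2
    have he0 : e ⟨i, hi⟩ ∉ p := fun h => hu (by
      have := p.add_mem h1 (p.mul_mem_right (pderiv j (α i)) h)
      simpa using this)
    have hki := (hp.mem_or_mem h2).resolve_left he0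
    obtain ⟨l, hl, hkl, hskl⟩ := hoff k hk
    rcases hcover l hl with rfl | rfl | rfl
    · exact hskl hki
    · exact hskl (hsym _ _ hs)
    · exact hkl rfl
  -- The three entries give [b a] = [c a], [a b] = [c b] and [a c] = [b c], all nonzero, which
  -- antisymmetry forbids.
  have x1 := (hα.bracket_of_notMem hd hbc hb hc (hall a b c ha hb hc hab hac hbc)).1 a ha hab hac
  have x2 := (hα.bracket_of_notMem hd hac ha hc (hall b a c hb ha hc hab.symm hbc hac)).1 b hb
    hab.symm hbc
  have x3 := (hα.bracket_of_notMem hd hab ha hb (hall c a b hc ha hb hac.symm hbc.symm hab)).1 c hc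
    hac.symm hbc.symm
  have s1 := bracket_swap Δ a b
  have s2 := bracket_swap Δ a c
  have s3 := bracket_swap Δ b c
  have := x1.1; have := x2.1; have := x3.1; have := x3.2
  omega

/-- The differential of `α` does not vanish identically along a component of the singular
scheme. -/
theorem Descends.exists_extD_notMem (hα : Descends Δ α) (hrad : (singularIdeal α).IsRadical)
    (hht : 3 ≤ (contentIdeal (extD α)).height) (hmin : p ∈ (singularIdeal α).minimalPrimes) :
    ∃ i j, extD α i j ∉ p := by
  by_contra! hd
  have hα_mem : ∀ i, α i ∈ p := fun i => hmin.1.2 (mem_singularIdeal α i)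
  have hJ := le_localIdeal_of_mem_minimalPrimes hrad hmin
  have hp3 : 3 ≤ p.height := hht.trans (Ideal.height_mono (Ideal.span_le.mpr (by
    rintro _ ⟨i, j, rfl⟩; exact hd i j)))
  -- If the vanishing variables lie among i, j with independent rays, A_i and A_j generate p locally
  -- and p has height at most two, against the codimension of dα.
  have hpair : ∀ i j, ToricFoliation.bracket Δ i j ≠ 0 → (∀ k, X k ∈ p → k = i ∨ k = j) →
      False := by
    intro i j hij hI
    have hle : singularIdeal α ≤ localIdeal (Ideal.span {α i, α j}) p := by
      rw [singularIdeal, Ideal.span_le]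
      rintro _ ⟨k, rfl⟩
      by_cases hk : X k ∈ p
      · rcases hI k hk with rfl | rfl
        · exact le_localIdeal (Ideal.subset_span (by simp))
        · exact le_localIdeal (Ideal.subset_span (by simp))
      · exact hα.mem_localIdeal hij (Ideal.mul_mem_left _ _ (Ideal.subset_span (by simp)))
          (Ideal.mul_mem_left _ _ (Ideal.subset_span (by simp))) hk
    have := height_le_two_of_le_localIdeal (hα_mem i) (hα_mem j)
      (hJ.trans (localIdeal_le_localIdeal hle))
    exact absurd (hp3.trans this) (by norm_num)
  by_cases h0 : ∃ i, X i ∈ p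
  · obtain ⟨i, hi⟩ := h0
    by_cases h1 : ∃ j, X j ∈ p ∧ j ≠ i
    · obtain ⟨j, hj, hji⟩ := h1
      by_cases h2 : ∃ k, X k ∈ p ∧ k ≠ i ∧ k ≠ j
      · obtain ⟨k, hk, hki, hkj⟩ := h2
        exact hα.false_of_three hα_mem hJ hd hji.symm hki.symm hkj.symm hi hj hk
      · push Not at h2
        have hI : ∀ k, X k ∈ p → k = i ∨ k = j := fun k hk => by
          by_cases h : k = i
          · exact Or.inl h
          · exact Or.inr (h2 k hk h)
        by_cases hbr : ToricFoliation.bracket Δ i j = 0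
        · exact hα.false_of_parallel hα_mem hJ hd hji.symm hbr hi hj hI
        · exact hpair i j hbr hI
    · push Not at h1
      obtain ⟨l, hl⟩ := exists_bracket_ne_zero Δ i
      exact hpair i l hl fun k hk => Or.inl (h1 k hk)
  · push Not at h0
    obtain ⟨i⟩ := nonempty_rays Δ
    obtain ⟨l, hl⟩ := exists_bracket_ne_zero Δ i
    exact hpair i l hl fun k hk => absurd hk (h0 k)

end Descends

/-! ### Flat extensions -/

section Flat

variable {S T : Type*} [CommRing S] [CommRing T]

/-- Multiplication by c is injective on S/I, and tensoring with the flat module T keeps it injective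
on T/IT. -/
theorem mem_map_of_mul_mem_map_of_flat {φ : S →+* T} (hφ : φ.Flat) {I : Ideal S} {c : S}
    (hc : ∀ x, c * x ∈ I → x ∈ I) {y : T} (hy : φ c * y ∈ I.map φ) : y ∈ I.map φ := by
  algebraize [φ]
  have hinj : Function.Injective (LinearMap.lsmul S (S ⧸ I) c) := by
    rw [← LinearMap.ker_eq_bot, LinearMap.ker_eq_bot']
    intro x hx
    obtain ⟨x, rfl⟩ := Ideal.Quotient.mk_surjective x
    rw [LinearMap.lsmul_apply, ← Ideal.Quotient.mk_eq_mk, ← Submodule.Quotient.mk_smul,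
      Submodule.Quotient.mk_eq_zero, smul_eq_mul] at hx
    rw [Ideal.Quotient.eq_zero_iff_mem]
    exact hc x hx
  have hT := Module.Flat.lTensor_preserves_injective_linearMap (M := T) _ hinj
  have hmem : ∀ t : T, t ∈ I.map φ ↔
      (t ⊗ₜ[S] (Ideal.Quotient.mk I 1) : TensorProduct S T (S ⧸ I)) = 0 := by
    intro t
    rw [← (TensorProduct.tensorQuotEquivQuotSMul T I).map_eq_zero_iff,
      TensorProduct.tensorQuotEquivQuotSMul_tmul_mk, one_smul, Submodule.Quotient.mk_eq_zero,
      Ideal.smul_top_eq_map, Submodule.restrictScalars_mem]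
    rfl
  rw [hmem] at hy ⊢
  apply hT
  rw [map_zero, LinearMap.lTensor_tmul, LinearMap.lsmul_apply, ← hy, ← TensorProduct.smul_tmul,
    Algebra.smul_def]
  rfl

theorem dvd_of_dvd_mul_of_flat {φ : S →+* T} (hφ : φ.Flat) {s t : S}
    (h : ∀ x, s ∣ t * x → s ∣ x) {y : T} (hy : φ s ∣ φ t * y) : φ s ∣ y := by
  have := mem_map_of_mul_mem_map_of_flat hφ (I := Ideal.span {s}) (c := t) (y := y)
    (by simpa only [Ideal.mem_span_singleton] using h)
    (by rw [Ideal.map_span, Set.image_singleton, Ideal.mem_span_singleton]; exact hy)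
  rwa [Ideal.map_span, Set.image_singleton, Ideal.mem_span_singleton] at this

theorem injective_of_flat [IsDomain S] [Nontrivial T] {φ : S →+* T} (hφ : φ.Flat) :
    Function.Injective φ := by
  rw [injective_iff_map_eq_zero]
  intro c hc
  by_contra hc0
  have := mem_map_of_mul_mem_map_of_flat hφ (I := ⊥) (c := c) (y := 1)
    (fun x hx => by
      rw [Ideal.mem_bot] at hx ⊢
      exact (mul_eq_zero.mp hx).resolve_left hc0) (by rw [hc]; simp)
  rw [Ideal.map_bot, Ideal.mem_bot] at this
  exact one_ne_zero this

/-- Coprimality makes t a nonzerodivisor modulo s, which flatness preserves; cancelling a common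
divisor of the images then shows it is a unit. -/
theorem isRelPrime_map_of_flat [IsDomain S] [UniqueFactorizationMonoid S] [IsDomain T]
    {φ : S →+* T} (hφ : φ.Flat) {s t : S} (hs : s ≠ 0) (h : IsRelPrime s t) :
    IsRelPrime (φ s) (φ t) := by
  intro d hds hdt
  obtain ⟨a, ha⟩ := hds
  obtain ⟨b, hb⟩ := hdt
  have hs0 : φ s ≠ 0 := fun h0 => hs (injective_of_flat hφ (by rw [h0, map_zero]))
  obtain ⟨c, hc⟩ := dvd_of_dvd_mul_of_flat hφ (fun x hx => h.dvd_of_dvd_mul_left hx)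
    (y := a) ⟨b, by rw [ha, hb]; ring⟩
  have ha0 : a ≠ 0 := by rintro rfl; rw [mul_zero] at ha; exact hs0 ha
  refine IsUnit.of_mul_eq_one c (mul_left_cancel₀ ha0 ?_)
  rw [mul_one]
  conv_rhs => rw [hc, ha]
  ring

/-- Associated primes of `T ⧸ I T` lie over minimal primes of a radical ideal `I`. -/
theorem comap_mem_minimalPrimes_of_flat [IsNoetherianRing S] {φ : S →+* T} (hφ : φ.Flat)
    {I : Ideal S} (hI : I.IsRadical) {Q : Ideal T} [hQ : Q.IsPrime] {y : T}
    (hy : ∀ r, r ∈ Q ↔ r * y ∈ I.map φ) : Q.comap φ ∈ I.minimalPrimes := by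
  classical
  have hfin := Ideal.finite_minimalPrimes_of_isNoetherianRing S I
  have hIQ : I ≤ Q.comap φ := fun x hx => by
    rw [Ideal.mem_comap, hy]
    exact Ideal.mul_mem_right _ _ (Ideal.mem_map_of_mem _ hx)
  have hQp : (Q.comap φ).IsPrime := Ideal.comap_isPrime _ _
  -- An element outside all minimal primes is a nonzerodivisor modulo the radical ideal I, hence
  -- modulo IT by flatness, and so cannot annihilate the class of y.
  have hsub : ((Q.comap φ : Ideal S) : Set S) ⊆ ⋃ i ∈ (↑hfin.toFinset : Set (Ideal S)), (i : Set S) := by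
    intro c hc
    by_contra hcon
    have hnot : ∀ P ∈ I.minimalPrimes, c ∉ P := by
      intro P hP hcP
      exact hcon (Set.mem_biUnion (by simpa using hP) hcP)
    have hreg : ∀ x, c * x ∈ I → x ∈ I := by
      intro x hx
      rw [← hI.radical, ← Ideal.sInf_minimalPrimes, Ideal.mem_sInf]
      intro P hP
      exact (hP.1.1.mem_or_mem (hP.1.2 hx)).resolve_left (hnot P hP)
    have h1 : φ c * y ∈ I.map φ := (hy _).mp hc
    have h2 := mem_map_of_mul_mem_map_of_flat hφ hreg h1
    refine hQ.ne_top ((Ideal.eq_top_iff_one _).mpr ((hy 1).mpr ?_))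
    rwa [one_mul]
  rw [Ideal.subset_union_prime (f := fun i => i) ⊥ ⊥
    (fun P hP _ _ => (hfin.mem_toFinset.mp hP).1.1)] at hsub
  obtain ⟨P, hP, hle⟩ := hsub
  have hP' := hfin.mem_toFinset.mp hP
  have := hP'.2 ⟨hQp, hIQ⟩ hle
  rwa [le_antisymm hle this]

end Flat

/-! ### Pullbacks of integrable forms -/

section Pullback

variable {ι κ : Type} [Fintype ι] {α : OneForm ι}

/-- The `1`-form `F^*(i_{∂_l} dα)`. -/
def contractPullback (F : ι → MvPolynomial κ ℂ) (α : OneForm ι) (l : ι) : OneForm κ :=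
  fun a => ∑ j, aeval F (extD α l j) * pderiv a (F j)

omit [Fintype ι] in
theorem aeval_mem_span (F : ι → MvPolynomial κ ℂ) {p : MvPolynomial ι ℂ}
    (hp : p ∈ singularIdeal α) :
    aeval F p ∈ Ideal.span (Set.range fun i => aeval F (α i)) := by
  have h := Ideal.mem_map_of_mem (aeval (R := ℂ) F).toRingHom hp
  rw [singularIdeal, Ideal.map_span, ← Set.range_comp] at h
  exact h

omit [Fintype ι] in
theorem extD_mul (h : ∀ i j k, α i * extD α j k + α j * extD α k i + α k * extD α i j = 0)
    (i j k : ι) : extD α i j * α k = extD α k j * α i - extD α k i * α j := by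
  have h1 := h i j k
  rw [extD_antisymm α k j] at h1
  linear_combination h1

theorem extD_pullback_eq_contract (F : ι → MvPolynomial κ ℂ) (α : OneForm ι) (a b : κ) :
    extD (pullback F α) a b = ∑ l, contractPullback F α l b * pderiv a (F l) := by
  rw [extD_pullback]
  refine Finset.sum_congr rfl fun j _ => ?_
  rw [contractPullback, Finset.sum_mul]
  exact Finset.sum_congr rfl fun i _ => by ring

/-- Contracting α ∧ dα = 0 with ∂_l gives A_l dα = α ∧ i_{∂_l} dα; this is the pullback. -/
theorem aeval_mul_extD_pullback (F : ι → MvPolynomial κ ℂ)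
    (h : ∀ i j k, α i * extD α j k + α j * extD α k i + α k * extD α i j = 0) (l : ι) (a b : κ) :
    aeval F (α l) * extD (pullback F α) a b =
      pullback F α a * contractPullback F α l b - pullback F α b * contractPullback F α l a := by
  have h1 : ∀ j i, aeval F (α l) * (aeval F (extD α j i) * pderiv a (F j) * pderiv b (F i)) =
      aeval F (α j) * pderiv a (F j) * (aeval F (extD α l i) * pderiv b (F i)) -
      aeval F (α i) * pderiv b (F i) * (aeval F (extD α l j) * pderiv a (F j)) := by
    intro j i
    have h2 := congrArg (aeval F) (extD_mul h j i l)
    simp only [map_mul, map_sub] at h2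
    linear_combination (pderiv a (F j) * pderiv b (F i)) * h2
  rw [extD_pullback, Finset.mul_sum]
  simp only [Finset.mul_sum, h1, Finset.sum_sub_distrib]
  congr 1
  · rw [pullback, contractPullback, Finset.sum_mul_sum]
  · rw [pullback, contractPullback, Finset.sum_mul_sum, Finset.sum_comm]

/-- Contraction of α ∧ dα = 0 with both ∂_i and ∂_j, pulled back. -/
theorem aeval_extD_mul_pullback (F : ι → MvPolynomial κ ℂ)
    (h : ∀ i j k, α i * extD α j k + α j * extD α k i + α k * extD α i j = 0) (i j : ι) (a : κ) :
    aeval F (extD α i j) * pullback F α a =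
      aeval F (α j) * contractPullback F α i a - aeval F (α i) * contractPullback F α j a := by
  simp only [pullback, contractPullback, Finset.mul_sum, ← Finset.sum_sub_distrib]
  refine Finset.sum_congr rfl fun k _ => ?_
  have h2 := congrArg (aeval F) (h i j k)
  simp only [map_mul, map_add, map_zero, extD_antisymm α i k, map_neg] at h2
  linear_combination pderiv a (F k) * h2

theorem pullback_integrable (F : ι → MvPolynomial κ ℂ)
    (h : ∀ i j k, α i * extD α j k + α j * extD α k i + α k * extD α i j = 0) (a b c : κ) :
    pullback F α a * extD (pullback F α) b c + pullback F α b * extD (pullback F α) c a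
      + pullback F α c * extD (pullback F α) a b = 0 := by
  have h1 : ∀ a b c : κ, pullback F α a * extD (pullback F α) b c =
      pullback F α b * extD (pullback F α) a c - pullback F α c * extD (pullback F α) a b := by
    intro a b c
    rw [extD_pullback_eq_contract F α a c, extD_pullback_eq_contract F α a b]
    conv_lhs => rw [pullback, Finset.sum_mul]
    rw [Finset.mul_sum, Finset.mul_sum, ← Finset.sum_sub_distrib]
    refine Finset.sum_congr rfl fun l _ => ?_
    linear_combination pderiv a (F l) * aeval_mul_extD_pullback F h l b c
  rw [h1 a b c, extD_antisymm (pullback F α) a c]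
  ring

/-- Modulo J(α) the form dα is decomposable, so (dα)_{ij} dα agrees with i_{∂_i} dα ∧ i_{∂_j} dα. -/
theorem contract_pluecker_mem (F : ι → MvPolynomial κ ℂ)
    (h : ∀ i j k, α i * extD α j k + α j * extD α k i + α k * extD α i j = 0) (i j : ι) (a b : κ) :
    aeval F (extD α i j) * extD (pullback F α) a b -
      (contractPullback F α i a * contractPullback F α j b
        - contractPullback F α i b * contractPullback F α j a) ∈
      Ideal.span (Set.range fun i => aeval F (α i)) := by
  have h1 : aeval F (extD α i j) * extD (pullback F α) a b -
      (contractPullback F α i a * contractPullback F α j b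
        - contractPullback F α i b * contractPullback F α j a) =
      ∑ r, ∑ k, pderiv a (F r) * pderiv b (F k) * aeval F (extD α r i * extD α j k
        + extD α k i * extD α r j + extD α i j * extD α r k) := by
    have h2 : ∀ r k, pderiv a (F r) * pderiv b (F k) * aeval F (extD α r i * extD α j k
        + extD α k i * extD α r j + extD α i j * extD α r k) =
        aeval F (extD α i j) * (aeval F (extD α r k) * pderiv a (F r) * pderiv b (F k))
        - aeval F (extD α i r) * pderiv a (F r) * (aeval F (extD α j k) * pderiv b (F k))
        + aeval F (extD α j r) * pderiv a (F r) * (aeval F (extD α i k) * pderiv b (F k)) := by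
      intro r k
      rw [extD_antisymm α i r, extD_antisymm α i k, extD_antisymm α j r]
      simp only [map_add, map_mul, map_neg]
      ring
    simp only [h2, Finset.sum_add_distrib, Finset.sum_sub_distrib, ← Finset.mul_sum,
      ← Finset.sum_mul]
    simp only [← extD_pullback]
    simp only [contractPullback]
    ring
  rw [h1]
  exact Ideal.sum_mem _ fun r _ => Ideal.sum_mem _ fun k _ =>
    Ideal.mul_mem_left _ _ (aeval_mem_span F (pluecker_mem h r i j k))

theorem singularIdeal_pullback_le (F : ι → MvPolynomial κ ℂ) (α : OneForm ι) :
    singularIdeal (pullback F α) ≤ Ideal.span (Set.range fun i => aeval F (α i)) := by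
  rw [singularIdeal, Ideal.span_le]
  rintro _ ⟨a, rfl⟩
  exact Ideal.sum_mem _ fun i _ => Ideal.mul_mem_right _ _ (Ideal.subset_span ⟨i, rfl⟩)

theorem span_le_unfoldingsIdeal (F : ι → MvPolynomial κ ℂ)
    (h : ∀ i j k, α i * extD α j k + α j * extD α k i + α k * extD α i j = 0) :
    Ideal.span (Set.range fun i => aeval F (α i)) ≤ unfoldingsIdeal (pullback F α) := by
  rw [Ideal.span_le]
  rintro _ ⟨l, rfl⟩
  refine ⟨contractPullback F α l, ?_⟩
  ext1 a; ext1 b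
  exact aeval_mul_extD_pullback F h l a b

theorem unfoldingsIdeal_le_kupkaIdeal (ω : OneForm κ) : unfoldingsIdeal ω ≤ kupkaIdeal ω := by
  rintro x ⟨η, hη⟩
  refine Ideal.mem_sup_left ?_
  rw [Ideal.mem_torsionOf_iff]
  ext1 a; ext1 b
  have h1 := congrFun (congrFun hη a) b
  simp only [Pi.smul_apply, smul_eq_mul, wedge] at h1
  simp only [Pi.smul_apply, Pi.zero_apply]
  rw [← Ideal.Quotient.mk_eq_mk, ← Submodule.Quotient.mk_smul, Submodule.Quotient.mk_eq_zero,
    smul_eq_mul, h1]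
  exact Ideal.sub_mem _ (Ideal.mul_mem_right _ _ (mem_singularIdeal ω a))
    (Ideal.mul_mem_right _ _ (mem_singularIdeal ω b))

/-- If no associated prime of `I` contains the content of `dω`, the Kupka ideal of `ω` is contained
in `I`. -/
theorem kupkaIdeal_le [Fintype κ] {ω : OneForm κ} {I : Ideal (MvPolynomial κ ℂ)} (hI : singularIdeal ω ≤ I)
    (h : ∀ (Q : Ideal (MvPolynomial κ ℂ)) (y : MvPolynomial κ ℂ), Q.IsPrime →
      (∀ r, r ∈ Q ↔ r * y ∈ I) → (∀ a b, extD ω a b ∈ Q) → False) : kupkaIdeal ω ≤ I := by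
  refine sup_le (fun x hx => ?_) hI
  rw [Ideal.mem_torsionOf_iff] at hx
  by_contra hxI
  have hx0 : (Ideal.Quotient.mk I x : MvPolynomial κ ℂ ⧸ I) ≠ 0 := fun h0 =>
    hxI (Ideal.Quotient.eq_zero_iff_mem.mp h0)
  -- The annihilator of the nonzero class of x lies in an associated prime, and it contains the
  -- coefficients of dω because J(ω) ⊆ I.
  obtain ⟨Q, hQ, hle⟩ :=
    exists_le_isAssociatedPrime_of_isNoetherianRing (MvPolynomial κ ℂ) _ hx0
  obtain ⟨hQp, z, hz⟩ := isAssociatedPrime_iff.mp hQ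
  obtain ⟨y, rfl⟩ := Ideal.Quotient.mk_surjective z
  have hmem : ∀ r y : MvPolynomial κ ℂ,
      r • (Ideal.Quotient.mk I y : MvPolynomial κ ℂ ⧸ I) = 0 ↔ r * y ∈ I := by
    intro r y
    rw [← Ideal.Quotient.mk_eq_mk, ← Submodule.Quotient.mk_smul, Submodule.Quotient.mk_eq_zero,
      smul_eq_mul]
  refine h Q y hQp (fun r => ?_) fun a b => hle ?_
  · rw [hz, ← hmem, Submodule.mem_colon_singleton, Submodule.mem_bot]
  · rw [Submodule.mem_colon_singleton, Submodule.mem_bot, hmem]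
    have h1 := congrFun (congrFun hx a) b
    simp only [Pi.smul_apply, Pi.zero_apply] at h1
    rw [← Ideal.Quotient.mk_eq_mk, ← Submodule.Quotient.mk_smul, Submodule.Quotient.mk_eq_zero,
      smul_eq_mul] at h1
    rw [mul_comm]
    exact hI h1

/-- If `i_δ dα` vanishes along the ideal and `dα` does not, then `δ` preserves the ideal. -/
theorem derivation_mul_extD_mem [Fintype κ] (F : ι → MvPolynomial κ ℂ)
    (h : ∀ i j k, α i * extD α j k + α j * extD α k i + α k * extD α i j = 0)
    {I : Ideal (MvPolynomial κ ℂ)} (hI : Ideal.span (Set.range fun i => aeval F (α i)) ≤ I)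
    (v : κ → MvPolynomial κ ℂ)
    (hv : ∀ l, ∑ a, v a * contractPullback F α l a ∈ I) (r i j : ι) :
    aeval F (extD α i j) * ∑ a, v a * pderiv a (aeval F (α r)) ∈ I := by
  set x : ι → MvPolynomial κ ℂ := fun s => ∑ a, v a * pderiv a (F s) with hx
  have hc : ∀ l, ∑ a, v a * contractPullback F α l a = ∑ s, aeval F (extD α l s) * x s := by
    intro l
    simp only [contractPullback, hx, Finset.mul_sum]
    rw [Finset.sum_comm]
    exact Finset.sum_congr rfl fun s _ => Finset.sum_congr rfl fun a _ => by ring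
  have hd : ∑ a, v a * pderiv a (aeval F (α r)) = ∑ s, aeval F (pderiv s (α r)) * x s := by
    simp only [pderiv_aeval, hx, Finset.mul_sum]
    rw [Finset.sum_comm]
    exact Finset.sum_congr rfl fun s _ => Finset.sum_congr rfl fun a _ => by ring
  simp only [hc] at hv
  rw [hd]
  -- Replace ∂_s A_r by ∂_r A_s − (dα)_{rs} and use α ∧ dα = 0 differentiated along ∂_r; what
  -- remains are contractions of dα with the pushed-forward vector x.
  have h1 : aeval F (extD α i j) * ∑ s, aeval F (pderiv s (α r)) * x s =
      ∑ s, x s * aeval F (pderiv r (α i) * extD α j s + pderiv r (α j) * extD α s i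
        + pderiv r (α s) * extD α i j)
      - aeval F (pderiv r (α i)) * ∑ s, aeval F (extD α j s) * x s
      + aeval F (pderiv r (α j)) * ∑ s, aeval F (extD α i s) * x s
      - aeval F (extD α i j) * ∑ s, aeval F (extD α r s) * x s := by
    simp only [Finset.mul_sum, ← Finset.sum_sub_distrib, ← Finset.sum_add_distrib]
    refine Finset.sum_congr rfl fun s _ => ?_
    rw [extD_antisymm α i s]
    simp only [map_add, map_mul, map_neg, extD, map_sub]
    ring
  rw [h1]
  refine I.sub_mem (I.add_mem (I.sub_mem ?_ (I.mul_mem_left _ (hv j))) (I.mul_mem_left _ (hv i)))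
    (I.mul_mem_left _ (hv r))
  exact I.sum_mem fun s _ => I.mul_mem_left _ (hI (aeval_mem_span F (pderiv_integrable_mem h r i j s)))

end Pullback

/-! ### Primes of height two -/

section Commutative

variable {R : Type*} [CommRing R]

theorem exists_reduced_pair [IsDomain R] [UniqueFactorizationMonoid R] (a b : R) :
    ∃ d s t, a = d * s ∧ b = d * t ∧ (d = 0 ∨ IsRelPrime s t) := by
  by_cases ha : a = 0
  · by_cases hb : b = 0
    · exact ⟨0, 0, 0, by simp [ha], by simp [hb], Or.inl rfl⟩
    · obtain ⟨s, t, d, h, h1, h2⟩ := UniqueFactorizationMonoid.exists_reduced_factors' a b hb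
      exact ⟨d, s, t, h1.symm, h2.symm, Or.inr h⟩
  · obtain ⟨s, t, d, h, h1, h2⟩ := UniqueFactorizationMonoid.exists_reduced_factors a ha b
    exact ⟨d, s, t, h1.symm, h2.symm, Or.inr h⟩

theorem height_le_one_of_le_localIdeal [IsNoetherianRing R] {p : Ideal R} [p.IsPrime] {d : R}
    (hd : d ∈ p) (h : p ≤ localIdeal (Ideal.span {d}) p) : p.height ≤ 1 :=
  Ideal.height_le_one_of_isPrincipal_of_mem_minimalPrimes (Ideal.span {d}) p
    (mem_minimalPrimes_of_le_localIdeal h (by simpa [Ideal.span_le] using hd))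

/-- A prime strictly below Q has height at most one and cannot contain a coprime pair. -/
theorem mem_minimalPrimes_of_isRelPrime [IsNoetherianRing R] [IsDomain R]
    [UniqueFactorizationMonoid R] {L Q : Ideal R} [hQ : Q.IsPrime] {f g : R}
    (hfg : IsRelPrime f g) (hht : Q.height ≤ 2) (hLQ : L ≤ Q)
    (h : ∀ P : Ideal R, P.IsPrime → L ≤ P → P ≤ Q → f ∈ P ∧ g ∈ P) : Q ∈ L.minimalPrimes := by
  refine ⟨⟨hQ, hLQ⟩, fun P hP hPQ => ?_⟩
  by_contra hne
  have := hP.1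
  obtain ⟨hf, hg⟩ := h P hP.1 hP.2 hPQ
  refine two_le_height_of_isRelPrime hf hg hfg ?_
  have h1 := (Ideal.height_strict_mono_of_isPrime_of_isPrime (lt_of_le_not_ge hPQ hne)).trans_le hht
  rw [show (2 : ℕ∞) = 1 + 1 by norm_num] at h1
  exact (ENat.lt_add_one_iff (by simp)).mp h1

/-- A diagonal `3 × 3` matrix of rank at most two is singular. -/
theorem diagonal_three_eq_zero (u c d x y : Fin 3 → R)
    (h : ∀ r s, c r * x s + d r * y s = if r = s then u r else 0) : u 0 * u 1 * u 2 = 0 := by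
  have h00 := h 0 0
  have h01 := h 0 1
  have h02 := h 0 2
  have h11 := h 1 1
  have h12 := h 1 2
  have h21 := h 2 1
  have h22 := h 2 2
  simp only [Fin.isValue, if_true, Fin.reduceEq, if_false] at h00 h01 h02 h11 h12 h21 h22
  have h10 := h 1 0
  have h20 := h 2 0
  simp only [Fin.isValue, Fin.reduceEq, if_false] at h10 h20
  rw [← h00, ← h11, ← h22]
  linear_combination (c 0 * x 0 + d 0 * y 0) * (c 2 * x 1 + d 2 * y 1) * h12
    + (c 1 * x 0 + d 1 * y 0) * (c 2 * x 2 + d 2 * y 2) * h01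
    - (c 1 * x 2 + d 1 * y 2) * (c 2 * x 0 + d 2 * y 0) * h01
    - (c 2 * x 1 + d 2 * y 1) * (c 1 * x 0 + d 1 * y 0) * h02
    + (c 2 * x 0 + d 2 * y 0) * (c 1 * x 1 + d 1 * y 1) * h02

/-- If `Nᵀ M N` vanishes modulo a prime not containing `det N`, then so does `M`. -/
theorem mem_of_congruent_mem {ι : Type*} [Fintype ι] [DecidableEq ι] {Q : Ideal R}
    [hQ : Q.IsPrime] (N M : Matrix ι ι R) (hN : N.det ∉ Q)
    (h : ∀ c c', ∑ l, ∑ k, M l k * N l c * N k c' ∈ Q) (l k : ι) : M l k ∈ Q := by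
  let π := Ideal.Quotient.mk Q
  have h1 : (N.map π).transpose * M.map π * N.map π = 0 := by
    ext c c'
    rw [Matrix.mul_apply, Matrix.zero_apply]
    rw [← Ideal.Quotient.eq_zero_iff_mem.mpr (h c c'), map_sum]
    simp only [Matrix.mul_apply, Matrix.transpose_apply, Matrix.map_apply, Finset.sum_mul, map_sum]
    rw [Finset.sum_comm]
    refine Finset.sum_congr rfl fun a _ => Finset.sum_congr rfl fun b _ => ?_
    simp only [map_mul]
    change π _ * π _ * π _ = π _ * π _ * π _
    ring
  have hdet : (N.map π).det ≠ 0 := by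
    have h2 := RingHom.map_det π N
    rw [RingHom.mapMatrix_apply] at h2
    rw [← h2]
    intro h0
    exact hN (Ideal.Quotient.eq_zero_iff_mem.mp h0)
  have h3 : (N.map π).det • (N.map π).det • M.map π = 0 := by
    have h4 := congrArg (fun A => (N.map π).transpose.adjugate * A * (N.map π).adjugate) h1
    simp only [Matrix.mul_zero, Matrix.zero_mul] at h4
    rw [← h4]
    calc _ = ((N.map π).transpose.adjugate * (N.map π).transpose) * M.map π
          * (N.map π * (N.map π).adjugate) := by
          rw [Matrix.adjugate_mul, Matrix.mul_adjugate, Matrix.det_transpose]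
          simp
      _ = _ := by simp only [Matrix.mul_assoc]
  have h5 : M.map π = 0 := by
    rw [smul_eq_zero, smul_eq_zero] at h3
    exact (h3.resolve_left hdet).resolve_left hdet
  exact Ideal.Quotient.eq_zero_iff_mem.mp (congrFun (congrFun h5 l) k)

end Commutative

/-! ### Points of V(Q), reducedness, and the origin. -/

section Points

variable {ι : Type} [Fintype ι] {Q : Ideal (MvPolynomial ι ℂ)} [hQ : Q.IsPrime]

/-- Nullstellensatz: if Q had no zero besides the origin, every variable would vanish on V(Q). -/
theorem exists_ne_zero_eval_eq_zero {j : ι} (hj : X j ∉ Q) :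
    ∃ x : ι → ℂ, x ≠ 0 ∧ ∀ q ∈ Q, eval x q = 0 := by
  by_contra! hcon
  apply hj
  rw [← IsPrime.vanishingIdeal_zeroLocus (K := ℂ) Q, mem_vanishingIdeal_iff]
  intro x hx
  by_cases hx0 : x = 0
  · simp [hx0]
  · obtain ⟨q, hq, hne⟩ := hcon x hx0
    exact absurd (by simpa [aeval_eq_eval] using hx q hq) hne

omit [Fintype ι] in
-- Localization at Q factors through the local ring at a point x of V(Q), so reducedness at x passes
-- to Q.
theorem IsReducedAt.mem_localIdeal_of_pow {J : Ideal (MvPolynomial ι ℂ)} {x : ι → ℂ}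
    (h : IsReducedAt J x) (hx : ∀ q ∈ Q, eval x q = 0) {y : MvPolynomial ι ℂ} {N : ℕ}
    (hy : y ^ N ∈ localIdeal J Q) : y ∈ localIdeal J Q := by
  obtain ⟨w, hw, hwy⟩ := hy
  have : (RingHom.ker (eval x)).IsPrime := RingHom.ker_isPrime _
  have h1 : (w * y) ^ (N + 1) ∈ J := by
    have : (w * y) ^ (N + 1) = w ^ N * y * (w * y ^ N) := by ring
    rw [this]
    exact J.mul_mem_left _ hwy
  have h2 := Ideal.mem_map_of_mem (algebraMap (MvPolynomial ι ℂ)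
    (Localization.AtPrime (RingHom.ker (eval x)))) h1
  rw [map_pow] at h2
  have h3 := h ⟨_, h2⟩
  rw [IsLocalization.algebraMap_mem_map_algebraMap_iff (RingHom.ker (eval x)).primeCompl] at h3
  obtain ⟨v, hv, hvy⟩ := h3
  refine ⟨v * w, fun h0 => ?_, by rwa [mul_assoc]⟩
  rcases hQ.mem_or_mem h0 with h0 | h0
  · exact hv (hx v h0)
  · exact hw h0

omit [Fintype ι] hQ in
theorem sub_C_constantCoeff_mem (hX : ∀ j, X j ∈ Q) (p : MvPolynomial ι ℂ) :
    p - C (constantCoeff p) ∈ Q := by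
  induction p using MvPolynomial.induction_on with
  | C c => simp
  | add p q hp hq =>
    have := Q.add_mem hp hq
    rw [map_add, C_add]
    convert this using 1
    ring
  | mul_X p i hp =>
    simp only [map_mul, constantCoeff_X, mul_zero, map_zero, sub_zero]
    exact Q.mul_mem_left _ (hX i)

omit [Fintype ι] hQ in
theorem mem_of_isHomogeneous (hX : ∀ j, X j ∈ Q) {p : MvPolynomial ι ℂ} {d : ℕ}
    (hp : p.IsHomogeneous d) (hd : d ≠ 0) : p ∈ Q := by
  have h := sub_C_constantCoeff_mem hX p
  rwa [constantCoeff_eq, hp.coeff_eq_zero (by simpa using hd.symm), map_zero, sub_zero] at h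

end Points

/-! ### Degrees of the lifting and the number of rays. -/

section Lifting

variable {m n : ℕ} {Δ : SimplicialCompleteFan 2 m} {e : Fin m → ℕ}
  {F : Fin m → MvPolynomial (Fin (n + 1)) ℂ}

theorem IsPolynomialLifting.degree_ne_zero (hF : IsPolynomialLifting Δ e F)
    (hinj : Function.Injective (aeval (R := ℂ) F)) (i : Fin m) : e i ≠ 0 := by
  intro hi
  have h1 := hF.homogeneous i
  rw [hi, ← totalDegree_zero_iff_isHomogeneous, totalDegree_eq_zero_iff_eq_C] at h1
  have h2 : aeval F (X i : MvPolynomial (Fin m) ℂ) = aeval F (C (coeff 0 (F i))) := by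
    rw [aeval_X, aeval_C, algebraMap_eq, ← h1]
  have h3 := congrArg totalDegree (hinj h2)
  rw [totalDegree_X, totalDegree_C] at h3
  exact one_ne_zero h3

theorem IsPolynomialLifting.exists_three (hF : IsPolynomialLifting Δ e F)
    (hinj : Function.Injective (aeval (R := ℂ) F)) :
    ∃ r : Fin 3 → Fin m, Function.Injective r := by
  obtain ⟨i⟩ := nonempty_rays Δ
  obtain ⟨l, hl⟩ := exists_bracket_ne_zero Δ i
  have hil : i ≠ l := by rintro rfl; exact hl (bracket_self Δ i)
  have hk : ∃ k, k ≠ i ∧ k ≠ l := by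
    by_contra! hcon
    have h0 : ∑ k, (e k : ℤ) * bracket Δ i k = 0 := by
      have hr := hF.relation
      have h1 : ∀ c, ∑ k, (e k : ℤ) * Δ.ray k c = 0 := fun c => by
        have := congrFun hr c
        simpa using this
      have : ∑ k, (e k : ℤ) * bracket Δ i k =
          Δ.ray i 0 * ∑ k, (e k : ℤ) * Δ.ray k 1 - Δ.ray i 1 * ∑ k, (e k : ℤ) * Δ.ray k 0 := by
        rw [Finset.mul_sum, Finset.mul_sum, ← Finset.sum_sub_distrib]
        refine Finset.sum_congr rfl fun k _ => ?_
        simp only [bracket]; ring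
      rw [this, h1, h1]; simp
    rw [Finset.sum_eq_single l] at h0
    · rcases mul_eq_zero.mp h0 with h | h
      · exact hF.degree_ne_zero hinj l (by exact_mod_cast h)
      · exact hl h
    · intro k _ hkl
      rw [show k = i by by_contra hki; exact hkl (hcon k hki), bracket_self, mul_zero]
    · simp
  obtain ⟨k, hki, hkl⟩ := hk
  refine ⟨![i, l, k], ?_⟩
  intro a b hab
  fin_cases a <;> fin_cases b <;> simp_all

/-- A prime minimal over a pair of elements does not contain three of the variables. -/
theorem exists_X_notMem {p : Ideal (MvPolynomial (Fin m) ℂ)} [hp : p.IsPrime]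
    {r : Fin 3 → Fin m} (hr : Function.Injective r) {f g : MvPolynomial (Fin m) ℂ}
    (hf : f ∈ p) (hg : g ∈ p) (h : p ≤ localIdeal (Ideal.span {f, g}) p) : ∃ i, X i ∉ p := by
  by_contra! hX
  -- Differentiating modulo p would express three independent dX's, up to units, through df and dg
  -- alone.
  have h1 : ∀ a : Fin 3, ∃ u c d, u ∉ p ∧ u * X (r a) = c * f + d * g := by
    intro a
    obtain ⟨u, hu, hux⟩ := h (hX (r a))
    obtain ⟨c, d, hcd⟩ := Ideal.mem_span_pair.mp hux
    exact ⟨u, c, d, hu, hcd.symm⟩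
  choose u c d hu hcd using h1
  let π := Ideal.Quotient.mk p
  have h2 := diagonal_three_eq_zero (fun a => π (u a)) (fun a => π (c a)) (fun a => π (d a))
    (fun b => π (pderiv (r b) f)) (fun b => π (pderiv (r b) g)) (by
      intro a b
      have h3 := pderiv_combination_mem (p := p) (f := ![f, g]) (c := ![c a, d a])
        (by intro k; fin_cases k <;> simpa) (hX (r a)) (by simpa using hcd a) (r b)
      rw [← Ideal.Quotient.eq_zero_iff_mem] at h3
      simp only [Fin.sum_univ_two, Matrix.cons_val_zero, Matrix.cons_val_one, map_sub, map_add,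
        map_mul] at h3
      rw [sub_eq_zero] at h3
      rw [← h3]
      by_cases hab : a = b
      · subst hab; simp [π]
      · rw [if_neg hab, pderiv_X_of_ne fun h => hab (hr h)]
        simp)
  simp only [← map_mul] at h2
  have h3 := Ideal.Quotient.eq_zero_iff_mem.mp h2
  rcases hp.mem_or_mem h3 with h3 | h3
  · exact (hp.mem_or_mem h3).elim (hu 0) (hu 1)
  · exact hu 2 h3

end Lifting

/-! ### Critical points -/

theorem exists_linearIndependent_comp {K ι : Type*} [Field K] {m : ℕ} (v : ι → Fin m → K)
    (h : Submodule.span K (Set.range v) = ⊤) :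
    ∃ c : Fin m → ι, LinearIndependent K (fun k => v (c k)) := by
  obtain ⟨κ, a, _, hspan, hli⟩ := exists_linearIndependent' K v
  have b := Module.Basis.mk hli (by rw [hspan, h])
  have e := b.indexEquiv (Pi.basisFun K (Fin m))
  exact ⟨fun k => a (e.symm k), hli.comp e.symm e.symm.injective⟩

section Critical

variable {m n : ℕ} {Δ : SimplicialCompleteFan 2 m} {D : ClassGroup Δ} {α : OneForm (Fin m)}
  {F : Fin m → MvPolynomial (Fin (n + 1)) ℂ}

/-- The columns of the Jacobian matrix of `F` and the radial vectors along `F`. -/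
def tangentField (Δ : SimplicialCompleteFan 2 m) (F : Fin m → MvPolynomial (Fin (n + 1)) ℂ) :
    Fin (n + 1) ⊕ {a : Fin m → ℤ // IsRelation Δ a} → Fin m → MvPolynomial (Fin (n + 1)) ℂ :=
  Sum.elim (fun j i => pderiv j (F i)) (fun a i => (a.1 i : MvPolynomial (Fin (n + 1)) ℂ) * F i)

theorem span_eval_tangentField {x : Fin (n + 1) → ℂ} (hx0 : x ≠ 0)
    (hx : x ∉ criticalPoints Δ F) :
    Submodule.span ℂ (Set.range fun c i => eval x (tangentField Δ F c i)) = ⊤ := by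
  have h1 : LinearMap.range (jacobian F x).mulVecLin ⊔ orbitTangent Δ (evalMap F x) = ⊤ := by
    by_contra h
    exact hx ⟨hx0, h⟩
  rw [eq_top_iff, ← h1, Matrix.range_mulVecLin, orbitTangent, sup_le_iff, Submodule.span_le,
    Submodule.span_le]
  constructor
  · rintro _ ⟨j, rfl⟩
    exact Submodule.subset_span ⟨Sum.inl j, by ext i; simp [tangentField, jacobian]⟩
  · rintro _ ⟨a, ha, rfl⟩
    exact Submodule.subset_span ⟨Sum.inr ⟨a, ha⟩, by ext i; simp [tangentField, evalMap]⟩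

/-- Two Jacobian columns pair under dα to a coefficient of dω; a radial vector contracts dα to a
multiple of α. -/
theorem sum_extD_mul_tangentField_mem (hα : IsTwistedForm Δ D α)
    {Q : Ideal (MvPolynomial (Fin (n + 1)) ℂ)}
    (hL : Ideal.span (Set.range fun i => aeval F (α i)) ≤ Q)
    (hC : ∀ a b, extD (pullback F α) a b ∈ Q)
    (c c' : Fin (n + 1) ⊕ {a : Fin m → ℤ // IsRelation Δ a}) :
    ∑ l, ∑ k, aeval F (extD α l k) * tangentField Δ F c l * tangentField Δ F c' k ∈ Q := by
  have hrad : ∀ (a : {a : Fin m → ℤ // IsRelation Δ a}) k,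
      ∑ l, aeval F (extD α l k) * tangentField Δ F (Sum.inr a) l ∈ Q := by
    intro a k
    have h1 := congrArg (aeval F) (hα.contract_extD a.2 k)
    simp only [map_sum, map_mul, map_intCast, aeval_X] at h1
    have h2 : ∑ l, aeval F (extD α l k) * tangentField Δ F (Sum.inr a) l =
        ∑ l, (a.1 l : MvPolynomial (Fin (n + 1)) ℂ) * F l * aeval F (extD α l k) :=
      Finset.sum_congr rfl fun l _ => by simp only [tangentField, Sum.elim_inr]; ring
    rw [h2, h1]
    exact Q.mul_mem_left _ (hL (Ideal.subset_span ⟨k, rfl⟩))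
  rcases c with a | a
  · rcases c' with b | b
    · have h1 := hC a b
      rw [extD_pullback] at h1
      exact h1
    · refine Q.sum_mem fun l _ => ?_
      have h2 : ∑ k, aeval F (extD α l k) * tangentField Δ F (Sum.inl a) l *
          tangentField Δ F (Sum.inr b) k = -(tangentField Δ F (Sum.inl a) l *
          ∑ k, aeval F (extD α k l) * tangentField Δ F (Sum.inr b) k) := by
        rw [Finset.mul_sum, ← Finset.sum_neg_distrib]
        refine Finset.sum_congr rfl fun k _ => ?_
        rw [extD_antisymm α k l, map_neg]
        ring
      rw [h2]
      exact Q.neg_mem (Q.mul_mem_left _ (hrad b l))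
  · rw [Finset.sum_comm]
    refine Q.sum_mem fun k _ => ?_
    rw [← Finset.sum_mul]
    exact Q.mul_mem_right _ (hrad a k)

/-- If `ω` and `dω` vanish along a component through a regular point of `F`, so does `dα`. -/
theorem extD_mem_of_notMem_criticalPoints (hα : IsTwistedForm Δ D α)
    {Q : Ideal (MvPolynomial (Fin (n + 1)) ℂ)} [Q.IsPrime]
    (hL : Ideal.span (Set.range fun i => aeval F (α i)) ≤ Q)
    (hC : ∀ a b, extD (pullback F α) a b ∈ Q) {x : Fin (n + 1) → ℂ} (hx0 : x ≠ 0)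
    (hx : x ∉ criticalPoints Δ F) (hQx : ∀ q ∈ Q, eval x q = 0) (i j : Fin m) :
    aeval F (extD α i j) ∈ Q := by
  -- Some m of the vectors form a basis at x, so their matrix has determinant outside Q and the
  -- congruence can be undone modulo Q.
  obtain ⟨c, hc⟩ := exists_linearIndependent_comp _ (span_eval_tangentField hx0 hx)
  refine mem_of_congruent_mem (Matrix.of fun l k => tangentField Δ F (c k) l)
    (Matrix.of fun l k => aeval F (extD α l k)) (fun hdet => ?_)
    (fun k k' => sum_extD_mul_tangentField_mem hα hL hC (c k) (c k')) i j
  have h1 := hQx _ hdet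
  rw [RingHom.map_det] at h1
  have h2 : LinearIndependent ℂ (Matrix.col ((eval x).mapMatrix
      (Matrix.of fun l k => tangentField Δ F (c k) l))) := hc
  rw [Matrix.linearIndependent_cols_iff_isUnit, Matrix.isUnit_iff_isUnit_det] at h2
  exact h2.ne_zero h1

end Critical

/-! ### Common factors -/

section CommonFactor

variable {R : Type*} [CommRing R] [IsDomain R] [UniqueFactorizationMonoid R]

omit [IsDomain R] in
theorem exists_common_factor {κ : Type*} [Fintype κ] {ω : κ → R} (hω : ω ≠ 0) :
    ∃ (φ : R) (ω' : κ → R), φ ≠ 0 ∧ (∀ r, ω r = φ * ω' r) ∧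
      ∀ d, (∀ r, d ∣ ω' r) → IsUnit d := by
  classical
  let _ := UniqueFactorizationMonoid.strongNormalizationMonoid (α := R)
  let _ := UniqueFactorizationMonoid.toNormalizedGCDMonoid R
  obtain ⟨r, hr⟩ := Function.ne_iff.mp hω
  obtain ⟨ω', h1, h2⟩ := Finset.extract_gcd ω (s := Finset.univ) ⟨r, Finset.mem_univ r⟩
  refine ⟨Finset.univ.gcd ω, ω', fun h0 => hr ?_, fun r => h1 r (Finset.mem_univ r), fun d hd => ?_⟩
  · exact Finset.gcd_eq_zero_iff.mp h0 r (Finset.mem_univ r)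
  · rw [isUnit_iff_dvd_one, ← h2]
    exact Finset.dvd_gcd fun r _ => hd r

theorem dvd_of_dvd_mul_of_isRelPrime {φ x f g : R} (hfg : IsRelPrime f g) (hf : φ ∣ x * f)
    (hg : φ ∣ x * g) : φ ∣ x := by
  by_cases hx : x = 0
  · simp [hx]
  obtain ⟨b, a, k, hab, rfl, rfl⟩ := UniqueFactorizationMonoid.exists_reduced_factors x hx φ
  have hk : k ≠ 0 := left_ne_zero_of_mul hx
  rw [mul_assoc, mul_dvd_mul_iff_left hk] at hf hg
  have hu := hfg (hab.symm.dvd_of_dvd_mul_left hf) (hab.symm.dvd_of_dvd_mul_left hg)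
  exact mul_dvd_mul_left k hu.dvd

theorem exists_prime_dvd_of_height_le_one [IsNoetherianRing R] {P : Ideal R} [hP : P.IsPrime]
    (hbot : P ≠ ⊥) (hht : P.height ≤ 1) : ∃ π, Prime π ∧ ∀ x ∈ P, π ∣ x := by
  obtain ⟨π, hπ, hpr⟩ := Ideal.IsPrime.exists_mem_prime_of_ne_bot hP hbot
  refine ⟨π, hpr, ?_⟩
  by_contra! h
  obtain ⟨r, hr, hπr⟩ := h
  exact two_le_height_of_isRelPrime hπ hr (hpr.irreducible.isRelPrime_iff_not_dvd.mpr hπr) hht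

/-- A prime of height at most two containing elements without a common factor is minimal over the
ideal they generate. -/
theorem mem_minimalPrimes_of_no_common_factor [IsNoetherianRing R] {κ : Type*} {ω' : κ → R}
    {Q : Ideal R} [hQ : Q.IsPrime] (hgcd : ∀ d, (∀ r, d ∣ ω' r) → IsUnit d)
    (hht : Q.height ≤ 2) (hmem : ∀ r, ω' r ∈ Q) :
    Q ∈ (Ideal.span (Set.range ω')).minimalPrimes := by
  refine ⟨⟨hQ, Ideal.span_le.mpr (by rintro _ ⟨r, rfl⟩; exact hmem r)⟩, fun P hP hPQ => ?_⟩
  by_contra hne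
  have := hP.1
  have hPr : ∀ r, ω' r ∈ P := fun r => hP.2 (Ideal.subset_span ⟨r, rfl⟩)
  have h1 := (Ideal.height_strict_mono_of_isPrime_of_isPrime (lt_of_le_not_ge hPQ hne)).trans_le hht
  rw [show (2 : ℕ∞) = 1 + 1 by norm_num] at h1
  have h2 : P.height ≤ 1 := (ENat.lt_add_one_iff (by simp)).mp h1
  by_cases hbot : P = ⊥
  · subst hbot
    exact not_isUnit_zero (hgcd 0 fun r => by rw [Ideal.mem_bot.mp (hPr r)])
  · obtain ⟨π, hπ, hdvd⟩ := exists_prime_dvd_of_height_le_one hbot h2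
    exact hπ.not_isUnit (hgcd π fun r => hdvd _ (hPr r))

end CommonFactor

/-! ### Components of the singular scheme of a pullback along which `dω` vanishes -/

section Component

variable {m n : ℕ} {α : OneForm (Fin m)} {F : Fin m → MvPolynomial (Fin (n + 1)) ℂ}
  {Q : Ideal (MvPolynomial (Fin (n + 1)) ℂ)} [hQ : Q.IsPrime]
  {i j : Fin m} {c f g : MvPolynomial (Fin (n + 1)) ℂ}

/-- `dω` does not vanish identically along a component of the scheme `Sing(ω)` where this scheme
coincides with the zero scheme of `F^*α`. -/
theorem not_le_localIdeal_singularIdeal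
    (h : ∀ i j k, α i * extD α j k + α j * extD α k i + α k * extD α i j = 0)
    (hL : Ideal.span (Set.range fun i => aeval F (α i)) ≤ Q)
    (hC : ∀ a b, extD (pullback F α) a b ∈ Q)
    (hi : aeval F (α i) = c * f) (hj : aeval F (α j) = c * g)
    (hfg : IsRelPrime f g) (hf : f ∈ Q) (hg : g ∈ Q) (hD : aeval F (extD α i j) ∉ Q)
    (hle : Q ≤ localIdeal (singularIdeal (pullback F α)) Q) : False := by
  set D := aeval F (extD α i j) with hDdef
  have hcomb : ∀ x ∈ Q, ∃ w ∉ Q, ∃ a : Fin (n + 1) → MvPolynomial (Fin (n + 1)) ℂ,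
      ∑ r, a r * pullback F α r = w * x := by
    intro x hx
    obtain ⟨w, hw, hwx⟩ := hle hx
    exact ⟨w, hw, Ideal.mem_span_range_iff_exists_fun.mp hwx⟩
  obtain ⟨w, hw, a, ha⟩ := hcomb f hf
  obtain ⟨v, hv, b, hb⟩ := hcomb g hg
  set Gi := contractPullback F α i with hGi
  set Gj := contractPullback F α j with hGj
  -- From D ω = c (g G_i − f G_j) and the coprimality of f and g, the expressions of w f and v g
  -- through the coefficients of ω yield congruences modulo Q.
  have hω : ∀ r, D * pullback F α r = c * (g * Gi r - f * Gj r) := by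
    intro r
    rw [hDdef, aeval_extD_mul_pullback F h, hi, hj]
    ring
  have hdot : ∀ a : Fin (n + 1) → MvPolynomial (Fin (n + 1)) ℂ,
      D * ∑ r, a r * pullback F α r =
        c * (g * ∑ r, a r * Gi r - f * ∑ r, a r * Gj r) := by
    intro a
    simp only [Finset.mul_sum, ← Finset.sum_sub_distrib]
    refine Finset.sum_congr rfl fun r _ => ?_
    linear_combination a r * hω r
  have h1 := hdot a
  have h2 := hdot b
  rw [ha] at h1
  rw [hb] at h2
  have hdet : c ^ 2 * ((∑ r, a r * Gi r) * (∑ s, b s * Gj s) -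
      (∑ r, a r * Gj r) * ∑ s, b s * Gi s) ∈ Q := by
    refine Q.mul_mem_left _ ?_
    rw [Finset.sum_mul_sum, Finset.sum_mul_sum, ← Finset.sum_sub_distrib]
    refine Q.sum_mem fun r _ => ?_
    rw [← Finset.sum_sub_distrib]
    refine Q.sum_mem fun s _ => ?_
    have h3 := hL (contract_pluecker_mem F h i j r s)
    have h4 := Q.mul_mem_left D (hC r s)
    have h5 := Q.mul_mem_left (a r * b s) (Q.sub_mem h4 h3)
    convert h5 using 1
    ring
  obtain ⟨k, hk⟩ : g ∣ D * w + c * ∑ r, a r * Gj r :=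
    hfg.symm.dvd_of_dvd_mul_left ⟨c * ∑ r, a r * Gi r, by linear_combination h1⟩
  obtain ⟨k', hk'⟩ : f ∣ D * v - c * ∑ r, b r * Gi r :=
    hfg.dvd_of_dvd_mul_left ⟨-(c * ∑ r, b r * Gj r), by linear_combination h2⟩
  obtain ⟨k₁, hk₁⟩ : f ∣ c * ∑ r, a r * Gi r :=
    hfg.dvd_of_dvd_mul_left ⟨D * w + c * ∑ r, a r * Gj r, by linear_combination -h1⟩
  have h6 : D * w + c * ∑ r, a r * Gj r ∈ Q := by
    rw [hk]; exact Q.mul_mem_right _ hg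
  have h7 : D * v - c * ∑ r, b r * Gi r ∈ Q := by
    rw [hk']; exact Q.mul_mem_right _ hf
  have h8 : c * ∑ r, a r * Gi r ∈ Q := by
    rw [hk₁]; exact Q.mul_mem_right _ hf
  -- Modulo Q one has D w ≡ −c a·G_j, D v ≡ c b·G_i and c a·G_i ≡ 0, while (G_i ∧ G_j)(a, b) ≡ D
  -- dω(a, b) ≡ 0.
  have h9 : D * w * (D * v) ∈ Q := by
    have h10 := Q.add_mem hdet (Q.add_mem (Q.sub_mem (Q.mul_mem_left (D * v) h6)
      (Q.mul_mem_left (c * ∑ r, a r * Gj r) h7)) (Q.mul_mem_left (-(c * ∑ r, b r * Gj r)) h8))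
    convert h10 using 1
    ring
  rcases hQ.mem_or_mem h9 with h9 | h9
  · exact (hQ.mem_or_mem h9).elim hD hw
  · exact (hQ.mem_or_mem h9).elim hD hv

/-- The form `ω` divided by its divisorial part does not vanish identically along a component
through points where `Sing(ω)` is reduced. -/
theorem exists_reduced_form_notMem
    (h : ∀ i j k, α i * extD α j k + α j * extD α k i + α k * extD α i j = 0)
    (hL : Ideal.span (Set.range fun i => aeval F (α i)) ≤ Q)
    (hC : ∀ a b, extD (pullback F α) a b ∈ Q)
    (hi : aeval F (α i) = c * f) (hj : aeval F (α j) = c * g)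
    (hfg : IsRelPrime f g) (hf : f ∈ Q) (hg : g ∈ Q) (hD : aeval F (extD α i j) ∉ Q)
    (hht : Q.height ≤ 2)
    (hR : ∀ y N, y ^ N ∈ localIdeal (singularIdeal (pullback F α)) Q →
      y ∈ localIdeal (singularIdeal (pullback F α)) Q)
    {φ : MvPolynomial (Fin (n + 1)) ℂ} {ω' : OneForm (Fin (n + 1))} (hφ : φ ≠ 0)
    (hω' : ∀ r, pullback F α r = φ * ω' r) (hgcd : ∀ d, (∀ r, d ∣ ω' r) → IsUnit d) :
    ∃ r, ω' r ∉ Q := by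
  by_contra! hmem
  have hmin := mem_minimalPrimes_of_no_common_factor hgcd hht hmem
  have hmul : ∀ x ∈ Ideal.span (Set.range ω'), φ * x ∈ singularIdeal (pullback F α) := by
    intro x hx
    obtain ⟨a, rfl⟩ := Ideal.mem_span_range_iff_exists_fun.mp hx
    rw [Finset.mul_sum]
    refine Ideal.sum_mem _ fun r _ => ?_
    rw [mul_left_comm, ← hω']
    exact Ideal.mul_mem_left _ _ (mem_singularIdeal _ r)
  -- If φ ∈ Q, a power φ^(N+1) lies locally in J(ω) = φ J(ω'); by reducedness so does φ, and
  -- cancelling φ puts a unit at Q into J(ω') ⊆ Q.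
  by_cases hφQ : φ ∈ Q
  · obtain ⟨N, w, hw, hwφ⟩ := exists_pow_mem_localIdeal_of_mem_minimalPrimes hmin hφQ
    obtain ⟨w', hw', h1⟩ := hR φ (N + 1) ⟨w, hw, by
      have := hmul _ hwφ
      rwa [mul_left_comm, ← pow_succ'] at this⟩
    obtain ⟨a, ha⟩ := Ideal.mem_span_range_iff_exists_fun.mp h1
    apply hw'
    have h2 : w' = ∑ r, a r * ω' r := by
      apply mul_right_cancel₀ hφ
      rw [← ha, Finset.sum_mul]
      exact Finset.sum_congr rfl fun r _ => by rw [hω']; ring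
    rw [h2]
    exact Q.sum_mem fun r _ => Q.mul_mem_left _ (hmem r)
  -- With φ a unit at Q, reducedness gives J(ω) = Q locally.
  · refine not_le_localIdeal_singularIdeal h hL hC hi hj hfg hf hg hD fun q hq => ?_
    obtain ⟨N, w, hw, hwq⟩ := exists_pow_mem_localIdeal_of_mem_minimalPrimes hmin hq
    refine hR q N ⟨φ * w, fun h0 => (hQ.mem_or_mem h0).elim hφQ hw, ?_⟩
    rw [mul_assoc]
    exact hmul _ hwq

/-- The kernel of the reduced form `ω'` preserves the zero scheme of `F^*α`. -/
theorem height_le_one_of_reduced_form_notMem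
    (h : ∀ i j k, α i * extD α j k + α j * extD α k i + α k * extD α i j = 0)
    (hinj : Function.Injective (aeval (R := ℂ) F))
    (hmin : Q ∈ (Ideal.span (Set.range fun i => aeval F (α i))).minimalPrimes)
    (hi : aeval F (α i) = c * f) (hj : aeval F (α j) = c * g) (hc : c ∉ Q)
    (hfg : IsRelPrime f g) (hD : aeval F (extD α i j) ∉ Q)
    {φ : MvPolynomial (Fin (n + 1)) ℂ} {ω' : OneForm (Fin (n + 1))} (hφ : φ ≠ 0)
    (hω' : ∀ r, pullback F α r = φ * ω' r) {r : Fin (n + 1)} (hr : ω' r ∉ Q) :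
    Q.height ≤ 1 := by
  set L := Ideal.span (Set.range fun i => aeval F (α i)) with hLdef
  -- Both c f dω = ω ∧ G_i and c g dω = ω ∧ G_j are divisible by φ, hence so is c dω. The quotient ν
  -- satisfies ω' ∧ ν = 0.
  have hdvd : ∀ a b, φ ∣ c * extD (pullback F α) a b := by
    have hB : ∀ l a b, φ ∣ aeval F (α l) * extD (pullback F α) a b := fun l a b => by
      rw [aeval_mul_extD_pullback F h, hω', hω']
      exact dvd_sub (Dvd.intro _ (mul_assoc _ _ _).symm) (Dvd.intro _ (mul_assoc _ _ _).symm)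
    intro a b
    refine dvd_of_dvd_mul_of_isRelPrime hfg ?_ ?_
    · have := hB i a b
      rwa [hi, mul_right_comm] at this
    · have := hB j a b
      rwa [hj, mul_right_comm] at this
  choose ν hν using hdvd
  have hων : ∀ a b d, ω' a * ν b d + ω' b * ν d a + ω' d * ν a b = 0 := by
    intro a b d
    have h1 := pullback_integrable F h a b d
    apply mul_left_cancel₀ hφ
    apply mul_left_cancel₀ hφ
    rw [mul_zero, mul_zero]
    simp only [hω'] at h1
    linear_combination c * h1 - φ * ω' a * hν b d - φ * ω' b * hν d a - φ * ω' d * hν a b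
  have hanti : ∀ a b, ν b a = - ν a b := by
    intro a b
    apply mul_left_cancel₀ hφ
    rw [← hν, extD_antisymm]
    linear_combination -hν a b
  refine height_le_one_of_derivations_preserve Q ω' hr fun k q hq => ?_
  let v : Fin (n + 1) → MvPolynomial (Fin (n + 1)) ℂ := Pi.single k (ω' r) - Pi.single r (ω' k)
  have hv : ∀ y : Fin (n + 1) → MvPolynomial (Fin (n + 1)) ℂ,
      ∑ a, v a * y a = ω' r * y k - ω' k * y r := by
    intro y
    simp [v, sub_mul, Finset.sum_sub_distrib, Pi.single_apply]
  -- Since ω'(v) = 0, contracting ω' ∧ ν = 0 makes i_v ν a multiple of ω'. Independence of the dF_l,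
  -- which follows from injectivity of F^*, splits this into c G_l(v) = ν_{rk} A_l(F).
  have hcontr : ∀ l, ∑ a, v a * contractPullback F α l a ∈ localIdeal L Q := by
    have h0 := eq_zero_of_sum_mul_pderiv_eq_zero hinj
      (c := fun l => c * (∑ a, v a * contractPullback F α l a) - ν r k * aeval F (α l)) (by
        intro b
        have h1 : ∑ l, (∑ a, v a * contractPullback F α l a) * pderiv b (F l) =
            ∑ a, v a * extD (pullback F α) b a := by
          simp only [extD_pullback_eq_contract, Finset.mul_sum, Finset.sum_mul]
          rw [Finset.sum_comm]
          exact Finset.sum_congr rfl fun a _ => Finset.sum_congr rfl fun l _ => by ring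
        simp only [sub_mul, Finset.sum_sub_distrib, mul_assoc, ← Finset.mul_sum]
        rw [h1, hv]
        have h2 : ∑ l, aeval F (α l) * pderiv b (F l) = φ * ω' b := hω' b
        rw [h2]
        linear_combination ω' r * hν b k - ω' k * hν b r - φ * hων r k b
          + φ * ω' r * hanti k b)
    intro l
    have h1 := congrFun h0 l
    simp only [Pi.zero_apply, sub_eq_zero] at h1
    refine mem_localIdeal_of_mul_mem hc (le_localIdeal ?_)
    rw [h1]
    exact L.mul_mem_left _ (Ideal.subset_span ⟨l, rfl⟩)
  let δ : Derivation ℂ (MvPolynomial (Fin (n + 1)) ℂ) (MvPolynomial (Fin (n + 1)) ℂ) :=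
    ω' r • pderiv k - ω' k • pderiv r
  have hδ : ∀ x, δ x = ω' r * pderiv k x - ω' k * pderiv r x := fun x => by
    simp [δ]
  have hδL : ∀ x ∈ L, δ x ∈ localIdeal L Q := by
    intro x hx
    induction hx using Submodule.span_induction with
    | mem x hx =>
      obtain ⟨l, rfl⟩ := hx
      have h1 := derivation_mul_extD_mem F h (I := localIdeal L Q) le_localIdeal v hcontr l i j
      rw [hv] at h1
      rw [hδ]
      exact mem_localIdeal_of_mul_mem hD h1
    | zero => rw [map_zero]; exact Ideal.zero_mem _
    | add x y _ _ hx hy => rw [map_add]; exact Ideal.add_mem _ hx hy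
    | smul t x hxL hx =>
      rw [smul_eq_mul, Derivation.leibniz, smul_eq_mul, smul_eq_mul]
      exact Ideal.add_mem _ (Ideal.mul_mem_left _ _ hx)
        (Ideal.mul_mem_right _ _ (le_localIdeal hxL))
  obtain ⟨N, hN⟩ := exists_pow_mem_localIdeal_of_mem_minimalPrimes hmin hq
  rw [← hδ]
  exact derivation_mem_of_pow_mem hmin.1.2 hδL hN

end Component

/-! ### Associated primes of the pulled-back ideal for a generic pair. -/

section Generic

variable {m n : ℕ} {Δ : SimplicialCompleteFan 2 m} {D : ClassGroup Δ} {α : OneForm (Fin m)}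
  {e : Fin m → ℕ} {F : Fin m → MvPolynomial (Fin (n + 1)) ℂ}

theorem singularIdeal_map_aeval (F : Fin m → MvPolynomial (Fin (n + 1)) ℂ)
    (α : OneForm (Fin m)) : (singularIdeal α).map (aeval (R := ℂ) F).toRingHom =
      Ideal.span (Set.range fun i => aeval F (α i)) := by
  rw [singularIdeal, Ideal.map_span, ← Set.range_comp]
  rfl

/-- Along a component `p` of the singular scheme where `dα` does not vanish, `α` is defined by two
coefficients, which become relatively prime after removing a factor that is a unit along `p`. -/
theorem exists_reduced_coefficients
    (h : ∀ i j k, α i * extD α j k + α j * extD α k i + α k * extD α i j = 0)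
    (hrad : (singularIdeal α).IsRadical) (hht : 2 ≤ (singularIdeal α).height)
    {p : Ideal (MvPolynomial (Fin m) ℂ)} [hp : p.IsPrime]
    (hmin : p ∈ (singularIdeal α).minimalPrimes) {i j : Fin m} (hD : extD α i j ∉ p) :
    p ≤ localIdeal (Ideal.span {α i, α j}) p ∧
      ∃ d s t, α i = d * s ∧ α j = d * t ∧ d ∉ p ∧ s ∈ p ∧ t ∈ p ∧ IsRelPrime s t := by
  have hα_mem : ∀ i, α i ∈ p := fun i => hmin.1.2 (mem_singularIdeal α i)
  have hle : singularIdeal α ≤ localIdeal (Ideal.span {α i, α j}) p := by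
    rw [singularIdeal, Ideal.span_le]
    rintro _ ⟨k, rfl⟩
    refine ⟨extD α i j, hD, ?_⟩
    rw [extD_mul h]
    exact Ideal.sub_mem _ (Ideal.mul_mem_left _ _ (Ideal.subset_span (by simp)))
      (Ideal.mul_mem_left _ _ (Ideal.subset_span (by simp)))
  have hpij := (le_localIdeal_of_mem_minimalPrimes hrad hmin).trans (localIdeal_le_localIdeal hle)
  refine ⟨hpij, ?_⟩
  obtain ⟨d, s, t, hs, ht, hor⟩ := exists_reduced_pair (α i) (α j)
  -- Otherwise p would lie locally in the principal ideal (d) and have height at most one.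
  have hd : d ∉ p := by
    intro hd
    have h1 : p ≤ localIdeal (Ideal.span {d}) p := hpij.trans (localIdeal_mono (by
      rw [Ideal.span_le]
      rintro x (rfl | rfl)
      · exact Ideal.mem_span_singleton.mpr ⟨s, hs⟩
      · exact Ideal.mem_span_singleton.mpr ⟨t, ht⟩))
    have h2 := (hht.trans (Ideal.height_mono hmin.1.2)).trans (height_le_one_of_le_localIdeal hd h1)
    exact absurd h2 (by norm_num)
  refine ⟨d, s, t, hs, ht, hd, ?_, ?_, hor.resolve_left fun h0 => hd (h0 ▸ p.zero_mem)⟩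
  · exact (hp.mem_or_mem (hs ▸ hα_mem i)).resolve_left hd
  · exact (hp.mem_or_mem (ht ▸ hα_mem j)).resolve_left hd

/-- For a generic pair with flat lifting, `dω` does not vanish identically along any associated
component of the zero scheme of `F^*α`. -/
theorem exists_extD_pullback_notMem (hα : IsTwistedForm Δ D α) (hF : IsPolynomialLifting Δ e F)
    (hgen : IsGenericPair Δ F α) (hflat : (aeval (R := ℂ) F).toRingHom.Flat)
    {Q : Ideal (MvPolynomial (Fin (n + 1)) ℂ)} [hQ : Q.IsPrime]
    {y : MvPolynomial (Fin (n + 1)) ℂ}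
    (hy : ∀ r, r ∈ Q ↔ r * y ∈ Ideal.span (Set.range fun i => aeval F (α i))) :
    ∃ a b, extD (pullback F α) a b ∉ Q := by
  by_contra! hC
  set L := Ideal.span (Set.range fun i => aeval F (α i)) with hLdef
  have hint := hα.integrable
  have hinj : Function.Injective (aeval (R := ℂ) F) := injective_of_flat hflat
  have hLQ : L ≤ Q := fun x hx => (hy x).mpr (L.mul_mem_right _ hx)
  have hpmin := comap_mem_minimalPrimes_of_flat hflat hgen.radical (Q := Q) (y := y)
    (by rwa [singularIdeal_map_aeval])
  set p := Q.comap (aeval (R := ℂ) F).toRingHom with hpdef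
  have hpp : p.IsPrime := Ideal.comap_isPrime _ _
  have hmem : ∀ x, x ∈ p ↔ aeval F x ∈ Q := fun x => Iff.rfl
  have hdesc : Descends Δ α := hα.descends
  obtain ⟨i, j, hD⟩ := hdesc.exists_extD_notMem hgen.radical hgen.three_le_height hpmin
  obtain ⟨hpij, d, s, t, hs, ht, hd, hsp, htp, hst⟩ :=
    exists_reduced_coefficients hint hgen.radical hgen.two_le_height hpmin hD
  have hi : aeval F (α i) = aeval F d * aeval F s := by rw [hs, map_mul]
  have hj : aeval F (α j) = aeval F d * aeval F t := by rw [ht, map_mul]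
  rw [hmem] at hD hd hsp htp
  have hs0 : s ≠ 0 := by
    rintro rfl
    exact hQ.ne_top (Ideal.eq_top_of_isUnit_mem _ htp ((hst (dvd_zero t) dvd_rfl).map _))
  have hfg : IsRelPrime (aeval F s) (aeval F t) := isRelPrime_map_of_flat hflat hs0 hst
  -- L and (s(F), t(F)) agree at Q, where D(F) and d(F) are units, so Q is associated to the pair
  -- with witness D(F) y.
  have hcol : IsPairColon Q (aeval F s) (aeval F t) (aeval F (extD α i j) * y) := by
    intro r
    constructor
    · intro hr
      rw [mul_left_comm]
      have h1 : ∀ x ∈ L, aeval F (extD α i j) * x ∈ Ideal.span {aeval F s, aeval F t} := by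
        intro x hx
        induction hx using Submodule.span_induction with
        | mem x hx =>
          obtain ⟨k, rfl⟩ := hx
          have h2 := congrArg (aeval F) (extD_mul hint i j k)
          simp only [map_mul, map_sub] at h2
          simp only [h2, hi, hj]
          exact Ideal.sub_mem _
            (Ideal.mul_mem_left _ _ (Ideal.mul_mem_left _ _ (Ideal.subset_span (by simp))))
            (Ideal.mul_mem_left _ _ (Ideal.mul_mem_left _ _ (Ideal.subset_span (by simp))))
        | zero => simp
        | add x y _ _ hx hy => rw [mul_add]; exact Ideal.add_mem _ hx hy
        | smul t x _ hx => rw [smul_eq_mul, mul_left_comm]; exact Ideal.mul_mem_left _ _ hx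
      exact h1 _ ((hy r).mp hr)
    · intro hr
      obtain ⟨a, b, hab⟩ := Ideal.mem_span_pair.mp hr
      have h1 : aeval F d * aeval F (extD α i j) * r ∈ Q := by
        rw [hy]
        have h2 : aeval F d * aeval F (extD α i j) * r * y =
            a * aeval F (α i) + b * aeval F (α j) := by
          rw [hi, hj]
          linear_combination -aeval F d * hab
        rw [h2]
        exact L.add_mem (L.mul_mem_left _ (Ideal.subset_span ⟨i, rfl⟩))
          (L.mul_mem_left _ (Ideal.subset_span ⟨j, rfl⟩))
      exact (hQ.mem_or_mem h1).resolve_left fun h2 => (hQ.mem_or_mem h2).elim hd hD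
  have hht2 : Q.height ≤ 2 := pairUnmixed_mvPolynomial ℂ (n + 1) _ _ _ Q hQ hfg hcol
  have hht1 : ¬ Q.height ≤ 1 := two_le_height_of_isRelPrime hsp htp hfg
  have hQmin : Q ∈ L.minimalPrimes := by
    refine mem_minimalPrimes_of_isRelPrime hfg hht2 hLQ fun P hP hLP hPQ => ⟨?_, ?_⟩
    · have h1 : aeval F (α i) ∈ P := hLP (Ideal.subset_span ⟨i, rfl⟩)
      rw [hi] at h1
      exact (hP.mem_or_mem h1).resolve_left fun h2 => hd (hPQ h2)
    · have h1 : aeval F (α j) ∈ P := hLP (Ideal.subset_span ⟨j, rfl⟩)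
      rw [hj] at h1
      exact (hP.mem_or_mem h1).resolve_left fun h2 => hd (hPQ h2)
  -- Otherwise every F_l, being of positive degree, lies in Q, so p contains all of at least three
  -- variables although two elements generate it locally.
  obtain ⟨k, hk⟩ : ∃ k, X k ∉ Q := by
    by_contra! hX
    obtain ⟨r, hr⟩ := hF.exists_three hinj
    obtain ⟨l, hl⟩ := exists_X_notMem hr (hpmin.1.2 (mem_singularIdeal α i))
      (hpmin.1.2 (mem_singularIdeal α j)) hpij
    refine hl ?_
    rw [hmem, aeval_X]
    exact mem_of_isHomogeneous hX (hF.homogeneous l) (hF.degree_ne_zero hinj l)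
  obtain ⟨x, hx0, hx⟩ := exists_ne_zero_eval_eq_zero hk
  have hcrit : x ∈ criticalPoints Δ F := by
    by_contra hcon
    exact hD (extD_mem_of_notMem_criticalPoints hα hLQ hC hx0 hcon hx i j)
  have hR : ∀ z N, z ^ N ∈ localIdeal (singularIdeal (pullback F α)) Q →
      z ∈ localIdeal (singularIdeal (pullback F α)) Q := fun z N hz =>
    (hgen.reduced_along x hcrit).mem_localIdeal_of_pow hx hz
  have hω : pullback F α ≠ 0 := by
    intro h0
    have h1 := eq_zero_of_sum_mul_pderiv_eq_zero hinj (c := fun l => aeval F (α l))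
      (fun b => congrFun h0 b)
    have h2 : aeval F s = 0 := by
      have h3 := congrFun h1 i
      simp only [hi, Pi.zero_apply] at h3
      exact (mul_eq_zero.mp h3).resolve_left fun h4 => hd (h4 ▸ Q.zero_mem)
    exact hs0 (hinj (by rw [h2, map_zero]))
  obtain ⟨φ, ω', hφ, hω', hgcd⟩ := exists_common_factor hω
  obtain ⟨r, hr⟩ := exists_reduced_form_notMem hint hLQ hC hi hj hfg hsp htp hD hht2 hR hφ hω' hgcd
  exact hht1 (height_le_one_of_reduced_form_notMem hint hinj hQmin hi hj hd hfg hD hφ hω' hr)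

end Generic

end ToricFoliation

end

theorem proposition6p16 {m n : ℕ} (Δ : ToricFoliation.SimplicialCompleteFan 2 m)
    (D : ToricFoliation.ClassGroup Δ) (α : ToricFoliation.OneForm (Fin m))
    (hα : ToricFoliation.IsTwistedForm Δ D α)
    (e : Fin m → ℕ) (F : Fin m → MvPolynomial (Fin (n + 1)) ℂ)
    (hF : ToricFoliation.IsPolynomialLifting Δ e F)
    (hgen : ToricFoliation.IsGenericPair Δ F α)
    (hflat : (MvPolynomial.aeval (R := ℂ) F).toRingHom.Flat) :
    ToricFoliation.unfoldingsIdeal (ToricFoliation.pullback F α)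
        = ToricFoliation.kupkaIdeal (ToricFoliation.pullback F α) ∧
      ToricFoliation.kupkaIdeal (ToricFoliation.pullback F α)
        = Ideal.span (Set.range fun i => MvPolynomial.aeval F (α i)) := by
  have h1 := ToricFoliation.span_le_unfoldingsIdeal F hα.integrable
  have h2 := ToricFoliation.unfoldingsIdeal_le_kupkaIdeal (ToricFoliation.pullback F α)
  have h3 := ToricFoliation.kupkaIdeal_le (ToricFoliation.singularIdeal_pullback_le F α)
    fun Q y hQ hy hC => by
      obtain ⟨a, b, hab⟩ := ToricFoliation.exists_extD_pullback_notMem hα hF hgen hflat hy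
      exact hab (hC a b)
  exact ⟨le_antisymm h2 (h3.trans h1), le_antisymm h3 (h1.trans h2)⟩
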